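/- **Conventions.** A monoid is a commutative monoid with an absorbing element $0$. Its spectrum $\operatorname{spec}A$ is the set of prime ideals with the topology generated by the sets $D_f=\{\mathfrak p\mid f\notin\mathfrak p\}$ and the structure sheaf with $\mathcal O(D_f)=A_f$. An $\mathcal M_0$-scheme $\widetilde X$ is a topological space with a sheaf of monoids that is covered by open subsets isomorphic to spectra of monoids; it is Noetherian if it is quasi-compact and covered by spectra of finitely generated monoids. For a monoid $A$ put $A_{\mathbb Z}=\mathbb Z[A]/(1\cdot 0_A)$; gluing the schemes $\operatorname{Spec}\mathcal O(U)_{\mathbb Z}$ over the affine open $U\subset\widetilde X$ gives the scheme $\widetilde X_{\mathbb Z}$. An $\mathbb F_1$-scheme is a triple $\mathcal X=(\widetilde X,X,e_X)$ of an $\mathcal M_0$-scheme $\widetilde X$, a scheme $X$ and a morphism $e_X:\widetilde X_{\mathbb Z}\to X$ that induces a bijection $\widetilde X_{\mathbb Z}(k)\to X(k)$ for every field $k$. It is Noetherian if $\widetilde X$ and $X$ are Noetherian. An $\mathcal O_{\widetilde X}$-module is a sheaf $\widetilde M$ of pointed sets with an action of $\mathcal O_{\widetilde X}$ such that $0$ sends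 every section to the base point $*$ and $*$ is fixed; it is coherent if it is, locally on affine open subsets $U$, associated (by localization) with a finitely generated $\mathcal O(U)$-set. Its base extension $\widetilde M_{\mathbb Z}$ to $\widetilde X_{\mathbb Z}$ is $\beta^{-1}\widetilde M\otimes_{\beta^{-1}\mathcal O_{\widetilde X}}\mathcal O_{\widetilde X_{\mathbb Z}}$, where $\beta:\widetilde X_{\mathbb Z}\to\widetilde X$ is the canonical map. An $\mathcal O_{\mathcal X}$-module is a triple $\mathcal M=(\widetilde M,M,\epsilon_M)$ of an $\mathcal O_{\widetilde X}$-module $\widetilde M$, an $\mathcal O_X$-module $M$ and an isomorphism $\epsilon_M:\widetilde M_{\mathbb Z}\to e_X^*M$; it is coherent if $\widetilde M$ and $M$ are. A morphism is a pair $(\widetilde f,f)$ of morphisms with $\epsilon_N\circ\widetilde f_{\mathbb Z}=e_X^*(f)\circ\epsilon_M$. The full subcategory of coherent modules is $\operatorname{Coh}\mathcal X$. A morphism $(\widetilde f,f):\mathcal M\to\mathcal N$ is normal if, on each stalk, every fibre of $\widetilde f_x$ other than the fibre of the base point has at most one element, and $0\to e_X^*(\ker f)\to e_X^*M\to e_X^*N$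 is exact. A sequence $\mathcal M_1\xrightarrow{\varphi}\mathcal M_2\xrightarrow{\psi}\mathcal M_3$ is exact at $\mathcal M_2$ if the kernel of $\psi$ exists in the category of $\mathcal O_{\mathcal X}$-modules and is equal to the (componentwise) image of $\varphi$. An admissible short exact sequence in $\operatorname{Coh}\mathcal X$ is a five term sequence $0\to\mathcal M_1\xrightarrow{\varphi}\mathcal M_2\xrightarrow{\psi}\mathcal M_3\to0$ of coherent modules that is exact at $\mathcal M_1$, $\mathcal M_2$ and $\mathcal M_3$ and for which $\varphi$ and $\psi$ are normal. An admissible monomorphism (epimorphism) is a morphism that occurs as $\varphi$ (as $\psi$) in such a sequence. **Proposition.** Let $\mathcal X=(\widetilde X,X,e_X)$ be a Noetherian $\mathbb F_1$-scheme. Then $\operatorname{Coh}\mathcal X$, with the class of admissible short exact sequences, is a quasi-exact category, that is: 1. A five term sequence in $\operatorname{Coh}\mathcal X$ that is isomorphic to an admissible short exact sequence is an admissible short exact sequence. 2. The composition of two admissible monomorphisms is an admissible monomorphism, and the composition of two admissible epimorphisms is an admissible epimorphism. 3. For an admissible monomorphism $i:\mathcal M\to\mathcal N$ and an admissible epimorphism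 $j:\mathcal P\to\mathcal N$, the fibre product $\mathcal M\times_{\mathcal N}\mathcal P$ exists in $\operatorname{Coh}\mathcal X$, the base change $\mathcal M\times_{\mathcal N}\mathcal P\to\mathcal P$ of $i$ is an admissible monomorphism, and the base change $\mathcal M\times_{\mathcal N}\mathcal P\to\mathcal M$ of $j$ is an admissible epimorphism. -/

import Mathlib

open CategoryTheory Limits TopologicalSpace Opposite AlgebraicGeometry
universe u v

noncomputable section

namespace F1

/-! ### Base extension of monoids and of `A`-sets -/

section BaseExtension

variable (A : Type u) [CommMonoidWithZero A]

/-- The base extension `A_ℤ = ℤ[A] / (1 · 0_A)` of a monoid with zero. -/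
def ZRing : Type u := MonoidAlgebra ℤ A ⧸ Ideal.span {MonoidAlgebra.of ℤ A (0 : A)}

instance : CommRing (ZRing A) :=
  inferInstanceAs (CommRing (MonoidAlgebra ℤ A ⧸ Ideal.span {MonoidAlgebra.of ℤ A (0 : A)}))

variable {A} in
/-- The quotient map `ℤ[A] → A_ℤ`. -/
def ZRing.mk : MonoidAlgebra ℤ A →+* ZRing A :=
  Ideal.Quotient.mk (Ideal.span {MonoidAlgebra.of ℤ A (0 : A)})

variable {A} in
/-- The element `1 · a` of `A_ℤ`. -/
def ZRing.of : A →*₀ ZRing A where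
  toFun a := ZRing.mk (MonoidAlgebra.of ℤ A a)
  map_zero' := Ideal.Quotient.eq_zero_iff_mem.2 (Ideal.subset_span rfl)
  map_one' := by rw [map_one, map_one]
  map_mul' a b := by rw [map_mul, map_mul]

variable {A} in
/-- The linear extension of a multiplicative map to a ring. -/
def ZRing.lift {R : Type v} [Ring R] (f : A →*₀ R) : ZRing A →+* R :=
  Ideal.Quotient.lift _ (MonoidAlgebra.lift ℤ R A (f : A →* R)).toRingHom (by
    intro a ha
    have : Ideal.span {MonoidAlgebra.of ℤ A (0 : A)} ≤
        RingHom.ker (MonoidAlgebra.lift ℤ R A (f : A →* R)).toRingHom := by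
      rw [Ideal.span_le]
      rintro _ rfl
      simp [RingHom.mem_ker]
    exact this ha)

variable {A}

@[simp] theorem ZRing.lift_of {R : Type v} [Ring R] (f : A →*₀ R) (a : A) :
    ZRing.lift f (ZRing.of a) = f a := by
  refine (Ideal.Quotient.lift_mk _ _ _).trans ?_
  simp

theorem ZRing.hom_ext {R : Type v} [Ring R] {f g : ZRing A →+* R}
    (h : ∀ a, f (ZRing.of a) = g (ZRing.of a)) : f = g := by
  apply Ideal.Quotient.ringHom_ext
  apply MonoidAlgebra.ringHom_ext
  · intro r
    have : ∀ φ : MonoidAlgebra ℤ A →+* R, φ (MonoidAlgebra.single 1 r) = r := by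
      intro φ
      rw [← map_intCast φ r]
      rfl
    rw [this, this]
  · intro a; exact h a

theorem ZRing.addHom_ext {G : Type v} [AddCommGroup G] {f g : ZRing A →+ G}
    (h : ∀ a, f (ZRing.of a) = g (ZRing.of a)) : f = g := by
  apply QuotientAddGroup.addMonoidHom_ext
  apply MonoidAlgebra.addHom_ext'
  intro a
  apply AddMonoidHom.ext_int
  exact h a

variable {B : Type u} [CommMonoidWithZero B]

/-- Functoriality of `A ↦ A_ℤ`. -/
def ZRing.map (f : A →*₀ B) : ZRing A →+* ZRing B :=
  ZRing.lift (ZRing.of.comp f)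

@[simp] theorem ZRing.map_of (f : A →*₀ B) (a : A) :
    ZRing.map f (ZRing.of a) = ZRing.of (f a) := by
  simp [ZRing.map]

/-- The base extension `M_ℤ` of a pointed set: the free abelian group on the elements of `M`
in which the base point is set to zero. -/
def ZSet (M : Type u) [Zero M] : Type u :=
  (M →₀ ℤ) ⧸ Submodule.span ℤ {Finsupp.single (0 : M) (1 : ℤ)}

instance (M : Type u) [Zero M] : AddCommGroup (ZSet M) :=
  inferInstanceAs (AddCommGroup ((M →₀ ℤ) ⧸ Submodule.span ℤ {Finsupp.single (0 : M) (1 : ℤ)}))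

section
variable {M : Type u} [Zero M] {N : Type u} [Zero N] {P : Type u} [Zero P]

/-- The generator `1 · m` of `M_ℤ`. -/
def ZSet.of (m : M) : ZSet M := Submodule.Quotient.mk (Finsupp.single m 1)

@[simp] theorem ZSet.of_zero : ZSet.of (0 : M) = 0 :=
  (Submodule.Quotient.mk_eq_zero _).2 (Submodule.subset_span rfl)

theorem ZSet.addHom_ext {G : Type v} [AddCommGroup G] {f g : ZSet M →+ G}
    (h : ∀ m, f (ZSet.of m) = g (ZSet.of m)) : f = g := by
  apply QuotientAddGroup.addMonoidHom_ext
  apply Finsupp.addHom_ext'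
  intro m
  apply AddMonoidHom.ext_int
  exact h m

/-- The additive extension of a base point preserving map. -/
def ZSet.map (f : M → N) (hf : f 0 = 0) : ZSet M →+ ZSet N :=
  (Submodule.mapQ _ _ (Finsupp.lmapDomain ℤ ℤ f) (by
    rw [Submodule.span_le]
    rintro _ rfl
    simp [hf])).toAddMonoidHom

@[simp] theorem ZSet.map_of (f : M → N) (hf : f 0 = 0) (m : M) :
    ZSet.map f hf (ZSet.of m) = ZSet.of (f m) := by
  change (Submodule.Quotient.mk (Finsupp.lmapDomain ℤ ℤ f (Finsupp.single m 1)) :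
    (N →₀ ℤ) ⧸ Submodule.span ℤ {Finsupp.single (0 : N) (1 : ℤ)}) = _
  simp [ZSet.of]

theorem ZSet.map_eq_self (f : M → M) (hf : f 0 = 0) (h : ∀ m, f m = m) (x : ZSet M) :
    ZSet.map f hf x = x :=
  DFunLike.congr_fun (ZSet.addHom_ext (f := ZSet.map f hf) (g := AddMonoidHom.id _)
    fun m => by rw [ZSet.map_of, h]; rfl) x

theorem ZSet.map_eq_map_map (f : M → N) (hf : f 0 = 0) (g : N → P) (hg : g 0 = 0) (k : M → P)
    (hk : k 0 = 0) (h : ∀ m, k m = g (f m)) (x : ZSet M) :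
    ZSet.map k hk x = ZSet.map g hg (ZSet.map f hf x) :=
  DFunLike.congr_fun (ZSet.addHom_ext (f := ZSet.map k hk)
    (g := (ZSet.map g hg).comp (ZSet.map f hf))
    fun m => by simp [h]) x

theorem ZSet.map_map_eq {N' : Type u} [Zero N'] (f : M → N) (hf : f 0 = 0) (g : N → P)
    (hg : g 0 = 0) (f' : M → N') (hf' : f' 0 = 0) (g' : N' → P) (hg' : g' 0 = 0)
    (h : ∀ m, g (f m) = g' (f' m)) (x : ZSet M) :
    ZSet.map g hg (ZSet.map f hf x) = ZSet.map g' hg' (ZSet.map f' hf' x) :=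
  DFunLike.congr_fun (ZSet.addHom_ext (f := (ZSet.map g hg).comp (ZSet.map f hf))
    (g := (ZSet.map g' hg').comp (ZSet.map f' hf'))
    fun m => by simp [h]) x

end

variable (A) (M : Type u) [Zero M] [MulActionWithZero A M]

/-- The action of `A` on `M_ℤ` by linear extension. -/
def ZSet.act : A →*₀ AddMonoid.End (ZSet M) where
  toFun a := ZSet.map (fun m : M => a • m) (smul_zero a)
  map_zero' := ZSet.addHom_ext fun m => by
    rw [ZSet.map_of, zero_smul, ZSet.of_zero]; rfl
  map_one' := ZSet.addHom_ext fun m => by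
    rw [ZSet.map_of, one_smul]; rfl
  map_mul' a b := ZSet.addHom_ext fun m => by
    rw [ZSet.map_of, mul_smul]
    change _ = ZSet.map (fun m : M => a • m) (smul_zero a)
      (ZSet.map (fun m : M => b • m) (smul_zero b) (ZSet.of m))
    rw [ZSet.map_of, ZSet.map_of]

/-- The `A_ℤ`-module structure on `M_ℤ`. -/
instance ZSet.module : Module (ZRing A) (ZSet M) :=
  Module.compHom (ZSet M) (ZRing.lift (ZSet.act A M))

variable {A M}

@[simp] theorem ZSet.of_smul_of (a : A) (m : M) :
    (ZRing.of a : ZRing A) • (ZSet.of m : ZSet M) = ZSet.of (a • m) := by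
  change (ZRing.lift (ZSet.act A M) (ZRing.of a)) (ZSet.of m) = _
  rw [ZRing.lift_of]
  exact ZSet.map_of (fun m : M => a • m) (smul_zero a) m

/-- A map which is equivariant for a morphism of monoids induces a semilinear map. -/
theorem ZSet.map_smul' {N : Type u} [Zero N] [MulActionWithZero B N] (θ : A →*₀ B)
    (f : M → N) (hf : f 0 = 0) (h : ∀ (a : A) (m : M), f (a • m) = θ a • f m)
    (r : ZRing A) (x : ZSet M) :
    ZSet.map f hf (r • x) = ZRing.map θ r • ZSet.map f hf x := by
  let F : ZRing A →+ ZSet M →+ ZSet N :=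
    { toFun := fun r => (ZSet.map f hf).comp (DistribSMul.toAddMonoidHom _ r)
      map_zero' := by ext; simp
      map_add' := fun r s => by ext; simp [add_smul] }
  let G : ZRing A →+ ZSet M →+ ZSet N :=
    { toFun := fun r => (DistribSMul.toAddMonoidHom _ (ZRing.map θ r)).comp (ZSet.map f hf)
      map_zero' := by ext; simp
      map_add' := fun r s => by ext; simp [add_smul] }
  have : F = G := ZRing.addHom_ext fun a => ZSet.addHom_ext fun m => by
    simp [F, G, h]
  exact DFunLike.congr_fun (DFunLike.congr_fun this r) x


section Localization

theorem ZRing.induction {p : ZRing A → Prop} (zero : p 0) (of : ∀ a, p (ZRing.of a))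
    (add : ∀ x y, p x → p y → p (x + y)) (neg : ∀ x, p x → p (-x)) (x : ZRing A) : p x := by
  let S : AddSubgroup (ZRing A) :=
    { carrier := {x | p x}
      zero_mem' := zero
      add_mem' := fun h h' => add _ _ h h'
      neg_mem' := fun h => neg _ h }
  have : QuotientAddGroup.mk' S = 0 := ZRing.addHom_ext fun a =>
    (QuotientAddGroup.eq_zero_iff _).2 (of a)
  exact (QuotientAddGroup.eq_zero_iff (N := S) x).1 (DFunLike.congr_fun this x)

theorem ZRing.isLocalization_away (θ : A →*₀ B) (f : A)
    (h : (Submonoid.powers f).IsLocalizationMap θ) :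
    letI := (ZRing.map θ).toAlgebra
    IsLocalization.Away (ZRing.of f : ZRing A) (ZRing B) := by
  let := (ZRing.map θ).toAlgebra
  have hal : ∀ x : ZRing A, algebraMap (ZRing A) (ZRing B) x = ZRing.map θ x := fun _ => rfl
  have hu : IsUnit (θ f) := h.map_units ⟨f, Submonoid.mem_powers f⟩
  constructor
  constructor
  · rintro ⟨_, n, rfl⟩
    rw [hal, map_pow, ZRing.map_of]
    exact (hu.map ZRing.of).pow n
  · intro z
    have key : ∃ (n : ℕ) (x : ZRing A), z * ZRing.of (θ f) ^ n = ZRing.map θ x := by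
      induction z using ZRing.induction with
      | zero => exact ⟨0, 0, by simp⟩
      | of b =>
        obtain ⟨⟨a, ⟨_, n, rfl⟩⟩, hab⟩ := h.surj b
        refine ⟨n, ZRing.of a, ?_⟩
        simp only [map_pow] at hab
        rw [ZRing.map_of, ← map_pow, ← map_mul, hab]
      | add x y hx hy =>
        obtain ⟨n, x', hx⟩ := hx
        obtain ⟨m, y', hy⟩ := hy
        refine ⟨n + m, x' * ZRing.of f ^ m + y' * ZRing.of f ^ n, ?_⟩
        rw [map_add, map_mul, map_mul, ← hx, ← hy, map_pow, map_pow, ZRing.map_of]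
        ring
      | neg x hx =>
        obtain ⟨n, x', hx⟩ := hx
        exact ⟨n, -x', by rw [map_neg, ← hx, neg_mul]⟩
    obtain ⟨n, x, hx⟩ := key
    refine ⟨⟨x, ⟨_, n, rfl⟩⟩, ?_⟩
    rw [hal, hal, ← hx, map_pow, ZRing.map_of]
  · intro x y hxy
    let L := Localization.Away (ZRing.of f : ZRing A)
    let ι := algebraMap (ZRing A) L
    let Θ : (Submonoid.powers f).LocalizationMap B :=
      { toFun := θ, map_mul' := map_mul θ, isLocalizationMap := h }
    let g : A →* L := ι.toMonoidHom.comp (ZRing.of (A := A)).toMonoidHom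
    have hg : ∀ s : Submonoid.powers f, IsUnit (g s) := by
      rintro ⟨_, n, rfl⟩
      change IsUnit (g (f ^ n))
      rw [map_pow]
      exact (IsLocalization.Away.algebraMap_isUnit (S := L) (ZRing.of f)).pow n
    have hΘ : ∀ a, Θ.lift hg (θ a) = g a := fun a => Θ.lift_eq hg a
    let ψ : B →*₀ L :=
      { Θ.lift hg with
        map_zero' := by
          have := hΘ 0
          rw [map_zero] at this
          refine this.trans ?_
          change ι (ZRing.of 0) = 0
          rw [map_zero, map_zero] }
    have : (ZRing.lift ψ).comp (ZRing.map θ) = ι := ZRing.hom_ext fun a => by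
      rw [RingHom.comp_apply, ZRing.map_of, ZRing.lift_of]
      exact hΘ a
    have hι : ι x = ι y := by
      rw [← this, RingHom.comp_apply, RingHom.comp_apply, ← hal, ← hal, hxy]
    exact IsLocalization.exists_of_eq (M := Submonoid.powers (ZRing.of f : ZRing A)) hι

theorem isOpenImmersion_specMap {R S : CommRingCat.{u}} (φ : R ⟶ S) (r : R)
    (h : letI := φ.hom.toAlgebra; IsLocalization.Away r S) :
    IsOpenImmersion (Spec.map φ) ∧ Set.range (Spec.map φ) = {x | r ∉ x.asIdeal} := by
  let := φ.hom.toAlgebra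
  let e : Localization.Away r ≃ₐ[R] S := IsLocalization.algEquiv (Submonoid.powers r) _ _
  have he : φ = CommRingCat.ofHom (algebraMap R (Localization.Away r)) ≫
      e.toRingEquiv.toCommRingCatIso.hom := by
    ext x
    exact (e.commutes x).symm
  refine ⟨?_, ?_⟩
  · rw [he, Spec.map_comp]
    infer_instance
  · exact PrimeSpectrum.localization_away_comap_range S r

end Localization

end BaseExtension

/-! ### Spectra of monoids and `M₀`-schemes -/

/-- A prime ideal of a monoid with zero. -/
@[ext]
structure MonSpec (A : Type u) [CommMonoidWithZero A] : Type u where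
  carrier : Set A
  zero_mem : 0 ∈ carrier
  mul_mem : ∀ (a : A) {b : A}, b ∈ carrier → a * b ∈ carrier
  one_notMem : 1 ∉ carrier
  mem_or_mem : ∀ {a b : A}, a * b ∈ carrier → a ∈ carrier ∨ b ∈ carrier

namespace MonSpec

variable {A : Type u} [CommMonoidWithZero A]

/-- The set `D_f` of prime ideals that do not contain `f`. -/
def basicOpen (f : A) : Set (MonSpec A) := {p | f ∉ p.carrier}

/-- The topology on the spectrum is generated by the sets `D_f`. -/
instance : TopologicalSpace (MonSpec A) := TopologicalSpace.generateFrom (Set.range basicOpen)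

theorem isOpen_basicOpen (f : A) : IsOpen (basicOpen f) :=
  TopologicalSpace.isOpen_generateFrom_of_mem ⟨f, rfl⟩

theorem mem_basicOpen_mul {f g : A} {p : MonSpec A} :
    p ∈ basicOpen (f * g) ↔ p ∈ basicOpen f ∧ p ∈ basicOpen g := by
  refine ⟨fun h => ⟨fun hf => h ?_, fun hg => h (p.mul_mem f hg)⟩, fun h hfg => ?_⟩
  · rw [mul_comm]
    exact p.mul_mem g hf
  · exact (p.mem_or_mem hfg).elim h.1 h.2

theorem exists_basicOpen {p : MonSpec A} {W : Set (MonSpec A)} (hW : IsOpen W) (hp : p ∈ W) :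
    ∃ f, p ∈ basicOpen f ∧ basicOpen f ⊆ W := by
  induction hW with
  | basic s hs =>
    obtain ⟨f, rfl⟩ := hs
    exact ⟨f, hp, subset_rfl⟩
  | univ => exact ⟨1, p.one_notMem, Set.subset_univ _⟩
  | inter s t _ _ ihs iht =>
    obtain ⟨f, hf, hfs⟩ := ihs hp.1
    obtain ⟨g, hg, hgt⟩ := iht hp.2
    refine ⟨f * g, mem_basicOpen_mul.2 ⟨hf, hg⟩, fun q hq => ?_⟩
    exact ⟨hfs (mem_basicOpen_mul.1 hq).1, hgt (mem_basicOpen_mul.1 hq).2⟩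
  | sUnion S _ ih =>
    obtain ⟨s, hs, hps⟩ := hp
    obtain ⟨f, hf, hfs⟩ := ih s hs hps
    exact ⟨f, hf, fun q hq => ⟨s, hs, hfs hq⟩⟩

/-- The prime ideal of non-units, of a non-trivial monoid. -/
def closedPoint [Nontrivial A] : MonSpec A where
  carrier := {a | ¬ IsUnit a}
  zero_mem := not_isUnit_zero
  mul_mem a b hb h := hb (isUnit_of_mul_isUnit_right h)
  one_notMem h := h isUnit_one
  mem_or_mem {a b} h := by
    by_contra hn
    simp only [Set.mem_ofPred_eq, not_or, not_not] at hn
    exact h (hn.1.mul hn.2)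

theorem basicOpen_of_isUnit {f : A} (hf : IsUnit f) : basicOpen f = Set.univ := by
  obtain ⟨⟨f, g, hfg, _⟩, rfl⟩ := hf
  refine Set.eq_univ_of_forall fun p hp => p.one_notMem ?_
  rw [← hfg, mul_comm]
  exact p.mul_mem g hp

theorem eq_univ_of_closedPoint_mem [Nontrivial A] {W : Set (MonSpec A)} (hW : IsOpen W)
    (h : closedPoint ∈ W) : W = Set.univ := by
  obtain ⟨f, hf, hfW⟩ := exists_basicOpen hW h
  have hu : IsUnit f := not_not.1 hf
  rw [basicOpen_of_isUnit hu] at hfW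
  exact Set.univ_subset_iff.1 hfW

theorem isEmpty_of_subsingleton [Subsingleton A] : IsEmpty (MonSpec A) :=
  ⟨fun p => p.one_notMem (by rw [Subsingleton.elim (1 : A) 0]; exact p.zero_mem)⟩

variable {B : Type u} [CommMonoidWithZero B]

/-- The preimage of a prime ideal. -/
def comap (θ : A →*₀ B) (q : MonSpec B) : MonSpec A where
  carrier := θ ⁻¹' q.carrier
  zero_mem := by simpa using q.zero_mem
  mul_mem a b hb := by
    simp only [Set.mem_preimage, map_mul]
    exact q.mul_mem _ hb
  one_notMem h := q.one_notMem (by simpa using h)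
  mem_or_mem {a b} h := by
    simp only [Set.mem_preimage, map_mul] at h
    exact q.mem_or_mem h

theorem pow_notMem {p : MonSpec A} {f : A} (h : f ∉ p.carrier) (n : ℕ) : f ^ n ∉ p.carrier := by
  induction n with
  | zero => simpa using p.one_notMem
  | succ n ih =>
    rw [pow_succ]
    exact fun hm => (p.mem_or_mem hm).elim ih h

theorem isUnit_notMem {p : MonSpec A} {f : A} (h : IsUnit f) : f ∉ p.carrier := by
  have : p ∈ basicOpen f := by rw [basicOpen_of_isUnit h]; trivial
  exact this

theorem mul_mem_iff {p : MonSpec A} {a b : A} (hb : b ∉ p.carrier) :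
    a * b ∈ p.carrier ↔ a ∈ p.carrier := by
  refine ⟨fun h => (p.mem_or_mem h).resolve_right hb, fun h => ?_⟩
  rw [mul_comm]
  exact p.mul_mem _ h

/-- The spectrum of a localization `A_f` is homeomorphic to `D_f`. -/
theorem exists_homeomorph (θ : A →*₀ B) (f : A) (h : (Submonoid.powers f).IsLocalizationMap θ) :
    ∃ e : MonSpec B ≃ₜ (basicOpen f : Set (MonSpec A)), ∀ q, (e q).1 = comap θ q := by
  have hu : IsUnit (θ f) := h.map_units ⟨f, Submonoid.mem_powers f⟩
  have hsurj : ∀ b : B, ∃ (a : A) (n : ℕ), b * θ f ^ n = θ a := fun b => by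
    obtain ⟨⟨a, ⟨_, n, rfl⟩⟩, hab⟩ := h.surj b
    exact ⟨a, n, by simpa using hab⟩
  have hmem : ∀ (q : MonSpec B) (b : B) (a : A) (n : ℕ), b * θ f ^ n = θ a →
      (b ∈ q.carrier ↔ a ∈ (comap θ q).carrier) := fun q b a n hab => by
    change _ ↔ θ a ∈ q.carrier
    rw [← hab, mul_mem_iff (isUnit_notMem (hu.pow n))]
  have hcont : Continuous (comap θ) := continuous_generateFrom_iff.2 (by
    rintro _ ⟨a, rfl⟩
    exact isOpen_basicOpen (θ a))
  have hinj : Function.Injective (comap θ) := fun q q' hq => by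
    ext b
    obtain ⟨a, n, hab⟩ := hsurj b
    rw [hmem q b a n hab, hmem q' b a n hab, hq]
  have hrange : ∀ q, comap θ q ∈ basicOpen f := fun q => isUnit_notMem (p := q) hu
  have hind : Topology.IsInducing (comap θ) := by
    refine ⟨le_antisymm hcont.le_induced (le_generateFrom ?_)⟩
    rintro _ ⟨b, rfl⟩
    obtain ⟨a, n, hab⟩ := hsurj b
    refine ⟨basicOpen a, isOpen_basicOpen a, ?_⟩
    ext q
    exact not_congr (hmem q b a n hab).symm
  have hsurj' : ∀ p ∈ (basicOpen f : Set (MonSpec A)), ∃ q, comap θ q = p := fun p hp => by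
    have key : ∀ {a a' : A} {n n' : ℕ} {b : B}, b * θ f ^ n = θ a → b * θ f ^ n' = θ a' →
        a ∈ p.carrier → a' ∈ p.carrier := fun {a a' n n' b} e e' ha => by
      have : θ (a * f ^ n') = θ (a' * f ^ n) := by
        rw [map_mul, map_mul, map_pow, map_pow, ← e, ← e']
        rw [mul_assoc, mul_assoc, mul_comm (θ f ^ n)]
      obtain ⟨⟨_, k, rfl⟩, hk⟩ := h.exists_of_eq this
      have h1 : f ^ k * (a * f ^ n') ∈ p.carrier :=
        p.mul_mem _ ((mul_mem_iff (pow_notMem hp n')).2 ha)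
      rw [show f ^ k * (a * f ^ n') = f ^ k * (a' * f ^ n) from hk, mul_comm,
        mul_mem_iff (pow_notMem hp k), mul_mem_iff (pow_notMem hp n)] at h1
      exact h1
    refine ⟨⟨{b | ∃ a n, b * θ f ^ n = θ a ∧ a ∈ p.carrier}, ⟨0, 0, by simp, p.zero_mem⟩, ?_, ?_,
      ?_⟩, ?_⟩
    · rintro b c ⟨a, n, hca, ha⟩
      obtain ⟨a', n', hba⟩ := hsurj b
      refine ⟨a' * a, n' + n, ?_, p.mul_mem _ ha⟩
      rw [map_mul, ← hba, ← hca, pow_add]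
      exact mul_mul_mul_comm _ _ _ _
    · rintro ⟨a, n, h1, ha⟩
      exact p.one_notMem (key h1 (n' := 0) (a' := 1) (by simp) ha)
    · rintro b c ⟨a, n, hbc, ha⟩
      obtain ⟨a₁, n₁, h₁⟩ := hsurj b
      obtain ⟨a₂, n₂, h₂⟩ := hsurj c
      have := key hbc (n' := n₁ + n₂) (a' := a₁ * a₂)
        (by rw [map_mul, ← h₁, ← h₂, pow_add]; exact mul_mul_mul_comm _ _ _ _) ha
      exact (p.mem_or_mem this).imp (fun h => ⟨a₁, n₁, h₁, h⟩) (fun h => ⟨a₂, n₂, h₂, h⟩)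
    · ext a
      refine ⟨fun ⟨a', n, h', ha'⟩ => key h' (n' := 0) (by simp) ha', fun ha => ?_⟩
      exact ⟨a, 0, by simp, ha⟩
  let e₀ : MonSpec B ≃ (basicOpen f : Set (MonSpec A)) :=
    Equiv.ofBijective (fun q => ⟨comap θ q, hrange q⟩)
      ⟨fun q q' hq => hinj (Subtype.ext_iff.1 hq), fun p => by
        obtain ⟨q, hq⟩ := hsurj' p.1 p.2
        exact ⟨q, Subtype.ext hq⟩⟩
  exact ⟨e₀.toHomeomorphOfIsInducing (hind.codRestrict hrange), fun q => rfl⟩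

end MonSpec

/-- A monoidal space: a topological space with a sheaf of (commutative) monoids with zero. -/
structure MonoidalSpace where
  carrier : TopCat.{u}
  presheaf : TopCat.Presheaf (Type u) carrier
  isSheaf : presheaf.IsSheaf
  monoid (U : (Opens carrier)ᵒᵖ) : CommMonoidWithZero (presheaf.obj U)
  map_zero {U V : (Opens carrier)ᵒᵖ} (i : U ⟶ V) : presheaf.map i 0 = 0
  map_one {U V : (Opens carrier)ᵒᵖ} (i : U ⟶ V) : presheaf.map i 1 = 1
  map_mul {U V : (Opens carrier)ᵒᵖ} (i : U ⟶ V) (a b : presheaf.obj U) :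
    presheaf.map i (a * b) = presheaf.map i a * presheaf.map i b

namespace MonoidalSpace

attribute [instance] MonoidalSpace.monoid

variable (X : MonoidalSpace.{u})

/-- The restriction map of the structure sheaf. -/
def res {U V : Opens X.carrier} (h : V ≤ U) : X.presheaf.obj (op U) →*₀ X.presheaf.obj (op V) where
  toFun := X.presheaf.map (homOfLE h).op
  map_zero' := X.map_zero _
  map_one' := X.map_one _
  map_mul' := X.map_mul _

theorem res_refl {U : Opens X.carrier} (a : X.presheaf.obj (op U)) : X.res le_rfl a = a := by
  change X.presheaf.map (𝟙 _) a = a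
  simp

theorem res_res {U V W : Opens X.carrier} (h : V ≤ U) (h' : W ≤ V) (a : X.presheaf.obj (op U)) :
    X.res h' (X.res h a) = X.res (h'.trans h) a := by
  change X.presheaf.map _ (X.presheaf.map _ a) = X.presheaf.map _ a
  rw [← ConcreteCategory.comp_apply, ← X.presheaf.map_comp]
  rfl

/-- A homeomorphism `φ` of an open subset `U` with `spec 𝒪_X(U)` identifies `(U, 𝒪_X|_U)` with
`(spec 𝒪_X(U), 𝒪_{spec})`. Here the structure sheaf of a spectrum `spec A` is determined by its
sections `A_f` over the basis of open subsets `D_f`. -/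
def IsSpecChart (U : Opens X.carrier) (φ : U ≃ₜ MonSpec (X.presheaf.obj (op U))) : Prop :=
  ∀ (f : X.presheaf.obj (op U)) (V : Opens X.carrier) (h : V ≤ U),
    (∀ x : U, x.1 ∈ V ↔ φ x ∈ MonSpec.basicOpen f) →
      (Submonoid.powers f).IsLocalizationMap (X.res h)

/-- An open subset is affine if it is isomorphic, as a monoidal space, to the spectrum of a
monoid, which then has to be the monoid of its sections. -/
def IsAffineOpen (U : Opens X.carrier) : Prop :=
  ∃ φ : U ≃ₜ MonSpec (X.presheaf.obj (op U)), X.IsSpecChart U φ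

theorem exists_basic {U : Opens X.carrier} (φ : U ≃ₜ MonSpec (X.presheaf.obj (op U)))
    (f : X.presheaf.obj (op U)) :
    ∃ V : Opens X.carrier, V ≤ U ∧ ∀ x : U, x.1 ∈ V ↔ φ x ∈ MonSpec.basicOpen f := by
  refine ⟨⟨(↑) '' (φ ⁻¹' MonSpec.basicOpen f), U.isOpen.isOpenMap_subtype_val _
    ((MonSpec.isOpen_basicOpen f).preimage φ.continuous)⟩, ?_, fun x => ?_⟩
  · rintro _ ⟨x, _, rfl⟩
    exact x.2
  · exact ⟨fun ⟨y, hy, hyx⟩ => (Subtype.ext hyx : y = x) ▸ hy, fun h => ⟨x, h, rfl⟩⟩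

/-- Affine open subsets of affine open subsets are basic. -/
theorem exists_eq_basic {U V : Opens X.carrier} (φ : U ≃ₜ MonSpec (X.presheaf.obj (op U)))
    (hV : X.IsAffineOpen V) (h : V ≤ U) :
    ∃ f : X.presheaf.obj (op U), ∀ x : U, x.1 ∈ V ↔ φ x ∈ MonSpec.basicOpen f := by
  obtain ⟨ψ, -⟩ := hV
  rcases subsingleton_or_nontrivial (X.presheaf.obj (op V)) with hs | hn
  · refine ⟨0, fun x => ⟨fun hx => ?_, fun hx => (hx (φ x).zero_mem).elim⟩⟩
    exact (MonSpec.isEmpty_of_subsingleton.false (ψ ⟨x.1, hx⟩)).elim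
  · let v : V := ψ.symm MonSpec.closedPoint
    have hW : IsOpen (φ '' {x : U | x.1 ∈ V}) :=
      φ.isOpenMap _ (V.isOpen.preimage continuous_subtype_val)
    obtain ⟨f, hf, hfW⟩ := MonSpec.exists_basicOpen hW
      (p := φ ⟨v.1, h v.2⟩) ⟨_, v.2, rfl⟩
    refine ⟨f, fun x => ⟨fun hx => ?_, fun hx => ?_⟩⟩
    · let T : Set V := {y | φ ⟨y.1, h y.2⟩ ∈ MonSpec.basicOpen f}
      have hT : IsOpen T := (MonSpec.isOpen_basicOpen f).preimage
        (φ.continuous.comp (continuous_subtype_val.subtype_mk _))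
      have : ψ '' T = Set.univ := MonSpec.eq_univ_of_closedPoint_mem (ψ.isOpenMap _ hT)
        ⟨v, hf, ψ.apply_symm_apply _⟩
      obtain ⟨y, hy, hyx⟩ : ψ ⟨x.1, hx⟩ ∈ ψ '' T := by rw [this]; trivial
      have := ψ.injective hyx
      subst this
      exact hy
    · obtain ⟨y, hy, hyx⟩ := hfW hx
      have := φ.injective hyx
      subst this
      exact hy

theorem mul_pow_aux {M : Type*} [CommMonoid M] (z f g f' : M) (m n : ℕ) :
    z * g ^ m * (f * f') ^ (m + n * m) =
      z * (f * (g * f ^ n)) ^ m * f' ^ (m + n * m) := by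
  simp only [mul_pow, pow_add, pow_mul]
  ac_rfl

theorem mul_pow_aux' {M : Type*} [CommMonoid M] (x f g : M) (j n k l : ℕ) :
    f ^ (j + n * j + k + l) * (g ^ j * x) = (f * (g * f ^ n)) ^ j * (x * f ^ k * f ^ l) := by
  simp only [mul_pow, pow_add, pow_mul]
  ac_rfl

theorem mul_pow_aux'' {M : Type*} [CommMonoid M] (x f g : M) (j n k l : ℕ) :
    (f * (g * f ^ n)) ^ j * (x * f ^ l * f ^ k) = f ^ (j + n * j + k + l) * (g ^ j * x) := by
  simp only [mul_pow, pow_add, pow_mul]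
  ac_rfl

/-- Basic open subsets of affine open subsets are affine. -/
theorem isAffineOpen_basic {U V : Opens X.carrier} (φ : U ≃ₜ MonSpec (X.presheaf.obj (op U)))
    (hφ : X.IsSpecChart U φ) (f : X.presheaf.obj (op U)) (h : V ≤ U)
    (hV : ∀ x : U, x.1 ∈ V ↔ φ x ∈ MonSpec.basicOpen f) : X.IsAffineOpen V := by
  have hloc := hφ f V h hV
  obtain ⟨e, he⟩ := MonSpec.exists_homeomorph (X.res h) f hloc
  let ψ₀ : V ≃ₜ (MonSpec.basicOpen f : Set (MonSpec (X.presheaf.obj (op U)))) :=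
    { toFun := fun x => ⟨φ ⟨x.1, h x.2⟩, (hV ⟨x.1, h x.2⟩).1 x.2⟩
      invFun := fun p => ⟨(φ.symm p.1).1, (hV _).2 (by simp)⟩
      left_inv := fun x => by simp
      right_inv := fun p => by simp
      continuous_toFun := by fun_prop
      continuous_invFun := by fun_prop }
  refine ⟨ψ₀.trans e.symm, fun g W hW hg => ?_⟩
  have hcomap : ∀ x : V, MonSpec.comap (X.res h) (ψ₀.trans e.symm x) = φ ⟨x.1, h x.2⟩ := fun x => by
    rw [← he]
    simp [ψ₀]
  have hu : IsUnit (X.res h f) := hloc.map_units ⟨f, Submonoid.mem_powers f⟩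
  obtain ⟨⟨a, ⟨_, n, rfl⟩⟩, hga⟩ := hloc.surj g
  simp only [_root_.map_pow] at hga
  have hmem : ∀ x : V, g ∈ (ψ₀.trans e.symm x).carrier ↔ a ∈ (φ ⟨x.1, h x.2⟩).carrier := fun x => by
    rw [← hcomap x]
    change _ ↔ X.res h a ∈ (ψ₀.trans e.symm x).carrier
    rw [← hga, MonSpec.mul_mem_iff (MonSpec.isUnit_notMem (hu.pow n))]
  have hloc' := hφ (f * a) W (hW.trans h) (fun x => by
    rw [MonSpec.mem_basicOpen_mul, ← hV]
    constructor
    · intro hx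
      exact ⟨hW hx, (not_congr (hmem ⟨x.1, hW hx⟩)).1 ((hg ⟨x.1, hW hx⟩).1 hx)⟩
    · rintro ⟨hx, hx'⟩
      exact (hg ⟨x.1, hx⟩).2 ((not_congr (hmem ⟨x.1, hx⟩)).2 hx'))
  have huW : IsUnit (X.res hW (X.res h f)) := hu.map (X.res hW)
  have hgW : X.res hW g * X.res hW (X.res h f) ^ n = X.res hW (X.res h a) := by
    rw [← hga, _root_.map_mul, _root_.map_pow]
  have hfaW : IsUnit (X.res (hW.trans h) (f * a)) :=
    hloc'.map_units ⟨f * a, Submonoid.mem_powers _⟩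
  have hgu : IsUnit (X.res hW g) := by
    rw [_root_.map_mul, ← X.res_res h hW a, ← hgW] at hfaW
    exact isUnit_of_mul_isUnit_left (isUnit_of_mul_isUnit_right hfaW)
  refine ⟨?_, ?_, ?_⟩
  · rintro ⟨_, m, rfl⟩
    simp only [_root_.map_pow]
    exact hgu.pow m
  · intro z
    obtain ⟨⟨b, ⟨_, m, rfl⟩⟩, hz⟩ := hloc'.surj z
    obtain ⟨f', hf'⟩ := hu.exists_right_inv
    have hf'W : X.res hW (X.res h f) * X.res hW f' = 1 := by
      rw [← _root_.map_mul, hf', _root_.map_one]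
    refine ⟨⟨X.res h b * f' ^ (m + n * m), ⟨_, m, rfl⟩⟩, ?_⟩
    simp only [_root_.map_pow, _root_.map_mul, ← X.res_res h hW, ← hgW] at hz ⊢
    rw [← hz]
    calc z * X.res hW g ^ m = z * X.res hW g ^ m *
          (X.res hW (X.res h f) * X.res hW f') ^ (m + n * m) := by rw [hf'W, one_pow, mul_one]
      _ = _ := by
        exact mul_pow_aux _ _ _ _ _ _
  · intro x y hxy
    obtain ⟨⟨x₀, ⟨_, k, rfl⟩⟩, hx⟩ := hloc.surj x
    obtain ⟨⟨y₀, ⟨_, l, rfl⟩⟩, hy⟩ := hloc.surj y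
    simp only [_root_.map_pow] at hx hy
    have : X.res (hW.trans h) (x₀ * f ^ l) = X.res (hW.trans h) (y₀ * f ^ k) := by
      rw [← X.res_res h hW, ← X.res_res h hW]
      simp only [_root_.map_mul, _root_.map_pow]
      rw [← hx, ← hy]
      simp only [_root_.map_mul, _root_.map_pow]
      rw [hxy]
      ac_rfl
    obtain ⟨⟨_, j, rfl⟩, hj⟩ := hloc'.exists_of_eq this
    refine ⟨⟨_, j, rfl⟩, ?_⟩
    have hj' := congrArg (X.res h) hj
    simp only [_root_.map_mul, _root_.map_pow, ← hx, ← hy, ← hga] at hj'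
    change g ^ j * x = g ^ j * y
    refine (hu.pow (j + n * j + k + l)).mul_left_cancel ?_
    calc X.res h f ^ (j + n * j + k + l) * (g ^ j * x)
        = (X.res h f * (g * X.res h f ^ n)) ^ j *
            (x * X.res h f ^ k * X.res h f ^ l) := mul_pow_aux' _ _ _ _ _ _ _
      _ = (X.res h f * (g * X.res h f ^ n)) ^ j *
            (y * X.res h f ^ l * X.res h f ^ k) := hj'
      _ = _ := mul_pow_aux'' _ _ _ _ _ _ _

end MonoidalSpace
namespace MonoidalSpace

variable (X : MonoidalSpace.{u})

/-- The affine open subsets of `X`, ordered by inclusion. -/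
structure AffOpens : Type u where
  val : Opens X.carrier
  isAffineOpen : X.IsAffineOpen val

instance : Preorder X.AffOpens := Preorder.lift AffOpens.val

/-- The diagram of the affine schemes `Spec 𝒪_X(U)_ℤ`, for `U` affine open in `X`. -/
def affDiagram : X.AffOpens ⥤ Scheme.{u} where
  obj U := Spec (.of (ZRing (X.presheaf.obj (op U.1))))
  map {U V} i := Spec.map (CommRingCat.ofHom (ZRing.map (X.res (leOfHom i : U.1 ≤ V.1))))
  map_id U := by
    rw [← Spec.map_id]
    congr 1
    ext1
    refine ZRing.hom_ext fun a => ?_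
    refine (ZRing.map_of _ _).trans ?_
    rw [X.res_refl]
    rfl
  map_comp {U V W} i j := by
    rw [← Spec.map_comp]
    congr 1
    ext1
    refine ZRing.hom_ext fun a => ?_
    refine (ZRing.map_of _ _).trans ?_
    refine .trans ?_ (congrArg (ZRing.map _) (ZRing.map_of _ a)).symm
    rw [ZRing.map_of, X.res_res]

theorem affDiagram_map {U V : X.AffOpens} (i : U ⟶ V)
    (φ : V.1 ≃ₜ MonSpec (X.presheaf.obj (op V.1))) (hφ : X.IsSpecChart V.1 φ)
    (f : X.presheaf.obj (op V.1)) (hf : ∀ x : V.1, x.1 ∈ U.1 ↔ φ x ∈ MonSpec.basicOpen f) :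
    IsOpenImmersion (X.affDiagram.map i) ∧
      Set.range (X.affDiagram.map i) = {x | ZRing.of f ∉ x.asIdeal} :=
  isOpenImmersion_specMap _ _ (ZRing.isLocalization_away _ f (hφ f U.1 (leOfHom i) hf))

instance {U V : X.AffOpens} (i : U ⟶ V) : IsOpenImmersion (X.affDiagram.map i) := by
  obtain ⟨φ, hφ⟩ := V.2
  obtain ⟨f, hf⟩ := X.exists_eq_basic φ U.2 (leOfHom i)
  exact (X.affDiagram_map i φ hφ f hf).1

instance : (X.affDiagram ⋙ Scheme.forget).IsLocallyDirected where
  cond {U V W} i j x y h := by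
    change X.affDiagram.map i x = X.affDiagram.map j y at h
    obtain ⟨φ, hφ⟩ := W.2
    obtain ⟨f, hf⟩ := X.exists_eq_basic φ U.2 (leOfHom i)
    obtain ⟨g, hg⟩ := X.exists_eq_basic φ V.2 (leOfHom j)
    obtain ⟨T, hTW, hT⟩ := X.exists_basic φ (f * g)
    simp only [MonSpec.mem_basicOpen_mul, ← hf, ← hg] at hT
    have hT' : ∀ x : W.1, x.1 ∈ T ↔ φ x ∈ MonSpec.basicOpen (f * g) := fun x => by
      rw [hT, hf, hg, MonSpec.mem_basicOpen_mul]
    let T' : X.AffOpens := ⟨T, X.isAffineOpen_basic φ hφ _ hTW hT'⟩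
    let k : T' ⟶ U := homOfLE fun x hx => ((hT ⟨x, hTW hx⟩).1 hx).1
    let l : T' ⟶ V := homOfLE fun x hx => ((hT ⟨x, hTW hx⟩).1 hx).2
    have h1 : X.affDiagram.map i x ∈ Set.range (X.affDiagram.map (k ≫ i)) := by
      rw [(X.affDiagram_map (k ≫ i) φ hφ _ hT').2]
      have hx : X.affDiagram.map i x ∈ {x | ZRing.of f ∉ x.asIdeal} := by
        rw [← (X.affDiagram_map i φ hφ f hf).2]
        exact ⟨x, rfl⟩
      have hy : X.affDiagram.map i x ∈ {x | ZRing.of g ∉ x.asIdeal} := by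
        rw [← (X.affDiagram_map j φ hφ g hg).2, h]
        exact ⟨y, rfl⟩
      intro hm
      rw [_root_.map_mul] at hm
      exact ((X.affDiagram.map i x).isPrime.mem_or_mem hm).elim hx hy
    obtain ⟨z, hz⟩ := h1
    refine ⟨T', k, l, z, ?_, ?_⟩
    · apply (X.affDiagram.map i).isOpenEmbedding.injective
      rw [← hz, Functor.map_comp, Scheme.Hom.comp_apply]
      rfl
    · apply (X.affDiagram.map j).isOpenEmbedding.injective
      rw [← h, ← hz, show k ≫ i = l ≫ j from Subsingleton.elim _ _, Functor.map_comp,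
        Scheme.Hom.comp_apply]
      rfl

instance : Quiver.IsThin X.AffOpens := fun _ _ => inferInstance

/-- The base extension `X_ℤ` of an `M₀`-scheme `X`, obtained by gluing the affine schemes
`Spec 𝒪_X(U)_ℤ` along the affine open subsets `U` of `X`. -/
def baseChange : Scheme.{u} := colimit X.affDiagram

/-- The open immersion of `U_ℤ = Spec 𝒪_X(U)_ℤ` in `X_ℤ`. -/
def toBaseChange (U : X.AffOpens) :
    Spec (.of (ZRing (X.presheaf.obj (op U.1)))) ⟶ X.baseChange :=
  colimit.ι X.affDiagram U

instance (U : X.AffOpens) : IsOpenImmersion (X.toBaseChange U) :=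
  inferInstanceAs (IsOpenImmersion (colimit.ι X.affDiagram U))

theorem map_toBaseChange {U V : X.AffOpens} (i : U ⟶ V) :
    Spec.map (CommRingCat.ofHom (ZRing.map (X.res (leOfHom i : U.1 ≤ V.1)))) ≫ X.toBaseChange V =
      X.toBaseChange U :=
  colimit.w X.affDiagram i

end MonoidalSpace

/-! ### Sheaves of modules on `M₀`-schemes and their base extension -/

/-- An `𝒪_X`-module on a monoidal space: a sheaf of pointed sets with an action of `𝒪_X`. -/
structure SetSheaf (X : MonoidalSpace.{u}) where
  val : TopCat.Presheaf (Type u) X.carrier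
  isSheaf : val.IsSheaf
  zero (U : (Opens X.carrier)ᵒᵖ) : Zero (val.obj U)
  action (U : (Opens X.carrier)ᵒᵖ) : MulActionWithZero (X.presheaf.obj U) (val.obj U)
  map_smul {U V : (Opens X.carrier)ᵒᵖ} (i : U ⟶ V) (a : X.presheaf.obj U) (m : val.obj U) :
    val.map i (a • m) = X.presheaf.map i a • val.map i m

namespace SetSheaf

attribute [instance] SetSheaf.zero SetSheaf.action

variable {X : MonoidalSpace.{u}}

theorem map_zero (M : SetSheaf X) {U V : (Opens X.carrier)ᵒᵖ} (i : U ⟶ V) :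
    M.val.map i (0 : M.val.obj U) = 0 := by
  have := M.map_smul i 0 0
  rwa [zero_smul, X.map_zero, zero_smul] at this

/-- The restriction maps. -/
def res (M : SetSheaf X) {U V : Opens X.carrier} (h : V ≤ U) (m : M.val.obj (op U)) :
    M.val.obj (op V) :=
  M.val.map (homOfLE h).op m

theorem res_zero (M : SetSheaf X) {U V : Opens X.carrier} (h : V ≤ U) :
    M.res h (0 : M.val.obj (op U)) = 0 :=
  M.map_zero _

theorem res_smul (M : SetSheaf X) {U V : Opens X.carrier} (h : V ≤ U) (a : X.presheaf.obj (op U))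
    (m : M.val.obj (op U)) : M.res h (a • m) = X.res h a • M.res h m :=
  M.map_smul _ a m

theorem res_refl (M : SetSheaf X) {U : Opens X.carrier} (m : M.val.obj (op U)) :
    M.res le_rfl m = m :=
  ConcreteCategory.congr_hom (M.val.map_id (op U)) m

theorem res_res (M : SetSheaf X) {U V W : Opens X.carrier} (h : V ≤ U) (h' : W ≤ V)
    (m : M.val.obj (op U)) : M.res (h'.trans h) m = M.res h' (M.res h m) :=
  ConcreteCategory.congr_hom (M.val.map_comp (homOfLE h).op (homOfLE h').op) m

/-- A morphism of `𝒪_X`-modules. -/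
@[ext]
structure Hom (M N : SetSheaf X) where
  hom : M.val ⟶ N.val
  map_smul (U : (Opens X.carrier)ᵒᵖ) (a : X.presheaf.obj U) (m : M.val.obj U) :
    hom.app U (a • m) = a • hom.app U m

theorem Hom.map_zero {M N : SetSheaf X} (f : Hom M N) (U : (Opens X.carrier)ᵒᵖ) :
    f.hom.app U (0 : M.val.obj U) = 0 := by
  have := f.map_smul U 0 0
  rwa [zero_smul, zero_smul] at this

theorem Hom.app_res {M N : SetSheaf X} (f : Hom M N) {U V : Opens X.carrier} (h : V ≤ U)
    (m : M.val.obj (op U)) : f.hom.app (op V) (M.res h m) = N.res h (f.hom.app (op U) m) :=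
  NatTrans.naturality_apply f.hom (homOfLE h).op m

instance : Category (SetSheaf X) where
  Hom := Hom
  id M := ⟨𝟙 _, fun _ _ _ => rfl⟩
  comp f g := ⟨f.hom ≫ g.hom, fun U a m =>
    (congrArg (g.hom.app U) (f.map_smul U a m)).trans (g.map_smul U a _)⟩

@[simp] theorem id_hom (M : SetSheaf X) : Hom.hom (𝟙 M) = 𝟙 M.val := rfl

@[simp] theorem comp_hom {M N P : SetSheaf X} (f : M ⟶ N) (g : N ⟶ P) :
    (f ≫ g).hom = f.hom ≫ g.hom := rfl

@[ext] theorem hom_ext {M N : SetSheaf X} {f g : M ⟶ N} (h : f.hom = g.hom) : f = g :=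
  Hom.ext h

/-- The morphism that is constantly equal to the base point. -/
instance (M N : SetSheaf X) : Zero (M ⟶ N) :=
  ⟨{ hom :=
      { app := fun U => TypeCat.ofHom fun _ => (0 : N.val.obj U)
        naturality := fun U V i => by
          ext m
          exact (N.map_zero i).symm }
     map_smul := fun U a m => (smul_zero a).symm }⟩

theorem zero_app {M N : SetSheaf X} (U : (Opens X.carrier)ᵒᵖ) (m : M.val.obj U) :
    (0 : M ⟶ N).hom.app U m = 0 := rfl

instance : HasZeroMorphisms (SetSheaf X) where
  comp_zero _ _ := rfl
  zero_comp _ _ _ g := by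
    ext U m
    exact Hom.map_zero g (op U)

/-- A morphism of `𝒪_X`-modules is normal if on every stalk, each fibre contains at most one
element, except for the fibre of the base point. -/
def Normal {M N : SetSheaf X} (f : M ⟶ N) : Prop :=
  ∀ (x : X.carrier) (a b : M.val.stalk x),
    (TopCat.Presheaf.stalkFunctor (Type u) x).map f.hom a =
        (TopCat.Presheaf.stalkFunctor (Type u) x).map f.hom b →
      a = b ∨ (TopCat.Presheaf.stalkFunctor (Type u) x).map f.hom a =
        N.val.germ ⊤ x trivial (0 : N.val.obj (op ⊤))

/-- The image sheaves of `f` and `g` agree, i.e. a section of `N` belongs locally to the image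
of `f` if and only if it belongs locally to the image of `g`. -/
def SameImage {M M' N : SetSheaf X} (f : M ⟶ N) (g : M' ⟶ N) : Prop :=
  ∀ (U : Opens X.carrier) (n : N.val.obj (op U)),
    (∀ x ∈ U, ∃ (V : Opens X.carrier) (h : V ≤ U), x ∈ V ∧
      N.res h n ∈ Set.range (f.hom.app (op V))) ↔
    (∀ x ∈ U, ∃ (V : Opens X.carrier) (h : V ≤ U), x ∈ V ∧
      N.res h n ∈ Set.range (g.hom.app (op V)))

/-- On the affine open subset `U`, the `𝒪_X`-module `M` is the sheaf associated with the
`𝒪_X(U)`-set `M(U)`: its sections over `D_f` are the localization `M(U)_f`. -/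
def IsAssociatedOn (M : SetSheaf X) (U : Opens X.carrier)
    (φ : U ≃ₜ MonSpec (X.presheaf.obj (op U))) : Prop :=
  ∀ (f : X.presheaf.obj (op U)) (V : Opens X.carrier) (h : V ≤ U),
    (∀ x : U, x.1 ∈ V ↔ φ x ∈ MonSpec.basicOpen f) →
      (∀ n : M.val.obj (op V), ∃ (m : M.val.obj (op U)) (k : ℕ),
        X.res h f ^ k • n = M.res h m) ∧
      ∀ m m' : M.val.obj (op U), M.res h m = M.res h m' →
        ∃ k : ℕ, f ^ k • m = f ^ k • m'

/-- An `𝒪_X`-module is coherent if, on an affine open cover, it is associated with finitely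
generated sets with an action of the monoid. -/
def IsCoherent (M : SetSheaf X) : Prop :=
  ∀ x : X.carrier, ∃ (U : Opens X.carrier) (φ : U ≃ₜ MonSpec (X.presheaf.obj (op U))),
    x ∈ U ∧ X.IsSpecChart U φ ∧ M.IsAssociatedOn U φ ∧
      ∃ s : Finset (M.val.obj (op U)), ∀ m : M.val.obj (op U),
        ∃ a : X.presheaf.obj (op U), ∃ y ∈ s, m = a • y

end SetSheaf

namespace MonoidalSpace

variable (X : MonoidalSpace.{u})

/-- The presheaf of rings `U ↦ 𝒪_X(U)_ℤ` on the affine open subsets of `X`. -/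
def affRing : X.AffOpensᵒᵖ ⥤ RingCat.{u} where
  obj U := .of (ZRing (X.presheaf.obj (op U.unop.1)))
  map {U V} i := RingCat.ofHom (ZRing.map (X.res (leOfHom i.unop : V.unop.1 ≤ U.unop.1)))
  map_id U := by
    ext1
    refine ZRing.hom_ext fun a => ?_
    refine (ZRing.map_of _ _).trans ?_
    rw [X.res_refl]
    rfl
  map_comp {U V W} i j := by
    ext1
    refine ZRing.hom_ext fun a => ?_
    refine (ZRing.map_of _ _).trans ?_
    refine .trans ?_ (congrArg (ZRing.map _) (ZRing.map_of _ a)).symm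
    rw [ZRing.map_of, X.res_res]

/-- The open subset `U_ℤ` of `X_ℤ`, for `U` affine open in `X`. -/
def affOpen : X.AffOpens ⥤ X.baseChange.Opens where
  obj U := (X.toBaseChange U).opensRange
  map {U V} i := homOfLE (by
    rintro _ ⟨y, rfl⟩
    rw [← X.map_toBaseChange i, Scheme.Hom.comp_apply]
    exact ⟨_, rfl⟩)

/-- The identification of `𝒪_X(U)_ℤ` with the sections of `𝒪_{X_ℤ}` over `U_ℤ`. -/
def affRingEquiv (U : X.AffOpens) :
    Γ(X.baseChange, X.affOpen.obj U) ≅ .of (ZRing (X.presheaf.obj (op U.1))) :=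
  X.baseChange.presheaf.mapIso (eqToIso ((X.toBaseChange U).image_top_eq_opensRange)).op ≪≫
    (X.toBaseChange U).appIso ⊤ ≪≫ Scheme.ΓSpecIso _

theorem le_affOpen (U : X.AffOpens) : ⊤ ≤ X.toBaseChange U ⁻¹ᵁ X.affOpen.obj U :=
  fun y _ => ⟨y, rfl⟩

theorem affRingEquiv_hom (U : X.AffOpens) :
    (X.affRingEquiv U).hom = (X.toBaseChange U).appLE (X.affOpen.obj U) ⊤ (X.le_affOpen U) ≫
      (Scheme.ΓSpecIso _).hom := by
  change (_ ≫ ((X.toBaseChange U).appIso ⊤).hom ≫ _) = _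
  rw [Scheme.Hom.appIso_hom', ← Category.assoc]
  congr 1
  exact Scheme.Hom.map_appLE _ _ _

theorem appLE_congr_hom {Y Z : Scheme.{u}} {f g : Y ⟶ Z} (h : f = g) (U : Z.Opens) (V : Y.Opens)
    (e : V ≤ f ⁻¹ᵁ U) (e' : V ≤ g ⁻¹ᵁ U) : f.appLE U V e = g.appLE U V e' := by
  subst h
  rfl

theorem affRingEquiv_naturality {U V : X.AffOpens} (i : U ⟶ V) :
    X.baseChange.presheaf.map (X.affOpen.map i).op ≫ (X.affRingEquiv U).hom =
      (X.affRingEquiv V).hom ≫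
        CommRingCat.ofHom (ZRing.map (X.res (leOfHom i : U.1 ≤ V.1))) := by
  rw [affRingEquiv_hom, affRingEquiv_hom, Category.assoc, ← Scheme.ΓSpecIso_naturality,
    ← Category.assoc, ← Category.assoc]
  congr 1
  refine (Scheme.Hom.map_appLE _ _ _).trans ?_
  rw [Scheme.Hom.appTop, Scheme.Hom.app_eq_appLE]
  refine .trans ?_ (Scheme.Hom.appLE_comp_appLE _ _ _ _ _ _ _).symm
  exact appLE_congr_hom (X.map_toBaseChange i).symm _ _ _ _

/-- The morphism from the presheaf of rings `U ↦ 𝒪_X(U)_ℤ` to the structure sheaf of `X_ℤ`. -/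
def affRingHom : X.affRing ⟶ X.affOpen.op ⋙ X.baseChange.ringCatSheaf.obj where
  app U := (forget₂ CommRingCat RingCat).map (X.affRingEquiv U.unop).inv
  naturality {U V} i := by
    have h : CommRingCat.ofHom (ZRing.map (X.res (leOfHom i.unop : V.unop.1 ≤ U.unop.1))) ≫
        (X.affRingEquiv V.unop).inv = (X.affRingEquiv U.unop).inv ≫
          X.baseChange.presheaf.map (X.affOpen.map i.unop).op := by
      rw [Iso.comp_inv_eq, Category.assoc, affRingEquiv_naturality, Iso.inv_hom_id_assoc]
    exact congrArg (forget₂ CommRingCat RingCat).map h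

end MonoidalSpace

namespace SetSheaf

variable {X : MonoidalSpace.{u}}

/-- The presheaf of abelian groups `U ↦ M(U)_ℤ` on the affine open subsets of `X`. -/
def affPresheaf (M : SetSheaf X) : X.AffOpensᵒᵖ ⥤ AddCommGrpCat.{u} where
  obj U := .of (ZSet (M.val.obj (op U.unop.1)))
  map {U V} i := AddCommGrpCat.ofHom
    (ZSet.map (M.res (leOfHom i.unop : V.unop.1 ≤ U.unop.1)) (M.res_zero _))
  map_id U := by
    ext x
    exact ZSet.map_eq_self (M.res le_rfl) (M.res_zero _) M.res_refl x
  map_comp {U V W} i j := by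
    ext x
    exact ZSet.map_eq_map_map (M.res (leOfHom i.unop : V.unop.1 ≤ U.unop.1)) (M.res_zero _)
      (M.res (leOfHom j.unop : W.unop.1 ≤ V.unop.1)) (M.res_zero _)
      (M.res _) (M.res_zero _) (M.res_res _ _) x

instance (M : SetSheaf X) (U : X.AffOpensᵒᵖ) : Module (X.affRing.obj U) (M.affPresheaf.obj U) :=
  inferInstanceAs (Module (ZRing (X.presheaf.obj (op U.unop.1)))
    (ZSet (M.val.obj (op U.unop.1))))

/-- The presheaf of modules `U ↦ M(U)_ℤ` on the affine open subsets of `X`. -/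
def affModule : SetSheaf X ⥤ PresheafOfModules.{u} X.affRing where
  obj M := PresheafOfModules.ofPresheaf (R := X.affRing) (M.affPresheaf) (by
    intro U V i r m
    exact ZSet.map_smul' (X.res (leOfHom i.unop : V.unop.1 ≤ U.unop.1)) _ (M.res_zero _)
      (M.res_smul _) r m)
  map {M N} f := PresheafOfModules.homMk
    { app := fun U => AddCommGrpCat.ofHom (ZSet.map (f.hom.app (op U.unop.1)) (f.map_zero _))
      naturality := fun U V i => by
        ext x
        exact ZSet.map_map_eq (M.res (leOfHom i.unop : V.unop.1 ≤ U.unop.1)) (M.res_zero _)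
          (f.hom.app (op V.unop.1)) (f.map_zero _) (f.hom.app (op U.unop.1)) (f.map_zero _)
          (N.res (leOfHom i.unop : V.unop.1 ≤ U.unop.1)) (N.res_zero _) (f.app_res _) x }
    (fun U r m => by
      have := ZSet.map_smul' (A := X.presheaf.obj (op U.unop.1)) (MonoidWithZeroHom.id _)
        (f.hom.app (op U.unop.1)) (f.map_zero _) (f.map_smul _) r m
      refine this.trans ?_
      congr 1
      exact DFunLike.congr_fun (ZRing.hom_ext (f := ZRing.map (MonoidWithZeroHom.id _))
        (g := RingHom.id _) fun a => ZRing.map_of _ a) r)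
  map_id M := by
    ext U x
    exact ZSet.map_eq_self ((𝟙 M : M ⟶ M).hom.app (op U.unop.1)) (Hom.map_zero (𝟙 M) _)
      (fun m => rfl) x
  map_comp f g := by
    ext U x
    exact ZSet.map_eq_map_map (f.hom.app (op U.unop.1)) (f.map_zero _)
      (g.hom.app (op U.unop.1)) (g.map_zero _) ((f ≫ g).hom.app (op U.unop.1))
      (Hom.map_zero (f ≫ g) _) (fun m => rfl) x

/-- The base extension functor `M ↦ M_ℤ` from `𝒪_X`-modules to `𝒪_{X_ℤ}`-modules. It is the
sheafification of the inverse image of the presheaf of modules `U ↦ M(U)_ℤ` along the inclusion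
of the open subsets `U_ℤ` in `X_ℤ`, for `U` affine open in `X`. -/
def baseChange : SetSheaf X ⥤ X.baseChange.Modules :=
  affModule ⋙ PresheafOfModules.pullback X.affRingHom ⋙
    PresheafOfModules.sheafification (𝟙 X.baseChange.ringCatSheaf.obj)

instance : (baseChange (X := X)).PreservesZeroMorphisms := by
  have h₁ : (affModule (X := X)).PreservesZeroMorphisms := ⟨fun M N => by
    ext U x
    exact DFunLike.congr_fun (ZSet.addHom_ext (f := ZSet.map _ (Hom.map_zero (0 : M ⟶ N) _))
      (g := 0) fun m => (ZSet.map_of _ _ m).trans ZSet.of_zero) x⟩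
  have h₂ : (PresheafOfModules.pullback X.affRingHom).PreservesZeroMorphisms :=
    have := (PresheafOfModules.pullbackPushforwardAdjunction X.affRingHom).isLeftAdjoint
    Functor.preservesZeroMorphisms_of_isLeftAdjoint _
  have h₃ : (PresheafOfModules.sheafification
      (𝟙 X.baseChange.ringCatSheaf.obj)).PreservesZeroMorphisms :=
    have := (PresheafOfModules.sheafificationAdjunction
      (𝟙 X.baseChange.ringCatSheaf.obj)).isLeftAdjoint
    Functor.preservesZeroMorphisms_of_isLeftAdjoint _
  refine ⟨fun M N => ?_⟩
  unfold baseChange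
  have e₁ := congrArg (PresheafOfModules.pullback X.affRingHom).map (h₁.map_zero M N)
  have e₂ := congrArg (PresheafOfModules.sheafification (𝟙 X.baseChange.ringCatSheaf.obj)).map
    (e₁.trans (h₂.map_zero _ _))
  exact e₂.trans (h₃.map_zero _ _)

end SetSheaf

namespace MonoidalSpace

/-- An `M₀`-scheme is a monoidal space that is covered by affine open subsets. -/
def IsM0Scheme (X : MonoidalSpace.{u}) : Prop :=
  ∀ x : X.carrier, ∃ U : Opens X.carrier, x ∈ U ∧ X.IsAffineOpen U

/-- An `M₀`-scheme is Noetherian if it is covered by finitely many spectra of finitely generated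
monoids. -/
def IsNoetherian (X : MonoidalSpace.{u}) : Prop :=
  CompactSpace X.carrier ∧ ∀ x : X.carrier, ∃ U : Opens X.carrier,
    x ∈ U ∧ X.IsAffineOpen U ∧ Monoid.FG (X.presheaf.obj (op U))

end MonoidalSpace

/-! ### `𝔽₁`-schemes and sheaves of modules -/

/-- An `𝔽₁`-scheme: an `M₀`-scheme `X̃`, a scheme `X` and an evaluation map `e : X̃_ℤ ⟶ X` that
induces a bijection between `k`-rational points for every field `k`. -/
structure F1Scheme where
  mon : MonoidalSpace.{u}
  isM0Scheme : mon.IsM0Scheme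
  sch : Scheme.{u}
  ev : mon.baseChange ⟶ sch
  bijective (k : Type u) [Field k] :
    Function.Bijective fun p : Spec (.of k) ⟶ mon.baseChange => p ≫ ev

/-- An `𝔽₁`-scheme is Noetherian if both the `M₀`-scheme and the scheme are Noetherian. -/
def F1Scheme.IsNoetherian (𝒳 : F1Scheme.{u}) : Prop :=
  𝒳.mon.IsNoetherian ∧ AlgebraicGeometry.IsNoetherian 𝒳.sch

/-- A coherent sheaf on a scheme: locally the sheaf associated with a finitely generated module. -/
def IsCoherent {X : Scheme.{u}} (M : X.Modules) : Prop :=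
  ∀ x : X, ∃ (R : CommRingCat.{u}) (f : Spec R ⟶ X) (_ : IsOpenImmersion f) (N : ModuleCat.{u} R),
    x ∈ Set.range f ∧ Module.Finite R N ∧ Nonempty (M.restrict f ≅ tilde N)

/-- A morphism `f : M ⟶ N` of `𝒪_Y`-modules is `φ`-flat, for a morphism of schemes `φ : X ⟶ Y`, if
`0 ⟶ φ^*(ker f) ⟶ φ^* M ⟶ φ^* N` is exact. -/
def IsFlatAlong {X Y : Scheme.{u}} (φ : X ⟶ Y) {M N : Y.Modules} (f : M ⟶ N) : Prop :=
  Mono ((Scheme.Modules.pullback φ).map (kernel.ι f)) ∧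
    (ShortComplex.mk ((Scheme.Modules.pullback φ).map (kernel.ι f))
      ((Scheme.Modules.pullback φ).map f) (by
        rw [← Functor.map_comp, kernel.condition, Functor.map_zero])).Exact

/-- An `𝒪_𝒳`-module on an `𝔽₁`-scheme `𝒳 = (X̃, X, e)`. -/
structure FModule (𝒳 : F1Scheme.{u}) where
  mon : SetSheaf 𝒳.mon
  sch : 𝒳.sch.Modules
  iso : SetSheaf.baseChange.obj mon ≅ (Scheme.Modules.pullback 𝒳.ev).obj sch

namespace FModule

variable {𝒳 : F1Scheme.{u}}

/-- A morphism of `𝒪_𝒳`-modules. -/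
@[ext]
structure Hom (M N : FModule 𝒳) where
  mon : M.mon ⟶ N.mon
  sch : M.sch ⟶ N.sch
  comm : SetSheaf.baseChange.map mon ≫ N.iso.hom =
    M.iso.hom ≫ (Scheme.Modules.pullback 𝒳.ev).map sch

instance : Category (FModule 𝒳) where
  Hom := Hom
  id M := ⟨𝟙 _, 𝟙 _, by simp⟩
  comp f g := ⟨f.mon ≫ g.mon, f.sch ≫ g.sch, by
    rw [Functor.map_comp, Functor.map_comp, Category.assoc, g.comm, ← Category.assoc, f.comm,
      Category.assoc]⟩

@[simp] theorem id_mon (M : FModule 𝒳) : Hom.mon (𝟙 M) = 𝟙 M.mon := rfl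

@[simp] theorem id_sch (M : FModule 𝒳) : Hom.sch (𝟙 M) = 𝟙 M.sch := rfl

@[simp] theorem comp_mon {M N P : FModule 𝒳} (f : M ⟶ N) (g : N ⟶ P) :
    (f ≫ g).mon = f.mon ≫ g.mon := rfl

@[simp] theorem comp_sch {M N P : FModule 𝒳} (f : M ⟶ N) (g : N ⟶ P) :
    (f ≫ g).sch = f.sch ≫ g.sch := rfl

@[ext] theorem hom_ext {M N : FModule 𝒳} {f g : M ⟶ N} (h : f.mon = g.mon)
    (h' : f.sch = g.sch) : f = g :=
  Hom.ext h h'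

instance (M N : FModule 𝒳) : Zero (M ⟶ N) :=
  ⟨{ mon := 0
     sch := 0
     comm := by simp }⟩

@[simp] theorem zero_mon (M N : FModule 𝒳) : (0 : M ⟶ N).mon = 0 := rfl

@[simp] theorem zero_sch (M N : FModule 𝒳) : (0 : M ⟶ N).sch = 0 := rfl

instance : HasZeroMorphisms (FModule 𝒳) where
  comp_zero f P := by ext1 <;> simp
  zero_comp M {N P} f := by ext1 <;> simp

/-- An `𝒪_𝒳`-module is coherent if both components are coherent. -/
def IsCoherent : ObjectProperty (FModule 𝒳) :=
  fun M => M.mon.IsCoherent ∧ F1.IsCoherent M.sch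

/-- A morphism of `𝒪_𝒳`-modules is normal if the component on `X̃` is normal and the component
on `X` is `e`-flat. -/
def Normal {M N : FModule 𝒳} (f : M ⟶ N) : Prop :=
  SetSheaf.Normal f.mon ∧ IsFlatAlong 𝒳.ev f.sch

/-- The sequence `L ⟶ M ⟶ N` of `𝒪_𝒳`-modules is exact at `M`: the kernel `k : K ⟶ M` of the second
morphism exists, and it is the image of the first morphism. Here, the image of `(f̃, f)` is given
by the image subsheaves `im f̃` and `im f`. -/
def ExactAt {L M N : FModule 𝒳} (f : L ⟶ M) (g : M ⟶ N) : Prop :=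
  ∃ (K : FModule 𝒳) (k : K ⟶ M) (w : k ≫ g = 0),
    Nonempty (IsLimit (KernelFork.ofι k w)) ∧
      (∀ U, Function.Injective (k.mon.hom.app U)) ∧
      SetSheaf.SameImage f.mon k.mon ∧
      Mono k.sch ∧ imageSubobject f.sch = imageSubobject k.sch

end FModule

/-- The category `Coh 𝒳` of coherent sheaves on an `𝔽₁`-scheme. -/
abbrev Coh (𝒳 : F1Scheme.{u}) := (FModule.IsCoherent (𝒳 := 𝒳)).FullSubcategory

/-- An admissible short exact sequence `0 ⟶ M₁ ⟶ M₂ ⟶ M₃ ⟶ 0` in `Coh 𝒳`: a five term sequence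
with zero objects at its ends that is exact, as a sequence of `𝒪_𝒳`-modules, at the three terms in
the middle, and whose two inner morphisms are normal. -/
def Admissible (𝒳 : F1Scheme.{u}) : ObjectProperty (ComposableArrows (Coh 𝒳) 4) := fun S =>
  IsZero (S.obj' 0).obj ∧ IsZero (S.obj' 4).obj ∧
    FModule.ExactAt (S.map' 0 1).hom (S.map' 1 2).hom ∧
    FModule.ExactAt (S.map' 1 2).hom (S.map' 2 3).hom ∧
    FModule.ExactAt (S.map' 2 3).hom (S.map' 3 4).hom ∧
    FModule.Normal (S.map' 1 2).hom ∧ FModule.Normal (S.map' 2 3).hom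

/-! ### Quasi-exact categories -/

section QuasiExact

variable {C : Type*} [Category.{v} C] (E : ObjectProperty (ComposableArrows C 4))

/-- The morphism `i` appears as the second arrow of a five term sequence in the class `E`. -/
def AdmissibleMono {M N : C} (i : M ⟶ N) : Prop :=
  ∃ (Z P Z' : C) (a : Z ⟶ M) (p : N ⟶ P) (b : P ⟶ Z'), E (.mk₄ a i p b)

/-- The morphism `p` appears as the third arrow of a five term sequence in the class `E`. -/
def AdmissibleEpi {N P : C} (p : N ⟶ P) : Prop :=
  ∃ (Z M Z' : C) (a : Z ⟶ M) (i : M ⟶ N) (b : P ⟶ Z'), E (.mk₄ a i p b)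

/-- A category with a class `E` of five term sequences, the admissible short exact sequences, is
quasi-exact. -/
structure IsQuasiExact : Prop where
  of_iso {S T : ComposableArrows C 4} (e : S ≅ T) (h : E S) : E T
  mono_comp {L M N : C} (i : L ⟶ M) (j : M ⟶ N) (hi : AdmissibleMono E i)
    (hj : AdmissibleMono E j) : AdmissibleMono E (i ≫ j)
  epi_comp {L M N : C} (p : L ⟶ M) (q : M ⟶ N) (hp : AdmissibleEpi E p)
    (hq : AdmissibleEpi E q) : AdmissibleEpi E (p ≫ q)
  hasPullback {M N P : C} (i : M ⟶ N) (j : P ⟶ N) (hi : AdmissibleMono E i)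
    (hj : AdmissibleEpi E j) : HasPullback i j
  pullback {K M N P : C} (i : M ⟶ N) (j : P ⟶ N) (hi : AdmissibleMono E i)
    (hj : AdmissibleEpi E j) (j' : K ⟶ M) (i' : K ⟶ P) (h : IsPullback j' i' i j) :
    AdmissibleMono E i' ∧ AdmissibleEpi E j'

end QuasiExact

end F1

end

noncomputable section

namespace F1

/-! ### Sheaves of modules on schemes -/

/-! Everything is reduced to sections over affine open subsets and to modules on schemes. The
spectrum of a non-trivial monoid has a point, the ideal of non-units, whose only open neighbourhood
is the whole spectrum (`MonoidalSpace.IsAffineOpen.subsingleton_or`). Hence a statement that holds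
locally on an affine open subset holds on all of it. Normality, images and quotients become
conditions on sets of sections (`SetSheaf.normal_iff`, `SetSheaf.sameImage_iff`,
`SetSheaf.quotient`), and the restriction maps of a coherent sheaf between affine open subsets are
localizations (`SetSheaf.IsCoherent.isLocalizedAt`).

The main point is that a normal morphism of coherent modules has a coherent kernel, formed in each
component (`FModule.exists_isKer`). Such a kernel needs an isomorphism between the base extension of
the kernel on `X̃` and the pullback of the kernel on `X`, so both functors have to preserve the
kernels in question. The pullback does, since flatness is part of normality. On the combinatorial
side, a normal morphism is the quotient by its kernel followed by the inclusion of its image. Base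
extension turns such quotients into cokernels, since they are cokernels of presheaves on affine open
subsets and the passage to sheaves is a left adjoint (`SetSheaf.IsQuotient.isColimit`). It also
preserves injections of coherent sheaves (`SetSheaf.IsCoherent.mono_baseChange_map`): over `U_ℤ` a
coherent `M` becomes the sheaf associated with `M(U)_ℤ`, and `M(U)_ℤ ⟶ N(U)_ℤ` is injective because
an injection of pointed sets has a pointed retraction. Coherence of kernels uses that `X` and the
rings `A_ℤ` are Noetherian; the latter gives finite generation of subsets that are stable under `A`
(`exists_finset_generators`).

As kernels are componentwise, so is admissibility (`FModule.isShortExact_iff`): `i` is injective and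
`p` is its quotient over affine open subsets, the sequence on `X` is short exact, and the pullback
of `i` along the evaluation map is a monomorphism. In this form, invariance under isomorphism is
immediate. A componentwise monomorphism with monic pullback has an admissible cokernel, and these
conditions are stable under composition. A normal, componentwise surjective morphism has an
admissible kernel; the flatness of a composition of such morphisms is a diagram chase
(`mono_map_kernelι_comp`). Finally, if `M` is the kernel of `q : N ⟶ Q`, then the fibre product of
`M` and `P` over `N` is the kernel of `P ⟶ N ⟶ Q`, which is a composition of admissible
epimorphisms. -/

theorem injective_app_of_mono {X : Scheme.{u}} {M N : X.Modules} (f : M ⟶ N) [Mono f]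
    (U : X.Opens) : Function.Injective (f.app U) := by
  have h : Mono (((Scheme.Modules.toPresheaf X).map f).app (op U)) :=
    (NatTrans.mono_iff_mono_app _).1 (inferInstanceAs (Mono ((Scheme.Modules.toPresheaf X).map f))) _
  exact (AddCommGrpCat.mono_iff_injective _).1 h

/-- Sections of a sheaf of modules that agree locally are equal. -/
theorem section_ext {X : Scheme.{u}} {M : X.Modules} {U : X.Opens} {s t : Γ(M, U)}
    (h : ∀ x ∈ U, ∃ (V : X.Opens) (i : V ⟶ U), x ∈ V ∧ M.presheaf.map i.op s = M.presheaf.map i.op t) :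
    s = t := by
  choose V i hV h using h
  exact TopCat.Sheaf.eq_of_locally_eq' ⟨_, M.isSheaf⟩ (fun x : U => V x.1 x.2) U
    (fun x => i x.1 x.2) (fun x hx => Opens.mem_iSup.2 ⟨⟨x, hx⟩, hV x hx⟩) s t
    (fun x => h x.1 x.2)

theorem app_map {X : Scheme.{u}} {M N : X.Modules} (f : M ⟶ N) {U V : X.Opens} (i : V ⟶ U)
    (s : Γ(M, U)) : f.app V (M.presheaf.map i.op s) = N.presheaf.map i.op (f.app U s) :=
  ConcreteCategory.congr_hom (f.mapPresheaf.naturality i.op) s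

theorem mono_of_locally_injective {X : Scheme.{u}} {M N : X.Modules} (f : M ⟶ N)
    (h : ∀ (U : X.Opens) (x : X), x ∈ U → ∃ V : X.Opens, V ≤ U ∧ x ∈ V ∧
      Function.Injective (f.app V)) : Mono f where
  right_cancellation {P} g₁ g₂ e := by
    ext U s
    refine section_ext fun x hx => ?_
    obtain ⟨V, hVU, hxV, hV⟩ := h U x hx
    refine ⟨V, homOfLE hVU, hxV, hV ?_⟩
    rw [app_map, app_map]
    congr 1
    exact ConcreteCategory.congr_hom (congrArg (fun k : P ⟶ N => k.app U) e) s

theorem mono_of_restrict {X : Scheme.{u}} {M N : X.Modules} (f : M ⟶ N)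
    (h : ∀ x : X, ∃ (Y : Scheme.{u}) (j : Y ⟶ X) (_ : IsOpenImmersion j), x ∈ Set.range j ∧
      Mono ((Scheme.Modules.restrictFunctor j).map f)) : Mono f := by
  refine mono_of_locally_injective f fun U x hx => ?_
  obtain ⟨Y, j, _, ⟨y, rfl⟩, hm⟩ := h x
  refine ⟨j ''ᵁ (j ⁻¹ᵁ U), j.image_preimage_le U, ⟨y, hx, rfl⟩, ?_⟩
  exact injective_app_of_mono ((Scheme.Modules.restrictFunctor j).map f) (j ⁻¹ᵁ U)

instance restrictFunctor_preservesMono {X Y : Scheme.{u}} (f : X ⟶ Y) [IsOpenImmersion f] :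
    (Scheme.Modules.restrictFunctor f).PreservesMonomorphisms where
  preserves g _ := mono_of_locally_injective _ fun U _ hx =>
    ⟨U, le_rfl, hx, injective_app_of_mono g (f ''ᵁ U)⟩

instance {X Y : Scheme.{u}} (f : X ⟶ Y) [IsOpenImmersion f] :
    (Scheme.Modules.restrictFunctor f).Additive :=
  have := preservesBinaryBiproducts_of_preservesBinaryCoproducts (Scheme.Modules.restrictFunctor f)
  Functor.additive_of_preservesBinaryBiproducts _

/-- The functor `N ↦ N^~`. -/
def tildeFunctor (R : CommRingCat.{u}) : ModuleCat.{u} R ⥤ (Spec R).Modules where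
  obj := tilde
  map := tilde.map

instance (R : CommRingCat.{u}) : (tildeFunctor R).Full :=
  inferInstanceAs (tilde.functor R).Full

instance (R : CommRingCat.{u}) : (tildeFunctor R).Faithful :=
  inferInstanceAs (tilde.functor R).Faithful

instance (R : CommRingCat.{u}) : (tildeFunctor R).IsLeftAdjoint :=
  inferInstanceAs (tilde.functor R).IsLeftAdjoint

instance (R : CommRingCat.{u}) : (tildeFunctor R).Additive :=
  inferInstanceAs (tilde.functor R).Additive

/-- Localization is exact: over a basic open subset `D(r)`, the map induced by `f` is the
localization of `f` at `r`. -/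
instance tildeFunctor_preservesMono (R : CommRingCat.{u}) : (tildeFunctor R).PreservesMonomorphisms where
  preserves {M N} f hf := by
    have hf' : Function.Injective f.hom := (ModuleCat.mono_iff_injective f).1 hf
    refine mono_of_locally_injective _ fun U x hx => ?_
    obtain ⟨_, ⟨_, ⟨r, rfl⟩, rfl⟩, hxr, hrU⟩ :=
      PrimeSpectrum.isBasis_basic_opens.exists_subset_of_mem_open hx U.2
    refine ⟨PrimeSpectrum.basicOpen r, hrU, hxr, ?_⟩
    let g := ((modulesSpecToSheaf.map (tilde.map f)).1.app (op (PrimeSpectrum.basicOpen r))).hom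
    have hg : g = IsLocalizedModule.map (Submonoid.powers r)
        (tilde.toOpen M (PrimeSpectrum.basicOpen r)).hom
        (tilde.toOpen N (PrimeSpectrum.basicOpen r)).hom f.hom := by
      apply IsLocalizedModule.ext (Submonoid.powers r)
        (tilde.toOpen M (PrimeSpectrum.basicOpen r)).hom
      · exact IsLocalizedModule.map_units (tilde.toOpen N (PrimeSpectrum.basicOpen r)).hom
      · refine (congrArg ModuleCat.Hom.hom
          (tilde.toOpen_map_app f (PrimeSpectrum.basicOpen r))).trans ?_
        ext x
        simp
    have : Function.Injective g := by
      rw [hg]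
      exact IsLocalizedModule.map_injective _ _ _ _ hf'
    exact this

/-- A left adjoint preserves cokernels, so preservation of monomorphisms is all that is missing for
exactness. With the analogous instance for `tildeFunctor`, kernels and cokernels of coherent sheaves
can be computed from modules on a chart. -/
instance restrictFunctor_preservesHomology {X Y : Scheme.{u}} (f : X ⟶ Y) [IsOpenImmersion f] :
    (Scheme.Modules.restrictFunctor f).PreservesHomology :=
  Functor.preservesHomology_of_preservesMonos_and_cokernels _

instance tildeFunctor_preservesHomology (R : CommRingCat.{u}) : (tildeFunctor R).PreservesHomology :=
  Functor.preservesHomology_of_preservesMonos_and_cokernels _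

/-! ### Coherent sheaves on Noetherian schemes -/

/-- The free sheaf of modules on a set of generators. -/
def freeModule (X : Scheme.{u}) (ι : Type u) : X.Modules :=
  SheafOfModules.free.{u} (R := X.ringCatSheaf) ι

/-- The free sheaf on `Spec R` is associated with a free module. -/
def tildeFree (R : CommRingCat.{u}) (ι : Type u) :
    (tildeFunctor R).obj (ModuleCat.of R (ι →₀ R)) ≅ freeModule (Spec R) ι :=
  tildeFinsupp ι

/-- Restriction of free sheaves to open subschemes. -/
def restrictFree {X Y : Scheme.{u}} (f : X ⟶ Y) [IsOpenImmersion f] (ι : Type u) :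
    freeModule X ι ≅ (freeModule Y ι).restrict f :=
  have : PreservesColimitsOfSize.{u, u} (Scheme.Modules.restrictFunctor f) := inferInstance
  letI F : SheafOfModules.{u} Y.ringCatSheaf ⥤ SheafOfModules.{u} X.ringCatSheaf :=
    Scheme.Modules.restrictFunctor f
  have : PreservesColimitsOfShape (Discrete ι) F :=
    PreservesColimitsOfSize.preservesColimitsOfShape (F := Scheme.Modules.restrictFunctor f)
  SheafOfModules.mapFreeIso F ι (Scheme.Modules.restrictUnitIso f).symm

/-- On the affine chart `f`, the sheaf `M` is associated with a finitely generated module. -/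
def IsFiniteOn {X : Scheme.{u}} (M : X.Modules) {R : CommRingCat.{u}} (f : Spec R ⟶ X)
    [IsOpenImmersion f] : Prop :=
  ∃ N : ModuleCat.{u} R, Module.Finite R N ∧ Nonempty (M.restrict f ≅ (tildeFunctor R).obj N)

/-- A quasi-coherent sheaf on `Spec R` comes from its module of global sections. The epimorphism
from a free sheaf then comes from a linear map, because `tildeFunctor` is full, and this map is
surjective, because a faithful functor reflects epimorphisms. -/
theorem finite_of_epi_free {R : CommRingCat.{u}} (M : (Spec R).Modules) [M.IsQuasicoherent]
    (ι : Type u) [Finite ι] (p : freeModule (Spec R) ι ⟶ M) [Epi p] :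
    ∃ N : ModuleCat.{u} R, Module.Finite R N ∧ Nonempty (M ≅ (tildeFunctor R).obj N) := by
  let N := (modulesSpecToSheaf.obj M).presheaf.obj (.op ⊤)
  have hi : IsIso M.fromTildeΓ := Scheme.Modules.isIso_fromTildeΓ_of_isQuasicoherent M
  let e : (tildeFunctor R).obj N ≅ M := @asIso _ _ _ _ M.fromTildeΓ hi
  let q := (tildeFunctor R).preimage ((tildeFree R ι).hom ≫ p ≫ e.inv)
  have hq : Epi ((tildeFunctor R).map q) := by
    rw [(tildeFunctor R).map_preimage]
    infer_instance
  have hq' : Epi q := (tildeFunctor R).epi_of_epi_map hq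
  refine ⟨N, ?_, ⟨e.symm⟩⟩
  exact Module.Finite.of_surjective q.hom ((ModuleCat.epi_iff_surjective q).1 hq')

theorem exists_epi_free {R : CommRingCat.{u}} (N : ModuleCat.{u} R) [Module.Finite R N] :
    ∃ (ι : Type u) (_ : Finite ι) (p : freeModule (Spec R) ι ⟶ (tildeFunctor R).obj N), Epi p := by
  obtain ⟨n, f, hf⟩ := Module.Finite.exists_fin' R N
  let g : (ULift.{u} (Fin n) →₀ R) →ₗ[R] N :=
    f ∘ₗ (Finsupp.linearEquivFunOnFinite R R (Fin n)).toLinearMap ∘ₗ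
      (Finsupp.domLCongr (R := R) (M := R) Equiv.ulift).toLinearMap
  have hg : Function.Surjective g := hf.comp
    ((Finsupp.linearEquivFunOnFinite R R (Fin n)).surjective.comp
      (Finsupp.domLCongr (R := R) (M := R) Equiv.ulift).surjective)
  have : Epi (ModuleCat.ofHom g) := (ModuleCat.epi_iff_surjective _).2 hg
  exact ⟨ULift.{u} (Fin n), inferInstance,
    (tildeFree R (ULift.{u} (Fin n))).inv ≫ (tildeFunctor R).map (ModuleCat.ofHom g), inferInstance⟩

/-- A surjection from a finite free sheaf restricts to one of the same kind, and quasi-coherence is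
inherited by the restriction, so that `finite_of_epi_free` applies on the smaller chart. -/
theorem IsFiniteOn.comp {X : Scheme.{u}} {M : X.Modules} {R S : CommRingCat.{u}}
    {f : Spec R ⟶ X} [IsOpenImmersion f] (h : IsFiniteOn M f) (g : Spec S ⟶ Spec R)
    [IsOpenImmersion g] : IsFiniteOn M (g ≫ f) := by
  obtain ⟨N, _, ⟨e⟩⟩ := h
  let e' : M.restrict (g ≫ f) ≅ ((tildeFunctor R).obj N).restrict g :=
    (Scheme.Modules.restrictFunctorComp g f).app M ≪≫
      (Scheme.Modules.restrictFunctor g).mapIso e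
  obtain ⟨ι, _, p, _⟩ := exists_epi_free N
  have : (((tildeFunctor R).obj N).restrict g).IsQuasicoherent :=
    Scheme.Modules.isQuasicoherent_restrictFunctor g (tilde N)
  obtain ⟨N', hN', ⟨e''⟩⟩ := finite_of_epi_free _ ι
    ((restrictFree g ι).hom ≫ (Scheme.Modules.restrictFunctor g).map p)
  exact ⟨N', hN', ⟨e' ≪≫ e''⟩⟩

/-- The charts provided by the coherence of `M` and of `N` are unrelated; both restrict to an affine
neighbourhood of `x` in the intersection of their images. -/
theorem exists_common_chart {X : Scheme.{u}} {M N : X.Modules} (hM : IsCoherent M)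
    (hN : IsCoherent N) (x : X) : ∃ (R : CommRingCat.{u}) (f : Spec R ⟶ X) (_ : IsOpenImmersion f),
      x ∈ Set.range f ∧ IsFiniteOn M f ∧ IsFiniteOn N f := by
  obtain ⟨R, f, _, A, hx, hA, ⟨e⟩⟩ := hM x
  obtain ⟨S, g, _, B, hx', hB, ⟨e'⟩⟩ := hN x
  obtain ⟨_, ⟨W, hWa, rfl⟩, hxW, hWU⟩ := X.isBasis_affineOpens.exists_subset_of_mem_open
    (show x ∈ ((f.opensRange ⊓ g.opensRange : X.Opens) : Set X) from ⟨hx, hx'⟩)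
    (f.opensRange ⊓ g.opensRange).2
  have hWa : IsAffineOpen W := hWa
  have h1 : Set.range hWa.fromSpec ⊆ Set.range f := by
    rw [hWa.range_fromSpec]
    exact fun y hy => (hWU hy).1
  have h2 : Set.range hWa.fromSpec ⊆ Set.range g := by
    rw [hWa.range_fromSpec]
    exact fun y hy => (hWU hy).2
  have hMf : IsFiniteOn M f := ⟨A, hA, ⟨e⟩⟩
  have hNg : IsFiniteOn N g := ⟨B, hB, ⟨e'⟩⟩
  have hi1 : IsOpenImmersion (IsOpenImmersion.lift f hWa.fromSpec h1) := by
    have : IsOpenImmersion (IsOpenImmersion.lift f hWa.fromSpec h1 ≫ f) := by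
      rw [IsOpenImmersion.lift_fac]; infer_instance
    exact IsOpenImmersion.of_comp _ f
  have hi2 : IsOpenImmersion (IsOpenImmersion.lift g hWa.fromSpec h2) := by
    have : IsOpenImmersion (IsOpenImmersion.lift g hWa.fromSpec h2 ≫ g) := by
      rw [IsOpenImmersion.lift_fac]; infer_instance
    exact IsOpenImmersion.of_comp _ g
  refine ⟨_, hWa.fromSpec, inferInstance, ?_, ?_, ?_⟩
  · rw [hWa.range_fromSpec]
    exact hxW
  · have := hMf.comp (IsOpenImmersion.lift f hWa.fromSpec h1)
    simp only [IsOpenImmersion.lift_fac] at this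
    exact this
  · have := hNg.comp (IsOpenImmersion.lift g hWa.fromSpec h2)
    simp only [IsOpenImmersion.lift_fac] at this
    exact this

/-- On a common chart `f` comes from a map `g` of finite modules, and the kernel of `f` from the
kernel of `g`, which is finite because `R` is Noetherian. -/
theorem IsCoherent.kernel {X : Scheme.{u}} [AlgebraicGeometry.IsNoetherian X] {M N : X.Modules}
    (hM : IsCoherent M) (hN : IsCoherent N) (f : M ⟶ N) : IsCoherent (kernel f) := by
  intro x
  obtain ⟨R, j, _, hx, ⟨A, _, ⟨a⟩⟩, ⟨B, _, ⟨b⟩⟩⟩ := exists_common_chart hM hN x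
  have hR : IsNoetherianRing R := by
    have := isLocallyNoetherian_of_isOpenImmersion j
    exact isLocallyNoetherian_Spec.1 this
  let g : A ⟶ B := (tildeFunctor R).preimage
    (a.inv ≫ (Scheme.Modules.restrictFunctor j).map f ≫ b.hom)
  have h₁ := Functor.PreservesHomology.preservesKernel (Scheme.Modules.restrictFunctor j) f
  have h₂ := Functor.PreservesHomology.preservesKernel (tildeFunctor R) g
  let e : (Limits.kernel f).restrict j ≅ (tildeFunctor R).obj (Limits.kernel g) :=
    PreservesKernel.iso (Scheme.Modules.restrictFunctor j) f ≪≫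
      kernel.mapIso _ ((tildeFunctor R).map g) a b (by
        rw [(tildeFunctor R).map_preimage, Iso.hom_inv_id_assoc]) ≪≫
      (PreservesKernel.iso (tildeFunctor R) g).symm
  refine ⟨R, j, inferInstance, Limits.kernel g, hx, ?_, ⟨e⟩⟩
  exact Module.Finite.of_injective (kernel.ι g).hom
    ((ModuleCat.mono_iff_injective _).1 inferInstance)

theorem IsCoherent.cokernel {X : Scheme.{u}} {M N : X.Modules}
    (hM : IsCoherent M) (hN : IsCoherent N) (f : M ⟶ N) : IsCoherent (cokernel f) := by
  intro x
  obtain ⟨R, j, _, hx, ⟨A, _, ⟨a⟩⟩, ⟨B, _, ⟨b⟩⟩⟩ := exists_common_chart hM hN x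
  let g : A ⟶ B := (tildeFunctor R).preimage
    (a.inv ≫ (Scheme.Modules.restrictFunctor j).map f ≫ b.hom)
  have h₁ := Functor.PreservesHomology.preservesCokernel (Scheme.Modules.restrictFunctor j) f
  have h₂ := Functor.PreservesHomology.preservesCokernel (tildeFunctor R) g
  let e : (Limits.cokernel f).restrict j ≅ (tildeFunctor R).obj (Limits.cokernel g) :=
    PreservesCokernel.iso (Scheme.Modules.restrictFunctor j) f ≪≫
      cokernel.mapIso _ ((tildeFunctor R).map g) a b (by
        rw [(tildeFunctor R).map_preimage, Iso.hom_inv_id_assoc]) ≪≫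
      (PreservesCokernel.iso (tildeFunctor R) g).symm
  refine ⟨R, j, inferInstance, Limits.cokernel g, hx, ?_, ⟨e⟩⟩
  exact Module.Finite.of_surjective (cokernel.π g).hom
    ((ModuleCat.epi_iff_surjective _).1 inferInstance)

/-! ### Finitely generated sets with an action of a monoid -/

section FiniteGeneration

variable {A : Type u} [CommMonoidWithZero A] {M : Type u} [Zero M] [MulActionWithZero A M]

/-- Hilbert's basis theorem: `ℤ[A]` is of finite type over `ℤ`, and `A_ℤ` is a quotient of it. -/
theorem ZRing.isNoetherianRing [Monoid.FG A] : IsNoetherianRing (ZRing A) := by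
  have : Algebra.FiniteType ℤ (MonoidAlgebra ℤ A) := inferInstance
  have : IsNoetherianRing (MonoidAlgebra ℤ A) := Algebra.FiniteType.isNoetherianRing ℤ _
  exact isNoetherianRing_of_surjective (MonoidAlgebra ℤ A) (ZRing A) ZRing.mk
    Ideal.Quotient.mk_surjective

/-- The additive extension of a map of pointed sets to an abelian group. -/
def ZSet.lift {G : Type v} [AddCommGroup G] (f : M → G) (hf : f 0 = 0) : ZSet M →+ G :=
  (Submodule.liftQ _ (Finsupp.linearCombination ℤ f) (by
    rw [Submodule.span_le]
    rintro _ rfl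
    simp [hf])).toAddMonoidHom

@[simp] theorem ZSet.lift_of {G : Type v} [AddCommGroup G] (f : M → G) (hf : f 0 = 0) (m : M) :
    ZSet.lift f hf (ZSet.of m) = f m := by
  change Finsupp.linearCombination ℤ f (Finsupp.single m 1) = _
  simp

theorem ZSet.induction {p : ZSet M → Prop} (zero : p 0) (of : ∀ m, p (ZSet.of m))
    (add : ∀ x y, p x → p y → p (x + y)) (neg : ∀ x, p x → p (-x)) (x : ZSet M) : p x := by
  let S : AddSubgroup (ZSet M) :=
    { carrier := {x | p x}
      zero_mem' := zero
      add_mem' := fun h h' => add _ _ h h'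
      neg_mem' := fun h => neg _ h }
  have : QuotientAddGroup.mk' S = 0 := ZSet.addHom_ext fun a =>
    (QuotientAddGroup.eq_zero_iff _).2 (of a)
  exact (QuotientAddGroup.eq_zero_iff (N := S) x).1 (DFunLike.congr_fun this x)

/-- A set with an action of a finitely generated monoid that is generated by finitely many elements
is Noetherian. -/
theorem exists_finset_generators [Monoid.FG A]
    (hM : ∃ s : Finset M, ∀ m : M, ∃ a : A, ∃ y ∈ s, m = a • y)
    (K : Set M) (hne : (0 : M) ∈ K) :
    ∃ t : Finset M, ↑t ⊆ K ∧ ∀ m ∈ K, ∃ a : A, ∃ y ∈ t, m = a • y := by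
  classical
  have := ZRing.isNoetherianRing (A := A)
  obtain ⟨s, hs⟩ := hM
  have hfin : Module.Finite (ZRing A) (ZSet M) := by
    refine ⟨⟨s.image ZSet.of, eq_top_iff.2 fun x _ => ?_⟩⟩
    induction x using ZSet.induction with
    | zero => exact zero_mem _
    | of m =>
      obtain ⟨a, y, hy, rfl⟩ := hs m
      rw [← ZSet.of_smul_of]
      exact Submodule.smul_mem _ _ (Submodule.subset_span (by simpa using ⟨y, hy, rfl⟩))
    | add x y hx hy => exact add_mem (hx trivial) (hy trivial)
    | neg x hx => exact neg_mem (hx trivial)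
  -- `M_ℤ` is a finite module over a Noetherian ring. Hence the span of `K` is finitely generated,
  -- and its generators can be chosen in `K`.
  have hfg : (Submodule.span (ZRing A) (ZSet.of '' K)).FG := IsNoetherian.noetherian _
  obtain ⟨t', ht', e⟩ := (Submodule.fg_span_iff_fg_span_finset_subset (ZSet.of '' K)).1 hfg
  obtain ⟨t, ht, rfl⟩ : ∃ t : Finset M, ↑t ⊆ K ∧ t.image ZSet.of = t' := by
    obtain ⟨t, ht, h⟩ := Finset.subset_set_image_iff.1 ht'
    exact ⟨t, ht, h⟩
  -- The element `0` is added so that the set `S` below contains the base point, which makes the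
  -- function `χ` compatible with the relation `1 · 0 = 0` in `M_ℤ`.
  refine ⟨insert 0 t, by simpa [Set.insert_subset_iff] using ⟨hne, ht⟩, fun m hm => ?_⟩
  by_contra hcon
  let S : Set M := {m | ∃ a : A, ∃ y ∈ insert 0 t, m = a • y}
  have hS : ∀ (a : A), ∀ y ∈ S, a • y ∈ S := by
    rintro a _ ⟨b, y, hy, rfl⟩
    exact ⟨a * b, y, hy, (mul_smul _ _ _).symm⟩
  have h0 : (0 : M) ∈ S := ⟨1, 0, by simp, by simp⟩
  -- `χ` sums the coefficients of the elements outside `S`. It kills all multiples of the elements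
  -- of `t`, but takes the value `1` at `m`, although `m` is in the span of `t`.
  let χ : ZSet M →+ ℤ := ZSet.lift (fun y => if y ∈ S then 0 else 1) (by simp [h0])
  have hχ : ∀ y ∈ S, χ (ZSet.of y) = 0 := fun y hy => by simp [χ, hy]
  -- As `χ` is only additive, it is replaced by the submodule of those `x` all of whose multiples
  -- are killed by `χ`.
  have hspan : Submodule.span (ZRing A) (ZSet.of '' K) ≤
      { carrier := {x | ∀ r : ZRing A, χ (r • x) = 0}
        zero_mem' := fun r => by simp
        add_mem' := fun {x y} hx hy r => by
          rw [smul_add, map_add, hx, hy, add_zero]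
        smul_mem' := fun c x hx r => by rw [← mul_smul]; exact hx _ } := by
    rw [e, Submodule.span_le]
    intro x hx r
    obtain ⟨y, hy, rfl⟩ := Finset.mem_image.1 (Finset.mem_coe.1 hx)
    induction r using ZRing.induction with
    | zero => simp
    | of a =>
      rw [ZSet.of_smul_of]
      exact hχ _ ⟨a, y, Finset.mem_insert_of_mem hy, rfl⟩
    | add r r' h h' => rw [add_smul, map_add, h, h', add_zero]
    | neg r h => rw [neg_smul, map_neg, h, neg_zero]
  have := hspan (Submodule.subset_span ⟨m, hm, rfl⟩) 1
  rw [one_smul] at this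
  have hmS : m ∉ S := hcon
  simp [χ, hmS] at this

end FiniteGeneration

/-! ### Affine open subsets of `M₀`-schemes -/

namespace MonoidalSpace

variable {X : MonoidalSpace.{u}}

/-- The point `u` is the prime ideal of non-units of a non-trivial monoid. This dichotomy replaces
sheafification throughout: a local statement on `U` holds on a neighbourhood of `u`, hence on `U`,
and if `𝒪(U)` is trivial, then all modules of sections over `U` are trivial as well. -/
theorem IsAffineOpen.subsingleton_or {U : Opens X.carrier} (hU : X.IsAffineOpen U) :
    Subsingleton (X.presheaf.obj (op U)) ∨
      ∃ u ∈ U, ∀ V : Opens X.carrier, u ∈ V → U ≤ V := by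
  obtain ⟨φ, -⟩ := hU
  rcases subsingleton_or_nontrivial (X.presheaf.obj (op U)) with hs | hn
  · exact Or.inl hs
  · refine Or.inr ⟨_, (φ.symm MonSpec.closedPoint).2, fun V hV x hx => ?_⟩
    have hW : IsOpen (φ '' {x : U | x.1 ∈ V}) :=
      φ.isOpenMap _ (V.isOpen.preimage continuous_subtype_val)
    have := MonSpec.eq_univ_of_closedPoint_mem hW ⟨_, hV, φ.apply_symm_apply _⟩
    obtain ⟨y, hy, hyx⟩ : φ ⟨x, hx⟩ ∈ φ '' {x : U | x.1 ∈ V} := by rw [this]; trivial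
    have := φ.injective hyx
    subst this
    exact hy

theorem IsAffineOpen.exists_localization {U V : Opens X.carrier} (hU : X.IsAffineOpen U)
    (hV : X.IsAffineOpen V) (h : V ≤ U) :
    ∃ f : X.presheaf.obj (op U), (Submonoid.powers f).IsLocalizationMap (X.res h) := by
  obtain ⟨φ, hφ⟩ := hU
  obtain ⟨f, hf⟩ := X.exists_eq_basic φ hV h
  exact ⟨f, hφ f V h hf⟩

/-- Affine open subsets form a basis of the topology of an `M₀`-scheme. -/
theorem IsM0Scheme.exists_affine (hX : X.IsM0Scheme) {x : X.carrier} {U : Opens X.carrier}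
    (hx : x ∈ U) : ∃ V : Opens X.carrier, V ≤ U ∧ x ∈ V ∧ X.IsAffineOpen V := by
  obtain ⟨W, hxW, φ, hφ⟩ := hX x
  have hO : IsOpen (φ '' {y : W | y.1 ∈ U}) :=
    φ.isOpenMap _ (U.isOpen.preimage continuous_subtype_val)
  obtain ⟨f, hf, hfO⟩ := MonSpec.exists_basicOpen hO (p := φ ⟨x, hxW⟩) ⟨_, hx, rfl⟩
  obtain ⟨V, hVW, hV⟩ := X.exists_basic φ f
  refine ⟨V, fun y hy => ?_, (hV ⟨x, hxW⟩).2 hf, X.isAffineOpen_basic φ hφ f hVW hV⟩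
  obtain ⟨z, hz, e⟩ := hfO ((hV ⟨y, hVW hy⟩).1 hy)
  have := φ.injective e
  subst this
  exact hz

/-- A chart `W` at the closed point of `U` contains `U`, so `𝒪(U)` is a localization `𝒪(W)_f`. It is
generated by the generators of `𝒪(W)` and the inverse `g` of `f`. -/
theorem IsNoetherian.fg (hX : X.IsNoetherian) {U : Opens X.carrier} (hU : X.IsAffineOpen U) :
    Monoid.FG (X.presheaf.obj (op U)) := by
  classical
  rcases hU.subsingleton_or with hs | ⟨u, -, hu⟩
  · exact ⟨⟨∅, Subsingleton.elim _ _⟩⟩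
  · obtain ⟨W, hW, hWa, hfg⟩ := hX.2 u
    obtain ⟨f, hf⟩ := hWa.exists_localization hU (hu W hW)
    obtain ⟨s, hs⟩ := Monoid.fg_def.1 hfg
    have hfu : IsUnit (X.res (hu W hW) f) := hf.map_units ⟨f, Submonoid.mem_powers f⟩
    obtain ⟨g, hg⟩ := hfu.exists_right_inv
    refine Monoid.fg_def.2 ⟨insert g (s.image (X.res (hu W hW))), eq_top_iff.2 fun b _ => ?_⟩
    obtain ⟨⟨a, ⟨_, n, rfl⟩⟩, hab⟩ := hf.surj b
    simp only [_root_.map_pow] at hab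
    have hb : b = X.res (hu W hW) a * g ^ n := by
      rw [← hab, mul_assoc, ← mul_pow, hg, one_pow, mul_one]
    rw [hb]
    refine mul_mem ?_ (pow_mem (Submonoid.subset_closure (by simp)) n)
    have ha : a ∈ Submonoid.closure (s : Set (X.presheaf.obj (op W))) := by rw [hs]; trivial
    have := Submonoid.mem_map_of_mem (X.res (hu W hW)).toMonoidHom ha
    rw [MonoidHom.map_mclosure] at this
    exact Submonoid.closure_mono (by
      rintro _ ⟨y, hy, rfl⟩
      simp only [Finset.coe_insert, Finset.coe_image]
      exact Or.inr ⟨y, hy, rfl⟩) this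

end MonoidalSpace

/-! ### Coherent sheaves on affine open subsets -/

namespace SetSheaf

variable {X : MonoidalSpace.{u}}

theorem subsingleton (M : SetSheaf X) {U : Opens X.carrier}
    [Subsingleton (X.presheaf.obj (op U))] : Subsingleton (M.val.obj (op U)) := by
  refine subsingleton_of_forall_eq 0 fun m => ?_
  rw [← one_smul (X.presheaf.obj (op U)) m, Subsingleton.elim (1 : X.presheaf.obj (op U)) 0,
    zero_smul]

theorem subsingleton_of_le {U V : Opens X.carrier} (h : V ≤ U)
    [Subsingleton (X.presheaf.obj (op U))] : Subsingleton (X.presheaf.obj (op V)) := by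
  refine subsingleton_of_zero_eq_one ?_
  rw [← _root_.map_zero (X.res h), ← _root_.map_one (X.res h),
    Subsingleton.elim (1 : X.presheaf.obj (op U)) 0]

/-- The restriction map of `M` is a localization at `f`. -/
def IsLocalizedAt (M : SetSheaf X) {U V : Opens X.carrier} (h : V ≤ U)
    (f : X.presheaf.obj (op U)) : Prop :=
  (∀ n : M.val.obj (op V), ∃ (m : M.val.obj (op U)) (k : ℕ), X.res h f ^ k • n = M.res h m) ∧
    ∀ m m' : M.val.obj (op U), M.res h m = M.res h m' → ∃ k : ℕ, f ^ k • m = f ^ k • m'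

/-- Denominators `g` can be exchanged for denominators `e`. Since `g` is invertible on `W` and `𝒪(W)
= 𝒪(V)_e`, some power of `e` is a multiple of `g` in `𝒪(V)`. Sections over `V` are compared by
multiplying them with powers of `f`, which is invertible on `V`, until they extend to `U`. -/
theorem IsLocalizedAt.of_le {M : SetSheaf X} {U V W : Opens X.carrier} (h : V ≤ U) (h' : W ≤ V)
    {f g : X.presheaf.obj (op U)} {e : X.presheaf.obj (op V)}
    (hf : IsUnit (X.res h f))
    (hg : IsUnit (X.res (h'.trans h) g))
    (he : (Submonoid.powers e).IsLocalizationMap (X.res h'))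
    (hV : M.IsLocalizedAt h f) (hW : M.IsLocalizedAt (h'.trans h) g) :
    M.IsLocalizedAt h' e := by
  obtain ⟨d, hd⟩ := hg.exists_right_inv
  obtain ⟨⟨c, ⟨_, j, rfl⟩⟩, hc⟩ := he.surj d
  simp only [_root_.map_pow] at hc
  -- The inverse `d` of `g` on `W` is the fraction `c / e ^ j`; hence `c * g` and `e ^ j` agree on
  -- `W`, and on `V` after multiplication with `e ^ l`.
  have hce : X.res h' (c * X.res h g) = X.res h' (e ^ j) := by
    rw [_root_.map_mul, X.res_res, ← hc, _root_.map_pow, mul_right_comm, mul_comm d, hd, one_mul]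
  obtain ⟨⟨_, l, rfl⟩, hl⟩ := he.exists_of_eq hce
  simp only at hl
  constructor
  · intro n
    obtain ⟨m, k, hk⟩ := hW.1 n
    refine ⟨c ^ k • M.res h m, j * k, ?_⟩
    rw [M.res_smul, ← M.res_res, ← hk, ← mul_smul, _root_.map_pow, ← X.res_res h h' g,
      ← mul_pow, ← _root_.map_mul, hce, _root_.map_pow, pow_mul]
  · intro m m' hm
    obtain ⟨m₁, a, ha⟩ := hV.1 m
    obtain ⟨m₁', a', ha'⟩ := hV.1 m'
    have key : M.res (h'.trans h) (f ^ a' • m₁) = M.res (h'.trans h) (f ^ a • m₁') := by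
      rw [M.res_res h h', M.res_res h h', M.res_smul h, M.res_smul h, ← ha, ← ha', ← mul_smul,
        ← mul_smul, M.res_smul, M.res_smul, hm, _root_.map_pow, _root_.map_pow, mul_comm]
    obtain ⟨k, hk⟩ := hW.2 _ _ key
    have h1 := congrArg (M.res h) hk
    simp only [M.res_smul, ← ha, ← ha', _root_.map_pow] at h1
    have h2 : X.res h g ^ k • m = X.res h g ^ k • m' := by
      -- The factors `f ^ a` and `f ^ a'` that were used to extend `m` and `m'` to `U` are
      -- cancelled.
      obtain ⟨w, hw⟩ := (hf.pow (a + a')).exists_left_inv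
      rw [← mul_smul, ← mul_smul, ← mul_smul, ← mul_smul] at h1
      have h3 := congrArg (w • ·) h1
      simp only [← mul_smul] at h3
      have e1 : w * (X.res h g ^ k * (X.res h f ^ a' * X.res h f ^ a)) = X.res h g ^ k := by
        rw [← pow_add, add_comm a', mul_left_comm, hw, mul_one]
      have e2 : w * (X.res h g ^ k * (X.res h f ^ a * X.res h f ^ a')) = X.res h g ^ k := by
        rw [← pow_add, mul_left_comm, hw, mul_one]
      simp only [mul_assoc] at h3
      rwa [e1, e2] at h3
    -- `e ^ (l + j)` is a multiple of `g`, so its `k`-th power is a multiple of `g ^ k`.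
    refine ⟨(l + j) * k, ?_⟩
    have e3 : e ^ ((l + j) * k) = (e ^ l * c) ^ k * X.res h g ^ k := by
      rw [pow_mul, pow_add, ← mul_pow, mul_assoc, hl]
    rw [e3, mul_smul, mul_smul, h2]

theorem IsCoherent.exists_chart {M : SetSheaf X} (hM : M.IsCoherent) (u : X.carrier) :
    ∃ U : Opens X.carrier, u ∈ U ∧ X.IsAffineOpen U ∧
      (∀ (V : Opens X.carrier) (h : V ≤ U), X.IsAffineOpen V →
        ∃ f, IsUnit (X.res h f) ∧ M.IsLocalizedAt h f) ∧
      ∃ s : Finset (M.val.obj (op U)), ∀ m : M.val.obj (op U),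
        ∃ a : X.presheaf.obj (op U), ∃ y ∈ s, m = a • y := by
  obtain ⟨U, φ, hu, hφ, hass, hs⟩ := hM u
  refine ⟨U, hu, ⟨φ, hφ⟩, fun V h hV => ?_, hs⟩
  obtain ⟨f, hf⟩ := X.exists_eq_basic φ hV h
  exact ⟨f, (hφ f V h hf).map_units ⟨f, Submonoid.mem_powers f⟩, hass f V h hf⟩

/-- A coherent sheaf is associated with its sections on every affine open subset. -/
theorem IsCoherent.isLocalizedAt {M : SetSheaf X} (hM : M.IsCoherent) {U V : Opens X.carrier}
    (hU : X.IsAffineOpen U) (hV : X.IsAffineOpen V) (h : V ≤ U) {f : X.presheaf.obj (op U)}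
    (hf : (Submonoid.powers f).IsLocalizationMap (X.res h)) : M.IsLocalizedAt h f := by
  rcases hU.subsingleton_or with hs | ⟨u, -, hu⟩
  · have := M.subsingleton (U := U)
    have := subsingleton_of_le h
    have := M.subsingleton (U := V)
    exact ⟨fun n => ⟨0, 0, Subsingleton.elim _ _⟩, fun m m' _ => ⟨0, Subsingleton.elim _ _⟩⟩
  -- The chart `W` at the closed point of `U` contains `U`. The restrictions from `W` to `U` and
  -- from `W` to `V` are localizations, hence so is the one from `U` to `V`.
  · obtain ⟨W, hW, -, hloc, -⟩ := hM.exists_chart u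
    obtain ⟨g, hg, hgU⟩ := hloc U (hu W hW) hU
    obtain ⟨g', hg', hgV⟩ := hloc V (h.trans (hu W hW)) hV
    exact IsLocalizedAt.of_le (hu W hW) h hg hg' hf hgU hgV

/-- A chart at the closed point of `U` contains `U`, and generators over the chart also generate the
localization. -/
theorem IsCoherent.fg {M : SetSheaf X} (hM : M.IsCoherent) {U : Opens X.carrier}
    (hU : X.IsAffineOpen U) : ∃ s : Finset (M.val.obj (op U)), ∀ m : M.val.obj (op U),
      ∃ a : X.presheaf.obj (op U), ∃ y ∈ s, m = a • y := by
  classical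
  rcases hU.subsingleton_or with hs | ⟨u, -, hu⟩
  · have := M.subsingleton (U := U)
    exact ⟨{0}, fun m => ⟨0, 0, by simp, Subsingleton.elim _ _⟩⟩
  · obtain ⟨W, hW, -, hloc, s, hs⟩ := hM.exists_chart u
    obtain ⟨f, hf, hfU⟩ := hloc U (hu W hW) hU
    refine ⟨s.image (M.res (hu W hW)), fun n => ?_⟩
    obtain ⟨m, k, hk⟩ := hfU.1 n
    obtain ⟨a, y, hy, rfl⟩ := hs m
    obtain ⟨w, hw⟩ := (hf.pow k).exists_left_inv
    refine ⟨w * X.res (hu W hW) a, _, Finset.mem_image_of_mem _ hy, ?_⟩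
    rw [mul_smul, ← M.res_smul, ← hk, ← mul_smul, hw, one_smul]

theorem isCoherent_of_affine (hX : X.IsM0Scheme) {M : SetSheaf X}
    (hloc : ∀ (U V : Opens X.carrier) (h : V ≤ U) (f : X.presheaf.obj (op U)), X.IsAffineOpen U →
      X.IsAffineOpen V → (Submonoid.powers f).IsLocalizationMap (X.res h) → M.IsLocalizedAt h f)
    (hfg : ∀ U : Opens X.carrier, X.IsAffineOpen U →
      ∃ s : Finset (M.val.obj (op U)), ∀ m : M.val.obj (op U),
        ∃ a : X.presheaf.obj (op U), ∃ y ∈ s, m = a • y) : M.IsCoherent := by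
  intro x
  obtain ⟨U, hx, φ, hφ⟩ := hX x
  exact ⟨U, φ, hx, hφ, fun f V h hf => hloc U V h f ⟨φ, hφ⟩
    (X.isAffineOpen_basic φ hφ f h hf) (hφ f V h hf), hfg U ⟨φ, hφ⟩⟩

end SetSheaf

/-! ### Extension of additive maps along localizations -/

section Extension

variable {A B : Type u} [CommMonoidWithZero A] [CommMonoidWithZero B]
  {M N : Type u} [Zero N] [MulActionWithZero B N]
  {R : Type v} [Ring R] {G : Type v} [AddCommGroup G] [Module R G]

/-- Every `n` is of the form `w • r m` with `w` an inverse of a power of `e`. The maps are only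
required to be equivariant along `ρ`, so that semilinear maps, such as restrictions to a smaller
open subset, are covered. -/
theorem ZSet.addHom_ext_of_localized {r : M → N} {e : B} (he : IsUnit e)
    (hsurj : ∀ n, ∃ (m : M) (k : ℕ), e ^ k • n = r m) (ρ : B →*₀ R) {φ ψ : ZSet N →+ G}
    (hφ : ∀ (b : B) (n : N), φ (ZSet.of (b • n)) = ρ b • φ (ZSet.of n))
    (hψ : ∀ (b : B) (n : N), ψ (ZSet.of (b • n)) = ρ b • ψ (ZSet.of n))
    (h : ∀ m, φ (ZSet.of (r m)) = ψ (ZSet.of (r m))) : φ = ψ := by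
  refine ZSet.addHom_ext fun n => ?_
  obtain ⟨m, k, hk⟩ := hsurj n
  obtain ⟨w, hw⟩ := (he.pow k).exists_left_inv
  have hn : n = w • r m := by rw [← hk, ← mul_smul, hw, one_smul]
  rw [hn, hφ, hψ, h]

variable [Zero M] [MulActionWithZero A M]

/-- This is the universal property of a localization of sets with an action: the fraction `n = m / f
^ k` is sent to `w ^ k • h m`, where `w` is the inverse of `θ f`. -/
theorem ZSet.exists_addHom_of_localized (θ : A →*₀ B) (f : A)
    (hθ : (Submonoid.powers f).IsLocalizationMap θ) {r : M → N}
    (hr : ∀ (a : A) (m : M), r (a • m) = θ a • r m)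
    (hsurj : ∀ n, ∃ (m : M) (k : ℕ), θ f ^ k • n = r m)
    (hinj : ∀ m m', r m = r m' → ∃ k : ℕ, f ^ k • m = f ^ k • m')
    (ρ : B →*₀ R) (h : M → G) (h0 : h 0 = 0) (hh : ∀ (a : A) (m : M), h (a • m) = ρ (θ a) • h m) :
    ∃ φ : ZSet N →+ G, (∀ (b : B) (n : N), φ (ZSet.of (b • n)) = ρ b • φ (ZSet.of n)) ∧
      ∀ m, φ (ZSet.of (r m)) = h m := by
  have he : IsUnit (θ f) := hθ.map_units ⟨f, Submonoid.mem_powers f⟩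
  obtain ⟨w, hw⟩ := he.exists_left_inv
  have hwk : ∀ k, w ^ k * θ f ^ k = 1 := fun k => by rw [← mul_pow, hw, one_pow]
  -- The value does not depend on the representation of `n` as a fraction.
  have key : ∀ (n : N) (m m' : M) (k l : ℕ), θ f ^ k • n = r m → θ f ^ l • n = r m' →
      ρ (w ^ k) • h m = ρ (w ^ l) • h m' := by
    intro n m m' k l hk hl
    have : r (f ^ l • m) = r (f ^ k • m') := by
      rw [hr, hr, ← hk, ← hl, ← mul_smul, ← mul_smul, _root_.map_pow, _root_.map_pow, mul_comm]
    obtain ⟨j, hj⟩ := hinj _ _ this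
    rw [← mul_smul, ← mul_smul, ← pow_add, ← pow_add] at hj
    -- From `f ^ (j + l) • m = f ^ (j + k) • m'`, multiplication with `w ^ (j + l + k)` leaves `w ^
    -- k` on the left and `w ^ l` on the right.
    have h1 := congrArg (ρ (w ^ (j + l + k)) • ·) (congrArg h hj)
    simp only [hh, ← mul_smul, ← _root_.map_mul, _root_.map_pow θ] at h1
    have e1 : w ^ (j + l + k) * θ f ^ (j + l) = w ^ k := by
      rw [pow_add, mul_right_comm, hwk, one_mul]
    have e2 : w ^ (j + l + k) * θ f ^ (j + k) = w ^ l := by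
      rw [show j + l + k = j + k + l by omega, pow_add, mul_right_comm, hwk, one_mul]
    rwa [e1, e2] at h1
  choose m k hk using hsurj
  let h' : N → G := fun n => ρ (w ^ k n) • h (m n)
  have hh' : ∀ (n : N) (m : M) (k : ℕ), θ f ^ k • n = r m → h' n = ρ (w ^ k) • h m :=
    fun n m k e => key _ _ _ _ _ (hk n) e
  have hr0 : r 0 = 0 := by
    have := hr 0 0
    rwa [zero_smul, _root_.map_zero, zero_smul] at this
  refine ⟨ZSet.lift h' ?_, fun b n => ?_, fun m => ?_⟩
  · rw [hh' 0 0 0 (by simp [hr0]), h0, smul_zero]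
  · rw [ZSet.lift_of, ZSet.lift_of]
    obtain ⟨⟨a, ⟨_, p, rfl⟩⟩, hab⟩ := hθ.surj b
    simp only [_root_.map_pow] at hab
    rw [hh' (b • n) (a • m n) (k n + p), hh, ← mul_smul, ← hab, ← _root_.map_mul, ← mul_smul,
      ← _root_.map_mul]
    · congr 2
      rw [pow_add, show w ^ k n * w ^ p * (b * θ f ^ p) = w ^ k n * b * (w ^ p * θ f ^ p) by
        ac_rfl, hwk, mul_one, mul_comm]
    · rw [hr, ← hab, ← hk, ← mul_smul, ← mul_smul, pow_add]
      congr 1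
      ac_rfl
  · rw [ZSet.lift_of, hh' (r m) m 0 (by simp)]
    simp

theorem ZSet.map_smul_of {G : Type v} [AddCommGroup G] [Module (ZRing B) G] (φ : ZSet N →+ G)
    (hφ : ∀ (b : B) (n : N), φ (ZSet.of (b • n)) = (ZRing.of b : ZRing B) • φ (ZSet.of n))
    (x : ZRing B) (y : ZSet N) : φ (x • y) = x • φ y := by
  induction x using ZRing.induction with
  | zero => simp
  | of b =>
    induction y using ZSet.induction with
    | zero => simp
    | of n => rw [ZSet.of_smul_of, hφ]
    | add y z hy hz => rw [smul_add, _root_.map_add, hy, hz, _root_.map_add, smul_add]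
    | neg y hy => rw [smul_neg, _root_.map_neg, hy, _root_.map_neg, smul_neg]
  | add x y hx hy => rw [add_smul, _root_.map_add, hx, hy, add_smul]
  | neg x hx => rw [neg_smul, _root_.map_neg, hx, neg_smul]

end Extension

/-! ### Morphisms from `M_ℤ` and their values on an affine open subset -/

namespace SetSheaf

variable {X : MonoidalSpace.{u}}

/-- The restriction map of a presheaf of modules on the affine open subsets. -/
def affRes (P : PresheafOfModules.{u} X.affRing) {U V : X.AffOpens} (i : V ⟶ U) :
    P.obj (op U) →+ P.obj (op V) :=
  (P.map i.op).hom.toAddMonoidHom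

theorem affRes_smul (P : PresheafOfModules.{u} X.affRing) {U V : X.AffOpens} (i : V ⟶ U)
    (r : X.affRing.obj (op U)) (x : P.obj (op U)) :
    affRes P i (r • x) = (X.affRing.map i.op r : X.affRing.obj (op V)) • affRes P i x :=
  P.map_smul i.op r x

theorem affRes_affRes (P : PresheafOfModules.{u} X.affRing) {U V W : X.AffOpens} (i : V ⟶ U)
    (j : W ⟶ V) (x : P.obj (op U)) : affRes P j (affRes P i x) = affRes P (j ≫ i) x :=
  (P.map_comp_apply i.op j.op x).symm

theorem affRes_id (P : PresheafOfModules.{u} X.affRing) {U : X.AffOpens} (i : U ⟶ U)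
    (x : P.obj (op U)) : affRes P i x = x := by
  obtain rfl : i = 𝟙 U := Subsingleton.elim _ _
  exact congrArg (fun f => f x) (P.map_id (op U))

theorem app_affRes {P Q : PresheafOfModules.{u} X.affRing} (f : P ⟶ Q) {U V : X.AffOpens}
    (i : V ⟶ U) (x : P.obj (op U)) : f.app (op V) (affRes P i x) = affRes Q i (f.app (op U) x) :=
  PresheafOfModules.naturality_apply f i.op x

/-- A presheaf of modules on the affine open subsets such that compatible families of
sections on the affine open subsets of `U ∩ V` glue to sections on `V`. -/
def GluesOver (P : PresheafOfModules.{u} X.affRing) (U : X.AffOpens) : Prop :=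
  ∀ (V : X.AffOpens) (s : ∀ W : X.AffOpens, (W ⟶ U) → (W ⟶ V) → P.obj (op W)),
    (∀ (W W' : X.AffOpens) (i : W ⟶ U) (j : W ⟶ V) (k : W' ⟶ W),
      affRes P k (s W i j) = s W' (k ≫ i) (k ≫ j)) →
    ∃! t : P.obj (op V), ∀ (W : X.AffOpens) (i : W ⟶ U) (j : W ⟶ V), affRes P j t = s W i j

/-- The section of `M_ℤ` that is given by a section of `M`. -/
def ofSection (M : SetSheaf X) (U : X.AffOpens) (m : M.val.obj (op U.1)) :
    (affModule.obj M).obj (op U) :=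
  (ZSet.of m : ZSet (M.val.obj (op U.1)))

/-- The section of `𝒪_ℤ` that is given by a section of `𝒪`. -/
def ofRing (U : X.AffOpens) : X.presheaf.obj (op U.1) →*₀ X.affRing.obj (op U) :=
  (ZRing.of : X.presheaf.obj (op U.1) →*₀ ZRing (X.presheaf.obj (op U.1)))

theorem ofSection_smul (M : SetSheaf X) (U : X.AffOpens) (a : X.presheaf.obj (op U.1))
    (m : M.val.obj (op U.1)) : M.ofSection U (a • m) = ofRing U a • M.ofSection U m :=
  (ZSet.of_smul_of _ _).symm

theorem affRes_ofSection (M : SetSheaf X) {U V : X.AffOpens} (i : V ⟶ U)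
    (m : M.val.obj (op U.1)) :
    affRes (affModule.obj M) i (M.ofSection U m) = M.ofSection V (M.res (leOfHom i) m) :=
  ZSet.map_of _ (M.res_zero _) _

theorem map_ofRing {U V : X.AffOpens} (i : V ⟶ U) (a : X.presheaf.obj (op U.1)) :
    X.affRing.map i.op (ofRing U a) = ofRing V (X.res (leOfHom i) a) :=
  ZRing.map_of _ _

theorem IsCoherent.addHom_ext {M : SetSheaf X} (hM : M.IsCoherent) {U W : X.AffOpens} (i : W ⟶ U)
    {R : Type v} [Ring R] {G : Type v} [AddCommGroup G] [Module R G]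
    (ρ : X.presheaf.obj (op W.1) →*₀ R) {φ ψ : (affModule.obj M).obj (op W) →+ G}
    (hφ : ∀ b n, φ (M.ofSection W (b • n)) = ρ b • φ (M.ofSection W n))
    (hψ : ∀ b n, ψ (M.ofSection W (b • n)) = ρ b • ψ (M.ofSection W n))
    (h : ∀ m, φ (M.ofSection W (M.res (leOfHom i) m)) = ψ (M.ofSection W (M.res (leOfHom i) m))) :
    φ = ψ := by
  obtain ⟨f, hf⟩ := U.2.exists_localization W.2 (leOfHom i)
  have hl := hM.isLocalizedAt U.2 W.2 (leOfHom i) hf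
  exact ZSet.addHom_ext_of_localized (hf.map_units ⟨f, Submonoid.mem_powers f⟩) hl.1 ρ hφ hψ h

theorem IsCoherent.exists_extension {M : SetSheaf X} (hM : M.IsCoherent) {U W : X.AffOpens}
    (i : W ⟶ U) (P : PresheafOfModules.{u} X.affRing)
    (h : (affModule.obj M).obj (op U) ⟶ P.obj (op U)) :
    ∃ g : (affModule.obj M).obj (op W) ⟶ P.obj (op W),
      ∀ m, g (M.ofSection W (M.res (leOfHom i) m)) = affRes P i (h (M.ofSection U m)) := by
  obtain ⟨f, hf⟩ := U.2.exists_localization W.2 (leOfHom i)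
  have hl := hM.isLocalizedAt U.2 W.2 (leOfHom i) hf
  obtain ⟨φ, hφ, hφ'⟩ := ZSet.exists_addHom_of_localized (X.res (leOfHom i)) f hf
    (M.res_smul (leOfHom i)) hl.1 hl.2 (ofRing W) (fun m => affRes P i (h (M.ofSection U m))) (by
      rw [show M.ofSection U 0 = 0 from ZSet.of_zero, _root_.map_zero, _root_.map_zero])
    (fun a m => by rw [ofSection_smul, _root_.map_smul, affRes_smul, map_ofRing])
  exact ⟨ModuleCat.ofHom (X := (affModule.obj M).obj (op W)) (Y := P.obj (op W))
    { φ with map_smul' := @ZSet.map_smul_of _ _ _ _ _ (P.obj (op W)) _ (P.obj (op W)).isModule φ hφ }, hφ'⟩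

/-- On the affine open subset `U`, the functor `M ↦ M_ℤ` is left adjoint to evaluation. -/
theorem IsCoherent.bijective_app {M : SetSheaf X} (hM : M.IsCoherent) {U : X.AffOpens}
    {P : PresheafOfModules.{u} X.affRing} (hP : GluesOver P U) :
    Function.Bijective fun f : affModule.obj M ⟶ P => f.app (op U) := by
  have hlin : ∀ {W : X.AffOpens} (g : (affModule.obj M).obj (op W) ⟶ P.obj (op W))
      (b : X.presheaf.obj (op W.1)) (n), g (M.ofSection W (b • n)) =
        ofRing W b • g (M.ofSection W n) := fun g b n => by
    rw [ofSection_smul, _root_.map_smul]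
  have huniq : ∀ {W : X.AffOpens} (i : W ⟶ U)
      (g g' : (affModule.obj M).obj (op W) ⟶ P.obj (op W)),
      (∀ m, g (M.ofSection W (M.res (leOfHom i) m)) = g' (M.ofSection W (M.res (leOfHom i) m))) →
      g = g' := fun {W} i g g' h => by
    have := hM.addHom_ext i (ofRing W) (φ := g.hom.toAddMonoidHom) (ψ := g'.hom.toAddMonoidHom)
      (hlin g) (hlin g') h
    ext x
    exact DFunLike.congr_fun this x
  constructor
  · intro f g hfg
    have hfg : f.app (op U) = g.app (op U) := hfg
    -- For `W` inside `U`, the set `M(W)` is a localization of `M(U)`, so morphisms that agree on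
    -- `U` agree on `W`. For an arbitrary `V`, uniqueness of gluing over the affine open subsets of
    -- `U ∩ V` then applies.
    have hW : ∀ (W : X.AffOpens) (i : W ⟶ U), f.app (op W) = g.app (op W) := fun W i =>
      huniq i _ _ fun m => by
        rw [← affRes_ofSection M i, app_affRes, app_affRes, hfg]
    ext V x
    have hu := hP V.unop (fun W i j => affRes P j (f.app V x)) (fun W W' i j k => by
      rw [affRes_affRes])
    refine hu.unique (fun W i j => rfl) fun W i j => ?_
    have e := app_affRes f j x
    rw [hW W i] at e
    exact (app_affRes g j x).symm.trans e
  · intro h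
    -- Conversely, the given map on `U` extends to the localizations `M(W)` for `W` inside `U`. For
    -- an arbitrary `V`, the image `t` of a section is glued from the values of these extensions on
    -- the affine open subsets of `U ∩ V`.
    choose g hg using fun (W : X.AffOpens) (i : W ⟶ U) => hM.exists_extension i P h
    have hcomp : ∀ (W W' : X.AffOpens) (i : W ⟶ U) (k : W' ⟶ W) (x),
        affRes P k (g W i x) = g W' (k ≫ i) (affRes (affModule.obj M) k x) := fun W W' i k x => by
      have := hM.addHom_ext i ((ofRing W').comp (X.res (leOfHom k)))
        (φ := (affRes P k).comp (g W i).hom.toAddMonoidHom)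
        (ψ := (g W' (k ≫ i)).hom.toAddMonoidHom.comp (affRes (affModule.obj M) k)) ?_ ?_ ?_
      · exact DFunLike.congr_fun this x
      · intro b n
        change affRes P k (g W i _) = _
        rw [hlin, affRes_smul, map_ofRing]
        rfl
      · intro b n
        change g W' (k ≫ i) (affRes (affModule.obj M) k _) = _
        rw [affRes_ofSection, M.res_smul, hlin, ← affRes_ofSection]
        rfl
      · intro m
        change affRes P k (g W i _) = g W' (k ≫ i) (affRes (affModule.obj M) k _)
        rw [hg, affRes_affRes, affRes_ofSection, ← M.res_res, hg]
    choose t ht ht' using fun (V : X.AffOpens) (x : (affModule.obj M).obj (op V)) =>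
      hP V (fun W i j => g W i (affRes (affModule.obj M) j x)) (fun W W' i j k => by
        rw [hcomp, affRes_affRes])
    let f : affModule.obj M ⟶ P :=
      { app := fun V => ModuleCat.ofHom (X := (affModule.obj M).obj V) (Y := P.obj V)
          { toFun := t V.unop
            map_add' := fun x y => (ht' _ _ _ fun W i j => by
              rw [_root_.map_add, ht, ht, _root_.map_add, _root_.map_add]).symm
            map_smul' := fun r x => (ht' V.unop _ (r • t V.unop x) fun W i j => by
              refine (affRes_smul P j r _).trans ?_
              rw [ht V.unop x W i j, ← _root_.map_smul]
              exact congrArg (g W i) (affRes_smul (affModule.obj M) j r x).symm).symm }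
        naturality := fun {V V'} k => by
          ext x
          exact (ht' V'.unop (affRes (affModule.obj M) k.unop x) (affRes P k.unop (t V.unop x))
            fun W i j => by rw [affRes_affRes, ht, affRes_affRes]).symm }
    refine ⟨f, huniq (𝟙 U) _ _ fun m => ?_⟩
    change t U _ = _
    rw [← affRes_id P (𝟙 U) (t U _), ht U _ U (𝟙 U), affRes_id, hg, affRes_id]
    have : M.res (leOfHom (𝟙 U)) m = m := M.res_refl m
    rw [this]

end SetSheaf

/-- An injection of pointed sets has a pointed retraction. It need not be equivariant, but it
induces an additive retraction, which suffices for injectivity. -/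
theorem ZSet.map_injective {M N : Type u} [Zero M] [Zero N] (f : M → N) (hf : f 0 = 0)
    (h : Function.Injective f) : Function.Injective (ZSet.map f hf) := by
  have hg : Function.invFun f 0 = 0 := by
    rw [← hf]
    exact Function.leftInverse_invFun h 0
  refine Function.LeftInverse.injective (g := ZSet.map (Function.invFun f) hg) fun x => ?_
  rw [← ZSet.map_eq_map_map f hf _ hg id rfl fun m => (Function.leftInverse_invFun h m).symm]
  exact ZSet.map_eq_self id rfl (fun _ => rfl) x

/-- By the two adjunctions and the hypotheses on `F₁` and `F₂`, the objects `L F` and `T (ev F)`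
corepresent the same functor for `F = F₁, F₂`. The comparison `β` is compatible with `φ`, so `L φ`
is identified with `T (ev φ)`. In the application, `L` is base extension restricted to `U_ℤ`, `ev`
takes sections over `U`, and `T` is the functor `N ↦ N^~`. -/
theorem mono_map_of_bijective {C D A : Type*} [Category* C] [Category* D] [Category* A] {L : C ⥤ D}
    {G : D ⥤ C} (adj : L ⊣ G) (ev : C ⥤ A) {T : A ⥤ D} (adjT : T ⊣ G ⋙ ev) {F₁ F₂ : C}
    (h₁ : ∀ P, Function.Bijective fun g : F₁ ⟶ G.obj P => ev.map g)
    (h₂ : ∀ P, Function.Bijective fun g : F₂ ⟶ G.obj P => ev.map g)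
    (φ : F₁ ⟶ F₂) [Mono (T.map (ev.map φ))] : Mono (L.map φ) := by
  let β : ∀ F : C, T.obj (ev.obj F) ⟶ L.obj F := fun F =>
    (adjT.homEquiv _ _).symm (ev.map (adj.unit.app F))
  have hβ : ∀ (F : C) (P : D) (k : L.obj F ⟶ P),
      adjT.homEquiv _ _ (β F ≫ k) = ev.map (adj.homEquiv _ _ k) := fun F P k => by
    rw [adjT.homEquiv_naturality_right, Equiv.apply_symm_apply, adj.homEquiv_unit, ev.map_comp]
    rfl
  have hiso : ∀ F : C, (∀ P, Function.Bijective fun g : F ⟶ G.obj P => ev.map g) → IsIso (β F) :=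
    fun F hF => (isIso_iff_coyoneda_map_bijective _).2 fun P => by
      have : (fun k : L.obj F ⟶ P => β F ≫ k) = (adjT.homEquiv _ _).symm ∘
          (fun g : F ⟶ G.obj P => ev.map g) ∘ adj.homEquiv F P := by
        funext k
        exact (Equiv.eq_symm_apply _).2 (hβ F P k)
      rw [this]
      exact (Equiv.bijective _).comp ((hF P).comp (Equiv.bijective _))
  have := hiso F₁ h₁
  have := hiso F₂ h₂
  have nat : T.map (ev.map φ) ≫ β F₂ = β F₁ ≫ L.map φ := by
    apply (adjT.homEquiv _ _).injective
    rw [hβ, adjT.homEquiv_naturality_left, Equiv.apply_symm_apply, ← ev.map_comp,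
      adj.homEquiv_unit, adj.unit_naturality]
  have e : L.map φ = inv (β F₁) ≫ T.map (ev.map φ) ≫ β F₂ := by
    rw [nat, IsIso.inv_hom_id_assoc]
  rw [e]
  infer_instance

/-! ### The charts `U_ℤ` of `X_ℤ` and the sections over them -/

namespace MonoidalSpace

variable {X : MonoidalSpace.{u}}

/-- The gluing diagram is locally directed: points of two charts become equal in the colimit only if
they come from a common smaller chart. So `U_ℤ ∩ V_ℤ` is covered by the `W_ℤ` with `W` affine in `U
∩ V`. -/
theorem mem_affOpen_of_mem {U V : X.AffOpens} {x : X.baseChange} (hU : x ∈ X.affOpen.obj U)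
    (hV : x ∈ X.affOpen.obj V) :
    ∃ (W : X.AffOpens) (_ : W ⟶ U) (_ : W ⟶ V), x ∈ X.affOpen.obj W := by
  obtain ⟨y, hy⟩ := hU
  obtain ⟨z, hz⟩ := hV
  obtain ⟨W, i, j, w, hw, -⟩ := (Scheme.IsLocallyDirected.ι_eq_ι_iff X.affDiagram
    (i := U) (j := V) (xi := y) (xj := z)).1 (hy.trans hz.symm)
  refine ⟨W, i, j, w, ?_⟩
  rw [← hy, ← X.map_toBaseChange i]
  exact (Scheme.Hom.comp_apply _ _ _).trans (congrArg (X.toBaseChange U) hw)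

theorem exists_mem_affOpen (x : X.baseChange) : ∃ U : X.AffOpens, x ∈ X.affOpen.obj U := by
  obtain ⟨U, y, hy⟩ := Scheme.IsLocallyDirected.ι_jointly_surjective X.affDiagram x
  exact ⟨U, y, hy⟩

/-- The sections over the subsets `(U ∩ V)_ℤ` of `U_ℤ`, for `V` affine open in `X`. -/
def affSections (U : X.AffOpens) :
    (Spec (.of (ZRing (X.presheaf.obj (op U.1))))).Modules ⥤ PresheafOfModules.{u} X.affRing :=
  Scheme.Modules.pushforward (X.toBaseChange U) ⋙
    (SheafOfModules.forget X.baseChange.ringCatSheaf ⋙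
      PresheafOfModules.restrictScalars (𝟙 X.baseChange.ringCatSheaf.obj)) ⋙
        PresheafOfModules.pushforward X.affRingHom

/-- The left adjoint of `affSections`. -/
def affSectionsAdjunction (U : X.AffOpens) :
    (PresheafOfModules.pullback X.affRingHom ⋙
      PresheafOfModules.sheafification (𝟙 X.baseChange.ringCatSheaf.obj)) ⋙
        Scheme.Modules.restrictFunctor (X.toBaseChange U) ⊣ affSections U :=
  ((PresheafOfModules.pullbackPushforwardAdjunction X.affRingHom).comp
    (PresheafOfModules.sheafificationAdjunction (𝟙 X.baseChange.ringCatSheaf.obj))).comp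
      (Scheme.Modules.restrictAdjunction (X.toBaseChange U))

/-- The value at `V` consists of the sections of `P` over the inverse image of `V_ℤ` in `U_ℤ`, which
is covered by the inverse images of the `W_ℤ` with `W` affine in `U ∩ V`. Gluing is therefore the
sheaf property of `P`. -/
theorem gluesOver_affSections (U : X.AffOpens)
    (P : (Spec (.of (ZRing (X.presheaf.obj (op U.1))))).Modules) :
    SetSheaf.GluesOver ((affSections U).obj P) U := by
  intro V s hs
  let ι := Σ' (W : X.AffOpens) (_ : W ⟶ U), W ⟶ V
  let O : X.AffOpens → (Spec (.of (ZRing (X.presheaf.obj (op U.1))))).Opens :=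
    fun W => X.toBaseChange U ⁻¹ᵁ X.affOpen.obj W
  let O' {W W' : X.AffOpens} (i : W' ⟶ W) : O W' ⟶ O W :=
    homOfLE fun y hy => leOfHom (X.affOpen.map i) hy
  have hO : ∀ (W₁ W₂ : X.AffOpens) (y) (_ : y ∈ O W₁) (_ : y ∈ O W₂),
      ∃ (W : X.AffOpens) (_ : W ⟶ W₁) (_ : W ⟶ W₂), y ∈ O W := fun W₁ W₂ y h₁ h₂ =>
    mem_affOpen_of_mem h₁ h₂
  let σ : ∀ k : ι, Γ(P, O k.1) := fun k => s k.1 k.2.1 k.2.2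
  have hσ : ∀ (k : ι) (W : X.AffOpens) (i : W ⟶ k.1),
      P.presheaf.map (O' i).op (σ k) = σ ⟨W, i ≫ k.2.1, i ≫ k.2.2⟩ := fun k W i =>
    hs k.1 W k.2.1 k.2.2 i
  have := TopCat.Sheaf.existsUnique_gluing' ⟨P.presheaf, P.isSheaf⟩ (fun k : ι => O k.1) (O V)
    (fun k => O' k.2.2) (fun y hy => by
      obtain ⟨W, i, j, hW⟩ := hO U V y ⟨y, rfl⟩ hy
      exact Opens.mem_iSup.2 ⟨⟨W, i, j⟩, hW⟩) σ (fun k l => by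
      -- An overlap of two members of the cover need not be a member, but it is covered by members;
      -- there, compatibility is the hypothesis `hs`.
      refine section_ext (M := P) fun y hy => ?_
      obtain ⟨W, i, j, hW⟩ := hO k.1 l.1 y hy.1 hy.2
      refine ⟨O W, homOfLE (le_inf (leOfHom (O' i)) (leOfHom (O' j))), hW, ?_⟩
      rw [← ConcreteCategory.comp_apply, ← ConcreteCategory.comp_apply, ← Functor.map_comp,
        ← Functor.map_comp]
      exact (hσ k W i).trans (hσ l W j).symm)
  obtain ⟨t, ht, ht'⟩ := this
  exact ⟨t, fun W i j => ht ⟨W, i, j⟩, fun t' h => ht' t' fun k => h k.1 k.2.1 k.2.2⟩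

/-- The module of sections over `U_ℤ`. -/
def affSectionsTop (U : X.AffOpens) : (Spec (.of (ZRing (X.presheaf.obj (op U.1))))).Modules ⥤
    ModuleCat (CommRingCat.of (ZRing (X.presheaf.obj (op U.1)))) :=
  affSections U ⋙ PresheafOfModules.evaluation X.affRing (op U)

/-- The ring `𝒪(U)_ℤ` acts on the sections over the inverse image of `U_ℤ` through the global
sections of its spectrum and through `affRingEquiv`. Their agreement makes `toAffSectionsTop`
linear. -/
theorem ΓSpecIso_inv_map (U : X.AffOpens) :
    (Scheme.ΓSpecIso (.of (ZRing (X.presheaf.obj (op U.1))))).inv ≫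
        (Spec (.of (ZRing (X.presheaf.obj (op U.1))))).presheaf.map
          (homOfLE (le_top : X.toBaseChange U ⁻¹ᵁ X.affOpen.obj U ≤ ⊤)).op =
      (X.affRingEquiv U).inv ≫ (X.toBaseChange U).app (X.affOpen.obj U) := by
  rw [Iso.eq_inv_comp, affRingEquiv_hom, Category.assoc, Iso.hom_inv_id_assoc, Scheme.Hom.appLE,
    Category.assoc, ← Functor.map_comp]
  exact (congrArg _ (CategoryTheory.Functor.map_id _ _)).trans (Category.comp_id _)

/-- Global sections on the spectrum `U_ℤ` are the values of `affSections` at `U`. -/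
def toAffSectionsTop (U : X.AffOpens) :
    moduleSpecΓFunctor (R := CommRingCat.of (ZRing (X.presheaf.obj (op U.1)))) ⟶
      affSectionsTop U where
  app P := ModuleCat.ofHom (X := moduleSpecΓFunctor.obj P) (Y := (affSectionsTop U).obj P)
    { toFun := P.presheaf.map (homOfLE (le_top : X.toBaseChange U ⁻¹ᵁ X.affOpen.obj U ≤ ⊤)).op
      map_add' := _root_.map_add (P.presheaf.map
        (homOfLE (le_top : X.toBaseChange U ⁻¹ᵁ X.affOpen.obj U ≤ ⊤)).op).hom
      map_smul' := fun r x => by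
        refine (P.val.map_smul (homOfLE le_top).op _ x).trans ?_
        refine congrArg (fun c : Γ(Spec (.of (ZRing (X.presheaf.obj (op U.1)))), X.toBaseChange U ⁻¹ᵁ X.affOpen.obj U) =>
          c • P.presheaf.map (homOfLE (le_top : X.toBaseChange U ⁻¹ᵁ X.affOpen.obj U ≤ ⊤)).op x) ?_
        refine .trans ?_ (congrArg (fun g => g.hom r) (ΓSpecIso_inv_map U))
        exact congrArg (fun c => (Spec (.of (ZRing (X.presheaf.obj (op U.1))))).presheaf.map
          (homOfLE (le_top : X.toBaseChange U ⁻¹ᵁ X.affOpen.obj U ≤ ⊤)).op c)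
          (congrArg (fun g : Γ(Spec (.of (ZRing (X.presheaf.obj (op U.1)))), ⊤) ⟶ _ =>
            g ((Scheme.ΓSpecIso (.of (ZRing (X.presheaf.obj (op U.1))))).inv r))
            (CategoryTheory.Functor.map_id _ _)) }
  naturality {P Q} f := by
    ext x
    exact (app_map f _ x).symm

instance (U : X.AffOpens) : IsIso (toAffSectionsTop U) := by
  have : ∀ P, IsIso ((toAffSectionsTop U).app P) := fun P =>
    (ConcreteCategory.isIso_iff_bijective _).2 (by
      have : IsIso (homOfLE (le_top : X.toBaseChange U ⁻¹ᵁ X.affOpen.obj U ≤ ⊤)) :=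
        ⟨homOfLE (X.le_affOpen U), Subsingleton.elim _ _, Subsingleton.elim _ _⟩
      have := (ConcreteCategory.isIso_iff_bijective (P.presheaf.map (homOfLE (le_top : X.toBaseChange U ⁻¹ᵁ X.affOpen.obj U ≤ ⊤)).op)).1 inferInstance
      exact this)
  exact NatIso.isIso_of_isIso_app _

end MonoidalSpace

/-! ### Base extension of injections -/

namespace SetSheaf

variable {X : MonoidalSpace.{u}} {M N : SetSheaf X}

/-- On the chart `U_ℤ`, the base extension of a coherent `M` is the sheaf associated with `M(U)_ℤ`.
The map `M(U)_ℤ ⟶ N(U)_ℤ` is injective, and passing to associated sheaves preserves monomorphisms.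
-/
theorem IsCoherent.mono_baseChange_map (hM : M.IsCoherent) (hN : N.IsCoherent) (f : M ⟶ N)
    (hf : ∀ U, X.IsAffineOpen U → Function.Injective (f.hom.app (op U))) :
    Mono (baseChange.map f) := by
  refine mono_of_restrict _ fun x => ?_
  obtain ⟨U, hU⟩ := MonoidalSpace.exists_mem_affOpen x
  refine ⟨_, X.toBaseChange U, inferInstance, hU, ?_⟩
  have : Mono ((affModule.map f).app (op U)) := (ModuleCat.mono_iff_injective _).2
    (ZSet.map_injective _ (f.map_zero _) (hf U.1 U.2))
  let T : ModuleCat (X.affRing.obj (op U)) ⥤ (Spec (.of (ZRing (X.presheaf.obj (op U.1))))).Modules :=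
    tildeFunctor (.of (ZRing (X.presheaf.obj (op U.1))))
  let e := asIso (MonoidalSpace.toAffSectionsTop U)
  -- The value of `affSections U` at `U` is the module of global sections on `U_ℤ`, whose left
  -- adjoint is the functor of associated sheaves.
  let adjT : T ⊣ MonoidalSpace.affSections U ⋙ PresheafOfModules.evaluation X.affRing (op U) :=
    tilde.adjunction.ofNatIsoRight e
  have hT : T.PreservesMonomorphisms :=
    tildeFunctor_preservesMono (.of (ZRing (X.presheaf.obj (op U.1))))
  have : Mono ((PresheafOfModules.evaluation X.affRing (op U)).map (affModule.map f)) := this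
  exact mono_map_of_bijective (MonoidalSpace.affSectionsAdjunction U)
    (PresheafOfModules.evaluation X.affRing (op U)) adjT
    (fun P => hM.bijective_app (MonoidalSpace.gluesOver_affSections U P))
    (fun P => hN.bijective_app (MonoidalSpace.gluesOver_affSections U P)) (affModule.map f)

end SetSheaf

/-! ### Base extension of quotients -/

namespace SetSheaf

variable {X : MonoidalSpace.{u}} {K M Q : SetSheaf X}

theorem app_ofSection (f : M ⟶ Q) (U : X.AffOpens) (m : M.val.obj (op U.1)) :
    (affModule.map f).app (op U) (M.ofSection U m) = Q.ofSection U (f.hom.app (op U.1) m) :=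
  ZSet.map_of _ (f.map_zero _) _

theorem affModule_hom_ext {P : PresheafOfModules.{u} X.affRing} {f g : affModule.obj M ⟶ P}
    (h : ∀ U m, f.app (op U) (M.ofSection U m) = g.app (op U) (M.ofSection U m)) : f = g := by
  ext U x
  exact DFunLike.congr_fun (ZSet.addHom_ext (f := (f.app U).hom.toAddMonoidHom)
    (g := (g.app U).hom.toAddMonoidHom) (h U.unop)) x

/-- The morphism `q` identifies `Q` with the quotient of `M` by the image of `k`, on affine open
subsets. -/
structure IsQuotient (k : K ⟶ M) (q : M ⟶ Q) : Prop where
  zero : k ≫ q = 0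
  surjective (U) (hU : X.IsAffineOpen U) : Function.Surjective (q.hom.app (op U))
  eq_or_mem (U) (hU : X.IsAffineOpen U) (a b : M.val.obj (op U)) :
    q.hom.app (op U) a = q.hom.app (op U) b → a = b ∨
      a ∈ Set.range (k.hom.app (op U)) ∧ b ∈ Set.range (k.hom.app (op U))

/-- The value at `n` is defined by a lift of `n` along `q`. Two lifts are equal or both in the image
of `k`, where `g` vanishes. Naturality and equivariance follow from this independence of the lift.
-/
theorem IsQuotient.exists_desc {k : K ⟶ M} {q : M ⟶ Q} (h : IsQuotient k q)
    {P : PresheafOfModules.{u} X.affRing} (g : affModule.obj M ⟶ P)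
    (hg : affModule.map k ≫ g = 0) :
    ∃ g' : affModule.obj Q ⟶ P, affModule.map q ≫ g' = g := by
  choose s hs using fun U : X.AffOpens => h.surjective U.1 U.2
  have hgk : ∀ (U : X.AffOpens) (m : K.val.obj (op U.1)),
      g.app (op U) (M.ofSection U (k.hom.app (op U.1) m)) = 0 := fun U m => by
    rw [← app_ofSection]
    exact congrArg (fun f : affModule.obj K ⟶ P => f.app (op U) (K.ofSection U m)) hg
  let t : ∀ U : X.AffOpens, Q.val.obj (op U.1) → P.obj (op U) := fun U n =>
    g.app (op U) (M.ofSection U (s U n))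
  have ht : ∀ (U : X.AffOpens) (m : M.val.obj (op U.1)),
      t U (q.hom.app (op U.1) m) = g.app (op U) (M.ofSection U m) := fun U m => by
    rcases h.eq_or_mem U.1 U.2 _ _ (hs U (q.hom.app (op U.1) m)) with h | ⟨⟨x, hx⟩, ⟨y, hy⟩⟩
    · change g.app (op U) (M.ofSection U _) = _
      rw [h]
    · change g.app (op U) (M.ofSection U _) = _
      rw [← hx, ← hy, hgk, hgk]
  have ht0 : ∀ U, t U 0 = 0 := fun U => by
    rw [← q.map_zero, ht, show M.ofSection U 0 = 0 from ZSet.of_zero, _root_.map_zero]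
  have hsmul : ∀ (U : X.AffOpens) (b : X.presheaf.obj (op U.1)) (n : Q.val.obj (op U.1)),
      t U (b • n) = ofRing U b • t U n := fun U b n => by
    rw [← hs U n, ← q.map_smul, ht, ht, ofSection_smul, _root_.map_smul]
  let φ : ∀ U : X.AffOpens, (affModule.obj Q).obj (op U) →+ P.obj (op U) := fun U =>
    ZSet.lift (t U) (ht0 U)
  have hφ : ∀ U n, φ U (Q.ofSection U n) = t U n := fun U n => ZSet.lift_of _ (ht0 U) n
  let g' : affModule.obj Q ⟶ P :=
    { app := fun U => ModuleCat.ofHom (X := (affModule.obj Q).obj U) (Y := P.obj U)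
        { φ U.unop with
          map_smul' := @ZSet.map_smul_of _ _ _ _ _ (P.obj U) _ (P.obj U).isModule (φ U.unop)
            fun b n => by
              refine (hφ U.unop _).trans ((hsmul U.unop b n).trans ?_)
              exact congrArg (fun x : P.obj U => (ofRing U.unop b : X.affRing.obj U) • x)
                (hφ U.unop n).symm }
      naturality := fun {U V} i => by
        ext x
        refine DFunLike.congr_fun (ZSet.addHom_ext
          (f := (φ V.unop).comp (affRes (affModule.obj Q) i.unop))
          (g := (affRes P i.unop).comp (φ U.unop)) fun n => ?_) x
        obtain ⟨m, rfl⟩ := h.surjective U.unop.1 U.unop.2 n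
        change φ V.unop (affRes (affModule.obj Q) i.unop (Q.ofSection U.unop _)) =
          affRes P i.unop (φ U.unop (Q.ofSection U.unop _))
        rw [affRes_ofSection, hφ, hφ, ht, ← q.app_res, ht, ← app_affRes, affRes_ofSection] }
  refine ⟨g', affModule_hom_ext fun U m => ?_⟩
  change φ U ((affModule.map q).app (op U) (M.ofSection U m)) = _
  rw [app_ofSection, hφ, ht]

theorem IsQuotient.hom_ext {k : K ⟶ M} {q : M ⟶ Q} (h : IsQuotient k q)
    {P : PresheafOfModules.{u} X.affRing} {g g' : affModule.obj Q ⟶ P}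
    (e : affModule.map q ≫ g = affModule.map q ≫ g') : g = g' := by
  refine affModule_hom_ext fun U n => ?_
  obtain ⟨m, rfl⟩ := h.surjective U.1 U.2 n
  rw [← app_ofSection]
  exact congrArg (fun f : affModule.obj M ⟶ P => f.app (op U) (M.ofSection U m)) e

theorem affModule_map_zero (M N : SetSheaf X) : affModule.map (0 : M ⟶ N) = 0 :=
  affModule_hom_ext fun U m => (app_ofSection 0 U m).trans ZSet.of_zero

/-- Base extension preserves quotients. -/
theorem IsQuotient.isColimit {k : K ⟶ M} {q : M ⟶ Q} (h : IsQuotient k q) :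
    ∃ w : baseChange.map k ≫ baseChange.map q = 0,
      Nonempty (IsColimit (CokernelCofork.ofπ (baseChange.map q) w)) := by
  have w : affModule.map k ≫ affModule.map q = 0 := by
    rw [← Functor.map_comp, h.zero, affModule_map_zero]
  choose d hd using fun {P : PresheafOfModules.{u} X.affRing} (g : affModule.obj M ⟶ P) hg =>
    h.exists_desc g hg
  -- The quotient is a cokernel for presheaves on the affine open subsets; inverse image followed by
  -- sheafification is a left adjoint and preserves it.
  have hc : IsColimit (CokernelCofork.ofπ (affModule.map q) w) :=
    CokernelCofork.IsColimit.ofπ _ _ (fun g hg => d g hg) (fun g hg => hd g hg)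
      fun g hg m hm => h.hom_ext (hm.trans (hd g hg).symm)
  have h₁ := (PresheafOfModules.pullbackPushforwardAdjunction X.affRingHom).comp
    (PresheafOfModules.sheafificationAdjunction (𝟙 X.baseChange.ringCatSheaf.obj))
  have h₂ := h₁.isLeftAdjoint
  have h₃ := Functor.preservesZeroMorphisms_of_isLeftAdjoint
    (PresheafOfModules.pullback X.affRingHom ⋙
    PresheafOfModules.sheafification (𝟙 X.baseChange.ringCatSheaf.obj))
  have h₄ : PreservesColimitsOfSize.{0, 0} (PresheafOfModules.pullback X.affRingHom ⋙
    PresheafOfModules.sheafification (𝟙 X.baseChange.ringCatSheaf.obj)) := h₁.leftAdjoint_preservesColimits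
  have := CokernelCofork.mapIsColimit _ hc (PresheafOfModules.pullback X.affRingHom ⋙
    PresheafOfModules.sheafification (𝟙 X.baseChange.ringCatSheaf.obj))
  refine ⟨by rw [← Functor.map_comp, h.zero, Functor.map_zero], ⟨this⟩⟩

end SetSheaf

/-! ### Reduction to sections over affine open subsets -/

namespace SetSheaf

variable {X : MonoidalSpace.{u}}

theorem ext_local (M : SetSheaf X) {U : Opens X.carrier} {s t : M.val.obj (op U)}
    (h : ∀ x ∈ U, ∃ (V : Opens X.carrier) (hV : V ≤ U), x ∈ V ∧ M.res hV s = M.res hV t) :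
    s = t := by
  choose V hVU hV h using h
  exact TopCat.Sheaf.eq_of_locally_eq' ⟨M.val, M.isSheaf⟩ (fun x : U => V x.1 x.2) U
    (fun x => homOfLE (hVU x.1 x.2)) (fun x hx => Opens.mem_iSup.2 ⟨⟨x, hx⟩, hV x hx⟩) s t
    (fun x => h x.1 x.2)

theorem hom_ext_affine (hX : X.IsM0Scheme) {M N : SetSheaf X} {f g : M ⟶ N}
    (h : ∀ U, X.IsAffineOpen U → ∀ m, f.hom.app (op U) m = g.hom.app (op U) m) : f = g := by
  ext U m
  refine N.ext_local fun x hx => ?_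
  obtain ⟨V, hVU, hxV, hV⟩ := hX.exists_affine hx
  refine ⟨V, hVU, hxV, ?_⟩
  have e₁ := Hom.app_res f hVU m
  have e₂ := Hom.app_res g hVU m
  exact e₁.symm.trans ((h V hV _).trans e₂)

theorem injective_app (hX : X.IsM0Scheme) {M N : SetSheaf X} {f : M ⟶ N}
    (h : ∀ U, X.IsAffineOpen U → Function.Injective (f.hom.app (op U))) (U : (Opens X.carrier)ᵒᵖ) :
    Function.Injective (f.hom.app U) := by
  intro a b hab
  refine M.ext_local (U := U.unop) fun x hx => ?_
  obtain ⟨V, hVU, hxV, hV⟩ := hX.exists_affine hx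
  refine ⟨V, hVU, hxV, h V hV ?_⟩
  have e₁ := Hom.app_res f hVU a
  have e₂ := Hom.app_res f hVU b
  exact e₁.trans ((congrArg (N.res hVU) hab).trans e₂.symm)

/-- Normality is a condition on the sections over affine open subsets. -/
theorem normal_iff (hX : X.IsM0Scheme) {M N : SetSheaf X} (f : M ⟶ N) :
    Normal f ↔ ∀ U, X.IsAffineOpen U → ∀ a b, f.hom.app (op U) a = f.hom.app (op U) b →
      a = b ∨ f.hom.app (op U) a = 0 := by
  have hzero : ∀ (x : X.carrier) (U : Opens X.carrier) (hx : x ∈ U),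
      N.val.germ U x hx 0 = N.val.germ ⊤ x trivial 0 := fun x U hx => by
    rw [← N.map_zero (homOfLE (le_top : U ≤ ⊤)).op, TopCat.Presheaf.germ_res_apply]
  constructor
  · intro h U hU a b hab
    rcases hU.subsingleton_or with hs | ⟨x, hx, hmin⟩
    · have := M.subsingleton (U := U)
      exact Or.inl (Subsingleton.elim _ _)
    -- Sections over `U` are determined by their germs at the closed point `x`, because `U` is the
    -- only neighbourhood of `x` inside `U`.
    · have hres : ∀ (L : SetSheaf X) (s t : L.val.obj (op U)),
          L.val.germ U x hx s = L.val.germ U x hx t → s = t := fun L s t hst => by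
        obtain ⟨W, hxW, i, j, e⟩ := L.val.germ_eq x hx hx s t hst
        obtain rfl : W = U := le_antisymm (leOfHom i) (hmin W hxW)
        exact (L.res_refl s).symm.trans (e.trans (L.res_refl t))
      have := h x (M.val.germ U x hx a) (M.val.germ U x hx b) (by
        rw [TopCat.Presheaf.stalkFunctor_map_germ_apply,
          TopCat.Presheaf.stalkFunctor_map_germ_apply, hab])
      refine this.imp (hres M a b) fun h => hres N _ _ ?_
      rw [hzero, ← h, TopCat.Presheaf.stalkFunctor_map_germ_apply]
  · intro h x a b hab
    obtain ⟨U, hxU, a, rfl⟩ := M.val.exists_germ_eq a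
    obtain ⟨V, hxV, b, rfl⟩ := M.val.exists_germ_eq b
    rw [TopCat.Presheaf.stalkFunctor_map_germ_apply,
      TopCat.Presheaf.stalkFunctor_map_germ_apply] at hab
    obtain ⟨W, hxW, i, j, e⟩ := N.val.germ_eq x hxU hxV _ _ hab
    obtain ⟨T, hTW, hxT, hT⟩ := hX.exists_affine hxW
    have e' : f.hom.app (op T) (M.res (hTW.trans (leOfHom i)) a) =
        f.hom.app (op T) (M.res (hTW.trans (leOfHom j)) b) := by
      rw [f.app_res, f.app_res, N.res_res (leOfHom i) hTW, N.res_res (leOfHom j) hTW]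
      exact congrArg (N.res hTW) e
    have ea : M.val.germ U x hxU a = M.val.germ T x hxT (M.res (hTW.trans (leOfHom i)) a) :=
      (M.val.germ_res_apply (homOfLE _) x hxT a).symm
    have eb : M.val.germ V x hxV b = M.val.germ T x hxT (M.res (hTW.trans (leOfHom j)) b) :=
      (M.val.germ_res_apply (homOfLE _) x hxT b).symm
    rw [ea, eb, TopCat.Presheaf.stalkFunctor_map_germ_apply, ← hzero x T hxT]
    exact (h T hT _ _ e').imp (congrArg _) (congrArg _)

/-- Agreement of images is a condition on the sections over affine open subsets. -/
theorem sameImage_iff (hX : X.IsM0Scheme) {M M' N : SetSheaf X} (f : M ⟶ N) (g : M' ⟶ N) :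
    SameImage f g ↔ ∀ U, X.IsAffineOpen U →
      Set.range (f.hom.app (op U)) = Set.range (g.hom.app (op U)) := by
  have key : ∀ {L L' : SetSheaf X} (f : L ⟶ N) (g : L' ⟶ N) (U : Opens X.carrier),
      X.IsAffineOpen U → ((∀ n : N.val.obj (op U), (∀ x ∈ U, ∃ (V : Opens X.carrier) (h : V ≤ U),
        x ∈ V ∧ N.res h n ∈ Set.range (f.hom.app (op V))) →
      (∀ x ∈ U, ∃ (V : Opens X.carrier) (h : V ≤ U), x ∈ V ∧
        N.res h n ∈ Set.range (g.hom.app (op V)))) →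
      Set.range (f.hom.app (op U)) ⊆ Set.range (g.hom.app (op U))) := by
    intro L L' f g U hU h n hn
    rcases hU.subsingleton_or with hs | ⟨x, hx, hmin⟩
    · have := N.subsingleton (U := U)
      exact ⟨0, Subsingleton.elim _ _⟩
    -- A neighbourhood of the closed point inside `U` is `U` itself, so belonging locally to the
    -- image is the same as belonging to it.
    · obtain ⟨V, hV, hxV, m, hm⟩ := h n (fun y hy => ⟨U, le_rfl, hy, by rwa [N.res_refl]⟩) x hx
      obtain rfl : V = U := le_antisymm hV (hmin V hxV)
      rw [N.res_refl] at hm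
      exact ⟨m, hm⟩
  constructor
  · intro h U hU
    exact (key f g U hU fun n => (h U n).1).antisymm (key g f U hU fun n => (h U n).2)
  · intro h U n
    have hloc : ∀ {L L' : SetSheaf X} (f : L ⟶ N) (g : L' ⟶ N), (∀ U, X.IsAffineOpen U →
        Set.range (f.hom.app (op U)) = Set.range (g.hom.app (op U))) →
        (∀ x ∈ U, ∃ (V : Opens X.carrier) (h : V ≤ U), x ∈ V ∧
          N.res h n ∈ Set.range (f.hom.app (op V))) →
        (∀ x ∈ U, ∃ (V : Opens X.carrier) (h : V ≤ U), x ∈ V ∧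
          N.res h n ∈ Set.range (g.hom.app (op V))) := by
      intro L L' f g h hn x hx
      obtain ⟨V, hV, hxV, m, hm⟩ := hn x hx
      obtain ⟨T, hTV, hxT, hT⟩ := hX.exists_affine hxV
      refine ⟨T, hTV.trans hV, hxT, ?_⟩
      rw [← h T hT]
      exact ⟨L.res hTV m, by rw [f.app_res, hm, N.res_res hV hTV]⟩
    exact ⟨hloc f g h, hloc g f fun U hU => (h U hU).symm⟩

/-! ### Subsheaves -/

/-- A subsheaf of an `𝒪_X`-module. -/
structure Sub (N : SetSheaf X) where
  carrier (U : Opens X.carrier) : Set (N.val.obj (op U))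
  res_mem {U V : Opens X.carrier} (h : V ≤ U) {n} (hn : n ∈ carrier U) : N.res h n ∈ carrier V
  zero_mem (U) : 0 ∈ carrier U
  smul_mem (U) (a : X.presheaf.obj (op U)) {n} (hn : n ∈ carrier U) : a • n ∈ carrier U
  of_local {U : Opens X.carrier} {n : N.val.obj (op U)} (h : ∀ x ∈ U, ∃ (V : Opens X.carrier)
    (hV : V ≤ U), x ∈ V ∧ N.res hV n ∈ carrier V) : n ∈ carrier U

namespace Sub

variable {N : SetSheaf X} (S : N.Sub)

/-- The presheaf of sections of a subsheaf. -/
def presheaf : TopCat.Presheaf (Type u) X.carrier where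
  obj U := S.carrier U.unop
  map i := TypeCat.ofHom fun n => ⟨N.val.map i n.1, S.res_mem (leOfHom i.unop) n.2⟩
  map_id U := by
    ext n
    exact ConcreteCategory.congr_hom (N.val.map_id U) n.1
  map_comp i j := by
    ext n
    exact ConcreteCategory.congr_hom (N.val.map_comp i j) n.1

theorem isSheaf : S.presheaf.IsSheaf := by
  refine TopCat.Presheaf.isSheaf_of_isSheafUniqueGluing_types _ fun ι U s hs => ?_
  obtain ⟨t, ht, ht'⟩ := N.isSheaf.isSheafUniqueGluing_types (fun i => (s i).1) (fun i j =>
    congrArg Subtype.val (hs i j))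
  refine ⟨⟨t, S.of_local fun x hx => ?_⟩, fun i => Subtype.ext (ht i), fun t' h =>
    Subtype.ext (ht' _ fun i => congrArg Subtype.val (h i))⟩
  obtain ⟨i, hi⟩ := Opens.mem_iSup.1 hx
  refine ⟨U i, le_iSup U i, hi, ?_⟩
  have : N.res (le_iSup U i) t = (s i).1 := ht i
  rw [this]
  exact (s i).2

instance (U : (Opens X.carrier)ᵒᵖ) : Zero (S.presheaf.obj U) := ⟨⟨0, S.zero_mem U.unop⟩⟩

instance (U : (Opens X.carrier)ᵒᵖ) : MulActionWithZero (X.presheaf.obj U) (S.presheaf.obj U) where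
  smul a n := ⟨a • n.1, S.smul_mem U.unop a n.2⟩
  one_smul n := Subtype.ext (one_smul _ n.1)
  mul_smul a b n := Subtype.ext (mul_smul a b n.1)
  smul_zero a := Subtype.ext (smul_zero a)
  zero_smul n := Subtype.ext (zero_smul _ n.1)

/-- The subsheaf as an `𝒪_X`-module. -/
def sheaf : SetSheaf X where
  val := S.presheaf
  isSheaf := S.isSheaf
  zero _ := inferInstance
  action _ := inferInstance
  map_smul i a n := Subtype.ext (N.map_smul i a n.1)

/-- The inclusion of a subsheaf. -/
def ι : S.sheaf ⟶ N :=
  { hom :=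
      { app := fun U => TypeCat.ofHom fun n : S.carrier U.unop => n.1
        naturality := fun _ _ _ => rfl }
    map_smul := fun _ _ _ => rfl }

theorem injective_ι (U : (Opens X.carrier)ᵒᵖ) : Function.Injective (S.ι.hom.app U) :=
  fun _ _ h => Subtype.ext h

theorem range_ι (U : Opens X.carrier) : Set.range (S.ι.hom.app (op U)) = S.carrier U :=
  Subtype.range_coe

/-- The factorization of a morphism through a subsheaf. -/
def lift {M : SetSheaf X} (f : M ⟶ N) (hf : ∀ U m, f.hom.app (op U) m ∈ S.carrier U) :
    M ⟶ S.sheaf :=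
  { hom :=
      { app := fun U => TypeCat.ofHom fun m => ⟨f.hom.app U m, hf U.unop m⟩
        naturality := fun U V i => by
          ext m
          have e : (⟨f.hom.app V (M.val.map i m), hf _ _⟩ : S.carrier V.unop) =
              ⟨N.val.map i (f.hom.app U m), S.res_mem (leOfHom i.unop) (hf _ _)⟩ :=
            Subtype.ext (NatTrans.naturality_apply f.hom i m)
          exact e }
    map_smul := fun U a m => Subtype.ext (f.map_smul U a m) }

/-- Finite generation holds because stable subsets of finitely generated sets are finitely
generated, and equality after localization can be tested in `N`. Only the extension of sections from
`V` to `U` inside the subsheaf remains as a hypothesis. -/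
theorem isCoherent (hX : X.IsNoetherian) (hX' : X.IsM0Scheme) (hN : N.IsCoherent)
    (h : ∀ (U V : Opens X.carrier) (hV : V ≤ U) (f : X.presheaf.obj (op U)), X.IsAffineOpen U →
      X.IsAffineOpen V → (Submonoid.powers f).IsLocalizationMap (X.res hV) →
        ∀ n ∈ S.carrier V, ∃ m ∈ S.carrier U, ∃ k : ℕ, X.res hV f ^ k • n = N.res hV m) :
    S.sheaf.IsCoherent := by
  refine isCoherent_of_affine hX' (fun U V hV f hU hVa hf => ⟨fun n => ?_, fun m m' e => ?_⟩)
    fun U hU => ?_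
  · obtain ⟨m, hm, k, hk⟩ := h U V hV f hU hVa hf n.1 n.2
    exact ⟨⟨m, hm⟩, k, Subtype.ext hk⟩
  · obtain ⟨k, hk⟩ := (hN.isLocalizedAt hU hVa hV hf).2 m.1 m'.1 (congrArg Subtype.val e)
    exact ⟨k, Subtype.ext hk⟩
  · classical
    have := hX.fg hU
    obtain ⟨t, ht, ht'⟩ := exists_finset_generators (hN.fg hU) (S.carrier U) (S.zero_mem U)
    refine ⟨t.subtype _, fun m => ?_⟩
    obtain ⟨a, y, hy, e⟩ := ht' m.1 m.2
    exact ⟨a, ⟨y, ht hy⟩, Finset.mem_subtype.2 hy, Subtype.ext e⟩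

end Sub

/-- The kernel of a morphism. -/
def kernelSub {M N : SetSheaf X} (f : M ⟶ N) : M.Sub where
  carrier U := {m | f.hom.app (op U) m = 0}
  res_mem {U V} h n hn := by
    have := f.app_res h n
    exact this.trans ((congrArg (N.res h) hn).trans (N.res_zero h))
  zero_mem U := f.map_zero _
  smul_mem U a n hn := (f.map_smul _ _ _).trans ((congrArg (a • ·) hn).trans (smul_zero a))
  of_local {U n} h := N.ext_local fun x hx => by
    obtain ⟨V, hV, hxV, e⟩ := h x hx
    exact ⟨V, hV, hxV, (f.app_res hV n).symm.trans (e.trans (N.res_zero hV).symm)⟩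

theorem IsCoherent.kernelSub (hX : X.IsNoetherian) (hX' : X.IsM0Scheme) {M N : SetSheaf X}
    (hM : M.IsCoherent) (hN : N.IsCoherent) (f : M ⟶ N) : (kernelSub f).sheaf.IsCoherent := by
  refine Sub.isCoherent _ hX hX' hM fun U V hV e hU hVa he n hn => ?_
  obtain ⟨m, k, hk⟩ := (hM.isLocalizedAt hU hVa hV he).1 n
  have h0 : N.res hV (f.hom.app (op U) m) = N.res hV 0 := by
    rw [← f.app_res, ← hk, f.map_smul, N.res_zero]
    exact (congrArg _ hn).trans (smul_zero _)
  -- The extension `m` of the section is in the kernel only on `V`; multiplication with `e ^ l`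
  -- moves it into the kernel on `U`.
  obtain ⟨l, hl⟩ := (hN.isLocalizedAt hU hVa hV he).2 _ _ h0
  refine ⟨e ^ l • m, ?_, l + k, ?_⟩
  · exact (f.map_smul _ _ _).trans (hl.trans (smul_zero _))
  · rw [pow_add, mul_smul, hk, M.res_smul, _root_.map_pow]

/-- The image of a morphism. -/
def imageSub {M N : SetSheaf X} (f : M ⟶ N) : N.Sub where
  carrier U := {n | ∀ x ∈ U, ∃ (V : Opens X.carrier) (h : V ≤ U), x ∈ V ∧
    N.res h n ∈ Set.range (f.hom.app (op V))}
  res_mem {U V} h n hn x hx := by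
    obtain ⟨W, hW, hxW, m, hm⟩ := hn x (h hx)
    refine ⟨V ⊓ W, inf_le_left, ⟨hx, hxW⟩, M.res inf_le_right m, ?_⟩
    rw [f.app_res, hm, ← N.res_res, ← N.res_res]
  zero_mem U x hx := ⟨U, le_rfl, hx, 0, by rw [f.map_zero, N.res_zero]⟩
  smul_mem U a n hn x hx := by
    obtain ⟨W, hW, hxW, m, hm⟩ := hn x hx
    exact ⟨W, hW, hxW, X.res hW a • m, by rw [f.map_smul, hm, N.res_smul]⟩
  of_local {U n} h x hx := by
    obtain ⟨V, hV, hxV, e⟩ := h x hx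
    obtain ⟨W, hW, hxW, m, hm⟩ := e x hxV
    exact ⟨W, hW.trans hV, hxW, m, by rw [hm, ← N.res_res]⟩

theorem imageSub_carrier {M N : SetSheaf X} (f : M ⟶ N) {U : Opens X.carrier}
    (hU : X.IsAffineOpen U) : (imageSub f).carrier U = Set.range (f.hom.app (op U)) := by
  refine Set.Subset.antisymm (fun n hn => ?_) fun n hn x hx => ⟨U, le_rfl, hx, by rwa [N.res_refl]⟩
  rcases hU.subsingleton_or with hs | ⟨x, hx, hmin⟩
  · have := N.subsingleton (U := U)
    exact ⟨0, Subsingleton.elim _ _⟩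
  · obtain ⟨V, hV, hxV, hm⟩ := hn x hx
    obtain rfl : V = U := le_antisymm hV (hmin V hxV)
    rwa [N.res_refl] at hm

theorem IsCoherent.imageSub (hX : X.IsNoetherian) (hX' : X.IsM0Scheme) {M N : SetSheaf X}
    (hM : M.IsCoherent) (hN : N.IsCoherent) (f : M ⟶ N) : (imageSub f).sheaf.IsCoherent := by
  refine Sub.isCoherent _ hX hX' hN fun U V hV e hU hVa he n hn => ?_
  rw [imageSub_carrier f hVa] at hn
  obtain ⟨y, rfl⟩ := hn
  obtain ⟨m, k, hk⟩ := (hM.isLocalizedAt hU hVa hV he).1 y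
  refine ⟨f.hom.app (op U) m, ?_, k, ?_⟩
  · rw [imageSub_carrier f hU]
    exact ⟨m, rfl⟩
  · rw [← f.map_smul, hk, f.app_res]

/-- The corestriction of a morphism to its image. -/
def toImage {M N : SetSheaf X} (f : M ⟶ N) : M ⟶ (imageSub f).sheaf :=
  (imageSub f).lift f fun U m _ hx => ⟨U, le_rfl, hx, m, (N.res_refl _).symm⟩

/-- The image of a normal morphism is the quotient by its kernel. -/
theorem isQuotient_toImage (hX : X.IsM0Scheme) {M N : SetSheaf X} {f : M ⟶ N} (hf : Normal f) :
    IsQuotient (kernelSub f).ι (toImage f) where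
  zero := by
    ext U m
    exact Subtype.ext m.2
  surjective U hU n := by
    obtain ⟨m, hm⟩ := (imageSub_carrier f hU).le n.2
    exact ⟨m, Subtype.ext hm⟩
  eq_or_mem U hU a b hab := by
    have hab : f.hom.app (op U) a = f.hom.app (op U) b := congrArg Subtype.val hab
    refine ((normal_iff hX f).1 hf U hU a b hab).imp id fun h => ?_
    rw [Sub.range_ι]
    exact ⟨h, hab.symm.trans h⟩

end SetSheaf

namespace SetSheaf

variable {X : MonoidalSpace.{u}} {K M : SetSheaf X} (k : K ⟶ M)

/-! ### Quotient sheaves -/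

/-- The equivalence relation on `M(U)` that collapses the image of `K(U)`. -/
def quotSetoid (U : Opens X.carrier) : Setoid (M.val.obj (op U)) where
  r a b := a = b ∨ a ∈ Set.range (k.hom.app (op U)) ∧ b ∈ Set.range (k.hom.app (op U))
  iseqv :=
    { refl := fun a => Or.inl rfl
      symm := by
        rintro a b (rfl | h)
        · exact Or.inl rfl
        · exact Or.inr ⟨h.2, h.1⟩
      trans := by
        rintro a b c (rfl | h) (rfl | h')
        · exact Or.inl rfl
        · exact Or.inr h'
        · exact Or.inr h
        · exact Or.inr ⟨h.1, h'.2⟩ }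

/-- The quotient of `M(U)` by the image of `K(U)`. -/
def Quot (U : Opens X.carrier) : Type u := Quotient (quotSetoid k U)

/-- The class of a section. -/
def Quot.mk {U : Opens X.carrier} (m : M.val.obj (op U)) : Quot k U := Quotient.mk _ m

theorem Quot.mk_eq {U : Opens X.carrier} {a b : M.val.obj (op U)} :
    Quot.mk k a = Quot.mk k b ↔
      a = b ∨ a ∈ Set.range (k.hom.app (op U)) ∧ b ∈ Set.range (k.hom.app (op U)) :=
  Quotient.eq (r := quotSetoid k U)

theorem Quot.mk_surjective {U : Opens X.carrier} (q : Quot k U) : ∃ m, Quot.mk k m = q :=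
  Quotient.exists_rep q

instance (U : Opens X.carrier) : Zero (Quot k U) := ⟨Quot.mk k 0⟩

instance (U : Opens X.carrier) : SMul (X.presheaf.obj (op U)) (Quot k U) where
  smul a := Quotient.map (a • ·) (by
    rintro x y (rfl | ⟨⟨x, rfl⟩, ⟨y, rfl⟩⟩)
    · exact Or.inl rfl
    · exact Or.inr ⟨⟨a • x, k.map_smul _ _ _⟩, ⟨a • y, k.map_smul _ _ _⟩⟩)

theorem Quot.smul_mk {U : Opens X.carrier} (a : X.presheaf.obj (op U)) (m : M.val.obj (op U)) :
    a • Quot.mk k m = Quot.mk k (a • m) := rfl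

instance (U : Opens X.carrier) : MulActionWithZero (X.presheaf.obj (op U)) (Quot k U) where
  one_smul q := by
    obtain ⟨m, rfl⟩ := Quot.mk_surjective k q
    rw [Quot.smul_mk, one_smul]
  mul_smul a b q := by
    obtain ⟨m, rfl⟩ := Quot.mk_surjective k q
    rw [Quot.smul_mk, Quot.smul_mk, Quot.smul_mk, mul_smul]
  smul_zero a := (Quot.smul_mk k a 0).trans (congrArg _ (smul_zero a))
  zero_smul q := by
    obtain ⟨m, rfl⟩ := Quot.mk_surjective k q
    rw [Quot.smul_mk, zero_smul]
    rfl

/-- The restriction maps of the quotients. -/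
def Quot.res {U V : Opens X.carrier} (h : V ≤ U) : Quot k U → Quot k V :=
  Quotient.map (M.res h) (by
    rintro x y (rfl | ⟨⟨x, rfl⟩, ⟨y, rfl⟩⟩)
    · exact Or.inl rfl
    · exact Or.inr ⟨⟨K.res h x, k.app_res h x⟩, ⟨K.res h y, k.app_res h y⟩⟩)

theorem Quot.res_mk {U V : Opens X.carrier} (h : V ≤ U) (m : M.val.obj (op U)) :
    Quot.res k h (Quot.mk k m) = Quot.mk k (M.res h m) := rfl

theorem Quot.res_smul {U V : Opens X.carrier} (h : V ≤ U) (a : X.presheaf.obj (op U))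
    (q : Quot k U) : Quot.res k h (a • q) = X.res h a • Quot.res k h q := by
  obtain ⟨m, rfl⟩ := Quot.mk_surjective k q
  rw [Quot.smul_mk, Quot.res_mk, Quot.res_mk, Quot.smul_mk, M.res_smul]

theorem Quot.subsingleton {U : Opens X.carrier} [Subsingleton (X.presheaf.obj (op U))] :
    Subsingleton (Quot k U) := by
  have := M.subsingleton (U := U)
  refine ⟨fun a b => ?_⟩
  obtain ⟨m, rfl⟩ := Quot.mk_surjective k a
  obtain ⟨n, rfl⟩ := Quot.mk_surjective k b
  rw [Subsingleton.elim m n]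

/-- The sections of the quotient sheaf: compatible families of sections of the quotients over the
affine open subsets. -/
def QuotSections (U : Opens X.carrier) : Type u :=
  {s : ∀ V : X.AffOpens, V.1 ≤ U → Quot k V.1 //
    ∀ (V W : X.AffOpens) (hV : V.1 ≤ U) (h : W.1 ≤ V.1),
      Quot.res k h (s V hV) = s W (h.trans hV)}

/-- The presheaf of sections of the quotient sheaf. -/
def quotPresheaf : TopCat.Presheaf (Type u) X.carrier where
  obj U := QuotSections k U.unop
  map i := TypeCat.ofHom fun s => ⟨fun V hV => s.1 V (hV.trans (leOfHom i.unop)),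
    fun V W _ h => s.2 V W _ h⟩
  map_id _ := rfl
  map_comp _ _ := rfl

instance (U : (Opens X.carrier)ᵒᵖ) : Zero ((quotPresheaf k).obj U) :=
  ⟨⟨fun _ _ => 0, fun _ _ _ h => (Quot.res_mk k h 0).trans (congrArg _ (M.res_zero h))⟩⟩

instance (U : (Opens X.carrier)ᵒᵖ) : MulActionWithZero (X.presheaf.obj U) ((quotPresheaf k).obj U) where
  smul a s := ⟨fun V hV => X.res hV a • s.1 V hV, fun V W hV h => by
    rw [Quot.res_smul, s.2, X.res_res]⟩
  one_smul s := Subtype.ext (funext₂ fun V hV =>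
    (congrArg (· • s.1 V hV) (_root_.map_one (X.res hV))).trans (one_smul _ _))
  mul_smul a b s := Subtype.ext (funext₂ fun V hV =>
    (congrArg (· • s.1 V hV) (_root_.map_mul (X.res hV) a b)).trans (mul_smul _ _ _))
  smul_zero a := Subtype.ext (funext₂ fun _ _ => smul_zero _)
  zero_smul s := Subtype.ext (funext₂ fun V hV =>
    (congrArg (· • s.1 V hV) (_root_.map_zero (X.res hV))).trans (zero_smul _ _))

/-- An affine open subset of a union lies in one of its members, by its closed point, unless its
monoid of sections is trivial. A compatible family on the affine open subsets of the union is
therefore determined, without further gluing conditions, by its parts on the members. -/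
theorem isSheaf_quotPresheaf : (quotPresheaf k).IsSheaf := by
  classical
  refine TopCat.Presheaf.isSheaf_of_isSheafUniqueGluing_types _ fun ι U s hs => ?_
  have hs' : ∀ (i j : ι) (V : X.AffOpens) (hi : V.1 ≤ U i) (hj : V.1 ≤ U j),
      (s i).1 V hi = (s j).1 V hj := fun i j V hi hj =>
    congrFun (congrFun (congrArg Subtype.val (hs i j)) V) (le_inf hi hj)
  have hcov : ∀ V : X.AffOpens, V.1 ≤ iSup U →
      Subsingleton (X.presheaf.obj (op V.1)) ∨ ∃ i, V.1 ≤ U i := fun V hV => by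
    refine V.2.subsingleton_or.imp id ?_
    rintro ⟨x, hx, hmin⟩
    obtain ⟨i, hi⟩ := Opens.mem_iSup.1 (hV hx)
    exact ⟨i, hmin _ hi⟩
  have hsub : ∀ V : X.AffOpens, ¬ (∃ i, V.1 ≤ U i) → V.1 ≤ iSup U →
      Subsingleton (Quot k V.1) := fun V h hV => by
    have := (hcov V hV).resolve_right h
    exact Quot.subsingleton k
  -- The default value `0` is taken only if `V` lies in no member of the cover; then the quotient
  -- over `V` has a single element.
  let t : ∀ V : X.AffOpens, V.1 ≤ iSup U → Quot k V.1 := fun V _ =>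
    if h : ∃ i, V.1 ≤ U i then (s h.choose).1 V h.choose_spec else 0
  have ht : ∀ (V : X.AffOpens) (hV : V.1 ≤ iSup U) (i : ι) (hi : V.1 ≤ U i),
      t V hV = (s i).1 V hi := fun V hV i hi => by
    have h : ∃ i, V.1 ≤ U i := ⟨i, hi⟩
    exact (dif_pos h).trans (hs' _ _ _ _ _)
  refine ⟨⟨t, fun V W hV h => ?_⟩, fun i => Subtype.ext (funext₂ fun V hV => ht V (hV.trans (le_iSup U i)) i hV),
    fun t' h' => Subtype.ext (funext₂ fun V hV => ?_)⟩
  · by_cases hi : ∃ i, V.1 ≤ U i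
    · obtain ⟨i, hi⟩ := hi
      rw [ht V hV i hi, ht W (h.trans hV) i (h.trans hi), (s i).2]
    · have := (hcov V hV).resolve_right hi
      have := subsingleton_of_le h
      have := Quot.subsingleton k (U := W.1)
      exact Subsingleton.elim _ _
  · by_cases hi : ∃ i, V.1 ≤ U i
    · obtain ⟨i, hi⟩ := hi
      exact (congrFun (congrFun (congrArg Subtype.val (h' i)) V) hi).trans (ht V hV i hi).symm
    · have := hsub V hi hV
      exact Subsingleton.elim _ _

/-- The quotient of a sheaf by the image of a morphism. -/
def quotient : SetSheaf X where
  val := quotPresheaf k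
  isSheaf := isSheaf_quotPresheaf k
  zero _ := inferInstance
  action _ := inferInstance
  map_smul i a s := Subtype.ext (funext₂ fun V hV =>
    congrArg (· • s.1 V (hV.trans (leOfHom i.unop))) (X.res_res (leOfHom i.unop) hV a).symm)

/-- The projection to the quotient. -/
def toQuotient : M ⟶ quotient k :=
  { hom :=
      { app := fun U => TypeCat.ofHom fun m =>
          (⟨fun V hV => Quot.mk k (M.res hV m), fun V W hV h =>
            congrArg (Quot.mk k) (M.res_res hV h m).symm⟩ : QuotSections k U.unop)
        naturality := fun U V i => by
          ext m
          refine Subtype.ext (funext₂ fun W hW => ?_)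
          exact congrArg (Quot.mk k) (M.res_res (leOfHom i.unop) hW m).symm }
    map_smul := fun U a m => Subtype.ext (funext₂ fun V hV =>
      congrArg (Quot.mk k) (M.res_smul hV a m)) }

theorem isQuotient_toQuotient : IsQuotient k (toQuotient k) where
  zero := by
    ext U m
    refine Subtype.ext (funext₂ fun V hV => ?_)
    refine (Quot.mk_eq k).2 (Or.inr ⟨⟨K.res hV m, k.app_res hV m⟩, ⟨0, k.map_zero _⟩⟩)
  surjective U hU s := by
    obtain ⟨m, hm⟩ := Quot.mk_surjective k (s.1 ⟨U, hU⟩ le_rfl)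
    refine ⟨m, Subtype.ext (funext₂ fun V hV => ?_)⟩
    refine (Quot.res_mk k hV m).symm.trans ?_
    rw [hm]
    exact s.2 ⟨U, hU⟩ V le_rfl hV
  eq_or_mem U hU a b hab := by
    have := congrFun (congrFun (congrArg Subtype.val hab) ⟨U, hU⟩) le_rfl
    have := (Quot.mk_eq k).1 this
    rwa [M.res_refl, M.res_refl] at this

theorem IsQuotient.isCoherent {k : K ⟶ M} {Q : SetSheaf X} {q : M ⟶ Q} (h : IsQuotient k q)
    (hX : X.IsM0Scheme) (hK : K.IsCoherent) (hM : M.IsCoherent) : Q.IsCoherent := by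
  have hkq : ∀ U (m : K.val.obj U), q.hom.app U (k.hom.app U m) = 0 := fun U m =>
    congrArg (fun f : K ⟶ Q => f.hom.app U m) h.zero
  refine isCoherent_of_affine hX (fun U V hV f hU hVa hf => ⟨fun n => ?_, fun m m' e => ?_⟩)
    fun U hU => ?_
  · obtain ⟨n, rfl⟩ := h.surjective V hVa n
    obtain ⟨m, j, hj⟩ := (hM.isLocalizedAt hU hVa hV hf).1 n
    exact ⟨q.hom.app (op U) m, j, by rw [← q.map_smul, hj, q.app_res]⟩
  · obtain ⟨m, rfl⟩ := h.surjective U hU m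
    obtain ⟨m', rfl⟩ := h.surjective U hU m'
    rw [← q.app_res, ← q.app_res] at e
    -- If `m` comes from `K` after restriction to `V`, then a multiple of `m` by a power of `f`
    -- comes from `K` over `U`, so its class vanishes. This handles sections of the quotient that
    -- agree on `V` because both are collapsed.
    have key : ∀ m : M.val.obj (op U), M.res hV m ∈ Set.range (k.hom.app (op V)) →
        ∃ j : ℕ, f ^ j • q.hom.app (op U) m = 0 := by
      rintro m ⟨y, hy⟩
      obtain ⟨x, i, hi⟩ := (hK.isLocalizedAt hU hVa hV hf).1 y
      have : M.res hV (f ^ i • m) = M.res hV (k.hom.app (op U) x) := by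
        rw [M.res_smul, ← hy, ← k.app_res, ← hi, k.map_smul, _root_.map_pow]
      obtain ⟨j, hj⟩ := (hM.isLocalizedAt hU hVa hV hf).2 _ _ this
      refine ⟨j + i, ?_⟩
      rw [← q.map_smul, pow_add, mul_smul, hj, q.map_smul, hkq, smul_zero]
    rcases h.eq_or_mem V hVa _ _ e with e | ⟨h₁, h₂⟩
    · obtain ⟨j, hj⟩ := (hM.isLocalizedAt hU hVa hV hf).2 _ _ e
      exact ⟨j, by rw [← q.map_smul, hj, q.map_smul]⟩
    · obtain ⟨i, hi⟩ := key m h₁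
      obtain ⟨j, hj⟩ := key m' h₂
      refine ⟨i + j, ?_⟩
      rw [pow_add, mul_smul, mul_smul, hj, smul_zero, ← mul_smul, mul_comm, mul_smul, hi, smul_zero]
  · classical
    obtain ⟨s, hs⟩ := hM.fg hU
    refine ⟨s.image (q.hom.app (op U)), fun n => ?_⟩
    obtain ⟨m, rfl⟩ := h.surjective U hU n
    obtain ⟨a, y, hy, rfl⟩ := hs m
    exact ⟨a, _, Finset.mem_image_of_mem _ hy, q.map_smul _ _ _⟩

theorem IsQuotient.normal {k : K ⟶ M} {Q : SetSheaf X} {q : M ⟶ Q} (h : IsQuotient k q)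
    (hX : X.IsM0Scheme) : Normal q := by
  refine (normal_iff hX q).2 fun U hU a b hab => ?_
  refine (h.eq_or_mem U hU a b hab).imp id ?_
  rintro ⟨⟨m, rfl⟩, -⟩
  exact congrArg (fun f : K ⟶ Q => f.hom.app (op U) m) h.zero

end SetSheaf

/-! ### Right exact functors between abelian categories -/

section Abelian

variable {C D : Type*} [Category* C] [Category* D] [Abelian C] [Abelian D] (F : C ⥤ D) [F.Additive]
  [PreservesFiniteColimits F]

theorem exact_map_of_epi (S : ShortComplex C) (hS : S.Exact) [Epi S.g] : (S.map F).Exact :=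
  (((F.preservesFiniteColimits_tfae.out 3 1 :) : PreservesFiniteColimits F ↔
    ∀ S : ShortComplex C, S.Exact ∧ Epi S.g → (S.map F).Exact ∧ Epi (F.map S.g)).1
      inferInstance S ⟨hS, inferInstance⟩).1

theorem exact_kernelι {M N : C} (f : M ⟶ N) :
    (ShortComplex.mk (kernel.ι f) f (kernel.condition f)).Exact :=
  ShortComplex.exact_of_f_is_kernel _ (kernelIsKernel f)

/-- If `F(ker p) ⟶ F(M)` and `F(ker q) ⟶ F(N)` are monomorphisms for two composable epimorphisms
`p : M ⟶ N` and `q`, then this holds for their composition. -/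
theorem mono_map_kernelι_comp {M N P : C} (p : M ⟶ N) (q : N ⟶ P) [Epi p]
    [Mono (F.map (kernel.ι p))] [Mono (F.map (kernel.ι q))] : Mono (F.map (kernel.ι (p ≫ q))) := by
  let a : kernel p ⟶ kernel (p ≫ q) := kernel.lift _ (kernel.ι p) (by simp)
  let b : kernel (p ≫ q) ⟶ kernel q := kernel.lift _ (kernel.ι (p ≫ q) ≫ p) (by simp)
  have hab : a ≫ b = 0 := by
    rw [← cancel_mono (kernel.ι q)]
    simp [a, b]
  -- The sequence `0 ⟶ ker p ⟶ ker (p ≫ q) ⟶ ker q ⟶ 0` is exact; its last map `b` is an epimorphism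
  -- because `p` is one.
  have hex : (ShortComplex.mk a b hab).Exact := by
    rw [ShortComplex.exact_iff_exact_up_to_refinements]
    intro T x hx
    refine ⟨T, 𝟙 T, inferInstance, kernel.lift _ (x ≫ kernel.ι (p ≫ q)) ?_, ?_⟩
    · have := congrArg (· ≫ kernel.ι q) hx
      simpa [b] using this
    · rw [← cancel_mono (kernel.ι (p ≫ q))]
      simp [a]
  have hb : Epi b := by
    rw [epi_iff_surjective_up_to_refinements]
    intro T y
    obtain ⟨T', π, hπ, x, hx⟩ := surjective_up_to_refinements_of_epi p (y ≫ kernel.ι q)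
    refine ⟨T', π, hπ, kernel.lift _ x ?_, ?_⟩
    · rw [← Category.assoc, ← hx]
      simp
    · rw [← cancel_mono (kernel.ι q)]
      simpa [b] using hx
  let S₁ := (ShortComplex.mk a b hab).map F
  let S₂ := (ShortComplex.mk (kernel.ι p) p (kernel.condition p)).map F
  -- The image under `F` of this sequence is mapped to `F (ker p) ⟶ F M ⟶ F N`. The outer vertical
  -- maps and the first map of the target are monomorphisms, so a diagram chase shows the same for
  -- the middle one.
  let φ : S₁ ⟶ S₂ :=
    { τ₁ := 𝟙 _
      τ₂ := F.map (kernel.ι (p ≫ q))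
      τ₃ := F.map (kernel.ι q)
      comm₁₂ := by
        change 𝟙 _ ≫ F.map _ = F.map _ ≫ F.map _
        rw [← F.map_comp, Category.id_comp]
        simp [a]
      comm₂₃ := by
        change F.map _ ≫ F.map _ = F.map _ ≫ F.map _
        rw [← F.map_comp, ← F.map_comp]
        simp [b] }
  have h₁ : S₁.Exact := exact_map_of_epi F _ hex
  have : Mono S₁.f := by
    have : Mono (F.map a ≫ F.map (kernel.ι (p ≫ q))) := by
      rw [← F.map_comp, show a ≫ kernel.ι (p ≫ q) = kernel.ι p by simp [a]]
      infer_instance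
    exact mono_of_mono (F.map a) (F.map (kernel.ι (p ≫ q)))
  have : Mono S₂.f := inferInstanceAs (Mono (F.map (kernel.ι p)))
  have : Mono φ.τ₁ := inferInstanceAs (Mono (𝟙 _))
  have : Mono φ.τ₃ := inferInstanceAs (Mono (F.map (kernel.ι q)))
  exact ShortComplex.mono_τ₂_of_exact_of_mono φ h₁

end Abelian

/-! ### Flatness of morphisms along a morphism of schemes -/

section Flat

variable {X Y : Scheme.{u}} (φ : X ⟶ Y) {M N : Y.Modules} (f : M ⟶ N)

/-- The pullback is right exact, so exactness in the middle is automatic for an epimorphism. -/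
theorem isFlatAlong_iff_of_epi [Epi f] :
    IsFlatAlong φ f ↔ Mono ((Scheme.Modules.pullback φ).map (kernel.ι f)) :=
  ⟨fun h => h.1, fun h => ⟨h, exact_map_of_epi (Scheme.Modules.pullback φ) _ (exact_kernelι f)⟩⟩

/-- The kernel vanishes, so only the exactness in the middle has content: it says that the pullback
of `f` has no kernel. -/
theorem isFlatAlong_iff_of_mono [Mono f] :
    IsFlatAlong φ f ↔ Mono ((Scheme.Modules.pullback φ).map f) := by
  have h0 : (Scheme.Modules.pullback φ).map (kernel.ι f) = 0 := by
    rw [kernel.ι_of_mono f, Functor.map_zero]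
  constructor
  · intro h
    exact (ShortComplex.exact_iff_mono _ h0).1 h.2
  · intro h
    refine ⟨?_, (ShortComplex.exact_iff_mono _ h0).2 h⟩
    have : IsZero ((Scheme.Modules.pullback φ).obj (kernel f)) :=
      (Scheme.Modules.pullback φ).map_isZero (isZero_kernel_of_mono f)
    exact ⟨fun _ _ _ => this.eq_of_tgt _ _⟩

theorem isFlatAlong_zero : IsFlatAlong φ (0 : M ⟶ N) := by
  refine ⟨inferInstance, ?_⟩
  refine (ShortComplex.exact_iff_epi _ (Functor.map_zero _ _ _)).2 ?_
  change Epi ((Scheme.Modules.pullback φ).map _)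
  infer_instance

/-- The pullback of the kernel of a flat morphism is a kernel. -/
theorem IsFlatAlong.isLimit {φ : X ⟶ Y} {f : M ⟶ N} (h : IsFlatAlong φ f) :
    ∃ w, Nonempty (IsLimit (KernelFork.ofι (f := (Scheme.Modules.pullback φ).map f)
      ((Scheme.Modules.pullback φ).map (kernel.ι f)) w)) :=
  have := h.1
  have : Mono (ShortComplex.mk ((Scheme.Modules.pullback φ).map (kernel.ι f))
      ((Scheme.Modules.pullback φ).map f) (by
        rw [← Functor.map_comp, kernel.condition, Functor.map_zero])).f := h.1
  ⟨_, ⟨h.2.fIsKernel⟩⟩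

end Flat

/-! ### Base extension of kernels of normal morphisms -/

namespace SetSheaf

variable {X : MonoidalSpace.{u}}

/-- Base extension preserves kernels of normal morphisms of coherent sheaves. -/
theorem isLimit_baseChange_kernelSub (hX : X.IsNoetherian) (hX' : X.IsM0Scheme) {M N : SetSheaf X}
    (hM : M.IsCoherent) (hN : N.IsCoherent) {f : M ⟶ N} (hf : Normal f) :
    ∃ w, Nonempty (IsLimit (KernelFork.ofι (f := baseChange.map f)
      (baseChange.map (kernelSub f).ι) w)) := by
  obtain ⟨w, ⟨hc⟩⟩ := (isQuotient_toImage hX' hf).isColimit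
  have h₁ : Mono (baseChange.map (kernelSub f).ι) :=
    (IsCoherent.kernelSub hX hX' hM hN f).mono_baseChange_map hM _ fun U _ =>
      Sub.injective_ι _ _
  have h₂ : Mono (baseChange.map (imageSub f).ι) :=
    (IsCoherent.imageSub hX hX' hM hN f).mono_baseChange_map hN _ fun U _ =>
      Sub.injective_ι _ _
  -- The first factor is, by normality, the quotient of `M` by the kernel, and the second is an
  -- injection of coherent sheaves.
  have e : baseChange.map f = baseChange.map (toImage f) ≫ baseChange.map (imageSub f).ι := by
    rw [← Functor.map_comp]
    rfl
  have hex := ShortComplex.exact_of_g_is_cokernel (ShortComplex.mk _ _ w) hc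
  -- A monomorphism is the kernel of its cokernel. Composition with the monomorphism from the base
  -- extension of the image does not change the kernel.
  have hk : IsLimit (KernelFork.ofι (baseChange.map (kernelSub f).ι) w) :=
    have : Mono (ShortComplex.mk _ _ w).f := h₁
    hex.fIsKernel
  exact ⟨_, ⟨isKernelCompMono hk (baseChange.map (imageSub f).ι) e⟩⟩

end SetSheaf

/-! ### Componentwise kernels of `𝒪_𝒳`-modules and exactness -/

namespace SetSheaf

variable {X : MonoidalSpace.{u}}

theorem exists_lift {K M T : SetSheaf X} (k : K ⟶ M)
    (hk : ∀ U, Function.Injective (k.hom.app U)) (t : T ⟶ M)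
    (ht : ∀ U m, t.hom.app U m ∈ Set.range (k.hom.app U)) : ∃ l : T ⟶ K, l ≫ k = t := by
  choose l hl using ht
  exact ⟨{ hom :=
            { app := fun U => TypeCat.ofHom (l U)
              naturality := fun U V i => by
                ext m
                apply hk V
                refine (hl V (T.val.map i m)).trans ?_
                refine .trans ?_ (NatTrans.naturality_apply k.hom i (l U m)).symm
                exact (NatTrans.naturality_apply t.hom i m).trans
                  (congrArg (M.val.map i) (hl U m).symm) }
           map_smul := fun U a m => by
            apply hk U
            refine (hl U _).trans ?_
            refine .trans ?_ (k.map_smul U a (l U m)).symm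
            exact (t.map_smul U a m).trans (congrArg (a • ·) (hl U m).symm) }, by
    ext U m
    exact hl (op U) m⟩

theorem mono_of_injective {K M : SetSheaf X} (k : K ⟶ M)
    (hk : ∀ U, Function.Injective (k.hom.app U)) : Mono k where
  right_cancellation f g h := by
    ext U m
    exact hk _ (congrArg (fun t => Hom.hom t |>.app (op U) m) h)

end SetSheaf

namespace FModule

variable {𝒳 : F1Scheme.{u}}

/-- The functor that forgets the component on `X̃`. -/
def toSch : FModule 𝒳 ⥤ 𝒳.sch.Modules where
  obj M := M.sch
  map f := f.sch

instance {M N : FModule 𝒳} (f : M ⟶ N) [IsIso f] : IsIso f.sch :=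
  inferInstanceAs (IsIso (toSch.map f))

theorem bijective_app {M N : FModule 𝒳} (f : M ⟶ N) [IsIso f] (U) :
    Function.Bijective (f.mon.hom.app U) := by
  refine Function.bijective_iff_has_inverse.2 ⟨(inv f).mon.hom.app U, fun m => ?_, fun m => ?_⟩
  · exact congrArg (fun t : M ⟶ M => t.mon.hom.app U m) (IsIso.hom_inv_id f)
  · exact congrArg (fun t : N ⟶ N => t.mon.hom.app U m) (IsIso.inv_hom_id f)

theorem mono_of_components {K M : FModule 𝒳} (k : K ⟶ M)
    (hk : ∀ U, Function.Injective (k.mon.hom.app U)) [Mono k.sch] : Mono k where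
  right_cancellation f g h := by
    have := SetSheaf.mono_of_injective k.mon hk
    ext1
    · exact (cancel_mono k.mon).1 (congrArg Hom.mon h)
    · exact (cancel_mono k.sch).1 (congrArg Hom.sch h)

/-- The factorizations in the two components are automatically compatible with the structure
isomorphisms, since this can be tested after composition with the monomorphism `e^*(k)`. For this
reason the condition `mono` is part of `IsKer`. -/
theorem exists_lift {K M T : FModule 𝒳} (k : K ⟶ M)
    (hk : ∀ U, Function.Injective (k.mon.hom.app U))
    [Mono ((Scheme.Modules.pullback 𝒳.ev).map k.sch)] (t : T ⟶ M)
    (ht : ∀ U m, t.mon.hom.app U m ∈ Set.range (k.mon.hom.app U)) (l : T.sch ⟶ K.sch)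
    (hl : l ≫ k.sch = t.sch) : ∃ l : T ⟶ K, l ≫ k = t := by
  obtain ⟨l', hl'⟩ := SetSheaf.exists_lift k.mon hk t.mon ht
  refine ⟨⟨l', l, ?_⟩, by ext1 <;> assumption⟩
  rw [← cancel_mono ((Scheme.Modules.pullback 𝒳.ev).map k.sch), Category.assoc, ← k.comm,
    Category.assoc, ← Functor.map_comp, hl, ← Category.assoc, ← Functor.map_comp, hl', t.comm]

/-- The morphism `k` is a kernel of `g`, componentwise. -/
structure IsKer {K M N : FModule 𝒳} (k : K ⟶ M) (g : M ⟶ N) : Prop where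
  injective (U) : Function.Injective (k.mon.hom.app U)
  mem_range (U) (m) : g.mon.hom.app U m = 0 ↔ m ∈ Set.range (k.mon.hom.app U)
  zero : k.sch ≫ g.sch = 0
  isLimit : Nonempty (IsLimit (KernelFork.ofι (f := g.sch) k.sch zero))
  mono : Mono ((Scheme.Modules.pullback 𝒳.ev).map k.sch)

namespace IsKer

variable {K M N : FModule 𝒳} {k : K ⟶ M} {g : M ⟶ N}

theorem comp_eq_zero (h : IsKer k g) : k ≫ g = 0 := by
  ext1
  · ext U m
    exact (h.mem_range (op U) _).2 ⟨m, rfl⟩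
  · exact h.zero

theorem mono_sch (h : IsKer k g) : Mono k.sch := mono_of_isLimit_fork h.isLimit.some

theorem exists_lift (h : IsKer k g) {T : FModule 𝒳} (t : T ⟶ M) (ht : t ≫ g = 0) : ∃ l : T ⟶ K, l ≫ k = t := by
  have := h.mono
  obtain ⟨l, hl⟩ := KernelFork.IsLimit.lift' h.isLimit.some t.sch (congrArg Hom.sch ht)
  refine FModule.exists_lift k h.injective t (fun U m => (h.mem_range U _).1 ?_) l hl
  exact congrArg (fun f : T ⟶ N => f.mon.hom.app U m) ht

theorem nonempty_isLimit (h : IsKer k g) : Nonempty (IsLimit (KernelFork.ofι k h.comp_eq_zero)) := by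
  have := h.mono_sch
  have := mono_of_components k h.injective
  choose l hl using fun {T : FModule 𝒳} (t : T ⟶ M) (ht : t ≫ g = 0) => h.exists_lift t ht
  exact ⟨KernelFork.IsLimit.ofι _ _ (fun t ht => l t ht) (fun t ht => hl t ht)
    fun t ht m hm => (cancel_mono k).1 (hm.trans (hl t ht).symm)⟩

theorem exact (h : IsKer k g) : (ShortComplex.mk k.sch g.sch h.zero).Exact :=
  ShortComplex.exact_of_f_is_kernel _ h.isLimit.some

end IsKer

/-- Normal morphisms of coherent modules have coherent kernels. -/
theorem exists_isKer (h𝒳 : 𝒳.IsNoetherian) {M N : FModule 𝒳} (hM : M.IsCoherent)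
    (hN : N.IsCoherent) {g : M ⟶ N} (hg : Normal g) :
    ∃ (K : FModule 𝒳) (_ : K.IsCoherent) (k : K ⟶ M), IsKer k g := by
  have := h𝒳.2
  obtain ⟨w₁, ⟨hl₁⟩⟩ := SetSheaf.isLimit_baseChange_kernelSub h𝒳.1 𝒳.isM0Scheme hM.1 hN.1 hg.1
  obtain ⟨w₂, ⟨hl₂⟩⟩ := hg.2.isLimit
  -- The structure isomorphisms of `M` and `N` identify the base extension of the first component of
  -- `g` with the pullback of the second. The induced isomorphism of kernels is the structure
  -- isomorphism of `K`.
  let φ : Arrow.mk (SetSheaf.baseChange.map g.mon) ≅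
      Arrow.mk ((Scheme.Modules.pullback 𝒳.ev).map g.sch) :=
    Arrow.isoMk M.iso N.iso g.comm.symm
  let K : FModule 𝒳 :=
    { mon := (SetSheaf.kernelSub g.mon).sheaf
      sch := kernel g.sch
      iso := KernelFork.mapIsoOfIsLimit hl₁ hl₂ φ }
  refine ⟨K, ⟨SetSheaf.IsCoherent.kernelSub h𝒳.1 𝒳.isM0Scheme hM.1 hN.1 _, hM.2.kernel hN.2 _⟩,
    ⟨(SetSheaf.kernelSub g.mon).ι, kernel.ι g.sch,
      (KernelFork.mapOfIsLimit_ι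
        (KernelFork.ofι (SetSheaf.baseChange.map (SetSheaf.kernelSub g.mon).ι) w₁) hl₂ φ.hom).symm⟩, ?_⟩
  exact
    { injective := SetSheaf.Sub.injective_ι _
      mem_range := fun U m => by
        rw [show Set.range ((SetSheaf.kernelSub g.mon).ι.hom.app U) = _ from
          SetSheaf.Sub.range_ι _ U.unop]
        rfl
      zero := kernel.condition _
      isLimit := ⟨kernelIsKernel _⟩
      mono := hg.2.1 }

/-- Componentwise description of exactness at the source of a normal morphism. -/
theorem exactAt_iff (h𝒳 : 𝒳.IsNoetherian) {L M N : FModule 𝒳} (hM : M.IsCoherent)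
    (hN : N.IsCoherent) (f : L ⟶ M) {g : M ⟶ N} (hg : Normal g) :
    ExactAt f g ↔ (∀ U, 𝒳.mon.IsAffineOpen U → ∀ m, g.mon.hom.app (op U) m = 0 ↔
      m ∈ Set.range (f.mon.hom.app (op U))) ∧
        ∃ w, (ShortComplex.mk f.sch g.sch w).Exact := by
  obtain ⟨K, hK, k, hk⟩ := exists_isKer h𝒳 hM hN hg
  have him : imageSubobject k.sch = kernelSubobject g.sch :=
    (ShortComplex.exact_iff_image_eq_kernel _).1 hk.exact
  constructor
  · rintro ⟨K', k', w, ⟨hl⟩, -, hsame, -, him'⟩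
    -- The kernel in the definition of exactness is isomorphic to the componentwise one, so its
    -- image can be computed in each component.
    obtain ⟨e, rfl⟩ : ∃ e : K' ≅ K, e.hom ≫ k = k' :=
      ⟨IsLimit.conePointUniqueUpToIso hl hk.nonempty_isLimit.some,
        IsLimit.conePointUniqueUpToIso_hom_comp hl hk.nonempty_isLimit.some
          WalkingParallelPair.zero⟩
    constructor
    · intro U hU m
      rw [(SetSheaf.sameImage_iff 𝒳.isM0Scheme _ _).1 hsame U hU, hk.mem_range]
      constructor
      · rintro ⟨x, rfl⟩
        obtain ⟨y, rfl⟩ := (bijective_app e.hom (op U)).2 x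
        exact ⟨y, rfl⟩
      · rintro ⟨y, rfl⟩
        exact ⟨e.hom.mon.hom.app (op U) y, rfl⟩
    · replace him' : imageSubobject f.sch = kernelSubobject g.sch :=
        him'.trans ((imageSubobject_iso_comp e.hom.sch k.sch).trans him)
      have w : f.sch ≫ g.sch = 0 := by
        have : (imageSubobject f.sch).arrow ≫ g.sch = 0 := by
          rw [him', kernelSubobject_arrow_comp]
        rw [← imageSubobject_arrow_comp f.sch, Category.assoc, this, comp_zero]
      exact ⟨w, (ShortComplex.exact_iff_image_eq_kernel _).2 him'⟩
  · rintro ⟨h, w, hex⟩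
    refine ⟨K, k, hk.comp_eq_zero, hk.nonempty_isLimit, hk.injective,
      (SetSheaf.sameImage_iff 𝒳.isM0Scheme _ _).2 fun U hU => ?_, hk.mono_sch, ?_⟩
    · ext m
      rw [← h U hU, hk.mem_range]
    · rw [him]
      exact (ShortComplex.exact_iff_image_eq_kernel _).1 hex

end FModule

/-! ### Admissible short exact sequences, componentwise -/

namespace SetSheaf

variable {X : MonoidalSpace.{u}}

/-- A section over `U` belongs to the image of a morphism that is injective over affine open
subsets if this holds over the affine open subsets of `U`. -/
theorem mem_range_of_affine (hX : X.IsM0Scheme) {K M : SetSheaf X} (k : K ⟶ M)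
    (hk : ∀ U, X.IsAffineOpen U → Function.Injective (k.hom.app (op U))) (U : Opens X.carrier)
    (m : M.val.obj (op U)) (hm : ∀ (V : Opens X.carrier) (h : V ≤ U), X.IsAffineOpen V →
      M.res h m ∈ Set.range (k.hom.app (op V))) : m ∈ Set.range (k.hom.app (op U)) := by
  have hinj := injective_app hX hk
  choose W hWU hxW hW using fun x : U => hX.exists_affine x.2
  choose s hs using fun x : U => hm (W x) (hWU x) (hW x)
  have hcov : U ≤ iSup W := fun x hx => Opens.mem_iSup.2 ⟨⟨x, hx⟩, hxW ⟨x, hx⟩⟩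
  obtain ⟨t, ht, -⟩ := TopCat.Sheaf.existsUnique_gluing' (C := Type u) ⟨K.val, K.isSheaf⟩
    W U (fun x => homOfLE (hWU x)) hcov s fun x y => by
      apply hinj (op (W x ⊓ W y))
      have h₁ := k.app_res (inf_le_left : W x ⊓ W y ≤ W x) (s x)
      have h₂ := k.app_res (inf_le_right : W x ⊓ W y ≤ W y) (s y)
      refine h₁.trans (.trans ?_ h₂.symm)
      rw [hs, hs]
      exact (M.res_res (hWU x) inf_le_left m).symm.trans (M.res_res (hWU y) inf_le_right m)
  refine ⟨t, M.ext_local fun x hx => ⟨W ⟨x, hx⟩, hWU _, hxW _, ?_⟩⟩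
  rw [← k.app_res, ← hs]
  exact congrArg _ (ht ⟨x, hx⟩)

theorem normal_zero (hX : X.IsM0Scheme) (M N : SetSheaf X) : Normal (0 : M ⟶ N) :=
  (normal_iff hX _).2 fun _ _ _ _ _ => Or.inr rfl

theorem normal_of_injective (hX : X.IsM0Scheme) {M N : SetSheaf X} (f : M ⟶ N)
    (hf : ∀ U, X.IsAffineOpen U → Function.Injective (f.hom.app (op U))) : Normal f :=
  (normal_iff hX _).2 fun U hU _ _ h => Or.inl (hf U hU h)

end SetSheaf

namespace FModule

variable {𝒳 : F1Scheme.{u}}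

theorem isZero_sch {Z : FModule 𝒳} (h : IsZero Z) : IsZero Z.sch :=
  (IsZero.iff_id_eq_zero _).2 (congrArg Hom.sch (h.eq_of_src (𝟙 Z) 0))

theorem eq_zero_of_isZero {Z : FModule 𝒳} (h : IsZero Z) {U} (z : Z.mon.val.obj U) : z = 0 :=
  congrArg (fun f : Z ⟶ Z => f.mon.hom.app U z) (h.eq_of_src (𝟙 Z) 0)

theorem normal_zero (M N : FModule 𝒳) : Normal (0 : M ⟶ N) :=
  ⟨SetSheaf.normal_zero 𝒳.isM0Scheme _ _, isFlatAlong_zero _⟩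

/-- Componentwise description of the admissible short exact sequences. -/
structure IsShortExact {L M N : FModule 𝒳} (i : L ⟶ M) (p : M ⟶ N) : Prop where
  injective (U) (hU : 𝒳.mon.IsAffineOpen U) : Function.Injective (i.mon.hom.app (op U))
  isQuotient : SetSheaf.IsQuotient i.mon p.mon
  zero : i.sch ≫ p.sch = 0
  shortExact : (ShortComplex.mk i.sch p.sch zero).ShortExact
  mono : Mono ((Scheme.Modules.pullback 𝒳.ev).map i.sch)

namespace IsShortExact

variable {L M N : FModule 𝒳} {i : L ⟶ M} {p : M ⟶ N}

theorem mono_sch (h : IsShortExact i p) : Mono i.sch := h.shortExact.mono_f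

theorem epi_sch (h : IsShortExact i p) : Epi p.sch := h.shortExact.epi_g

theorem comp_eq_zero (h : IsShortExact i p) : i ≫ p = 0 := by
  ext1
  · exact h.isQuotient.zero
  · exact h.zero

theorem app_app (h : IsShortExact i p) {U} (x : L.mon.val.obj U) :
    p.mon.hom.app U (i.mon.hom.app U x) = 0 :=
  congrArg (fun f : L.mon ⟶ N.mon => f.hom.app U x) h.isQuotient.zero

theorem mem_range (h : IsShortExact i p) {U} (hU : 𝒳.mon.IsAffineOpen U) {m}
    (hm : p.mon.hom.app (op U) m = 0) : m ∈ Set.range (i.mon.hom.app (op U)) := by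
  rcases h.isQuotient.eq_or_mem U hU m 0 (hm.trans (p.mon.map_zero _).symm) with rfl | h
  · exact ⟨0, i.mon.map_zero _⟩
  · exact h.1

theorem isKer (h : IsShortExact i p) : IsKer i p where
  injective := SetSheaf.injective_app 𝒳.isM0Scheme h.injective
  mem_range U m := by
    constructor
    · intro hm
      refine SetSheaf.mem_range_of_affine 𝒳.isM0Scheme _ h.injective U.unop m fun V hVU hV =>
        h.mem_range hV ?_
      rw [p.mon.app_res]
      exact (congrArg (N.mon.res hVU) hm).trans (N.mon.res_zero _)
    · rintro ⟨x, rfl⟩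
      exact h.app_app x
  zero := h.zero
  isLimit := have := h.mono_sch; ⟨h.shortExact.exact.fIsKernel⟩
  mono := h.mono

theorem normal_left (h : IsShortExact i p) : Normal i :=
  have := h.mono_sch
  ⟨SetSheaf.normal_of_injective 𝒳.isM0Scheme _ h.injective, (isFlatAlong_iff_of_mono _ _).2 h.mono⟩

theorem normal_right (h : IsShortExact i p) : Normal p := by
  have := h.epi_sch
  have := h.mono
  refine ⟨h.isQuotient.normal 𝒳.isM0Scheme, (isFlatAlong_iff_of_epi _ _).2 ?_⟩
  -- Up to isomorphism, `i` is the kernel of `p` on the scheme, so the flatness of `p` is the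
  -- condition that the pullback of `i` is a monomorphism.
  let e := IsLimit.conePointUniqueUpToIso (kernelIsKernel p.sch) h.isKer.isLimit.some
  have he : e.hom ≫ i.sch = kernel.ι p.sch :=
    IsLimit.conePointUniqueUpToIso_hom_comp _ _ WalkingParallelPair.zero
  rw [← he, Functor.map_comp]
  infer_instance

theorem of_iso {L' M' N' : FModule 𝒳} {i' : L' ⟶ M'} {p' : M' ⟶ N'} (h : IsShortExact i p)
    (a : L ⟶ L') (b : M ⟶ M') (c : N ⟶ N') [IsIso a] [IsIso b] [IsIso c] (hi : a ≫ i' = i ≫ b)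
    (hp : b ≫ p' = p ≫ c) : IsShortExact i' p' := by
  have hi' (U x) : i'.mon.hom.app U (a.mon.hom.app U x) = b.mon.hom.app U (i.mon.hom.app U x) :=
    congrArg (fun f : L ⟶ M' => f.mon.hom.app U x) hi
  have hp' (U x) : p'.mon.hom.app U (b.mon.hom.app U x) = c.mon.hom.app U (p.mon.hom.app U x) :=
    congrArg (fun f : M ⟶ N' => f.mon.hom.app U x) hp
  have hz : i' ≫ p' = 0 := by
    rw [← cancel_epi a, ← Category.assoc, hi, Category.assoc, hp, ← Category.assoc,
      h.comp_eq_zero, zero_comp, comp_zero]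
  have := h.mono
  refine
    { injective := fun U hU x y e => ?_
      isQuotient :=
        { zero := congrArg Hom.mon hz
          surjective := fun U hU z => ?_
          eq_or_mem := fun U hU x y e => ?_ }
      zero := congrArg Hom.sch hz
      shortExact := ?_
      mono := ?_ }
  · obtain ⟨x, rfl⟩ := (bijective_app a _).2 x
    obtain ⟨y, rfl⟩ := (bijective_app a _).2 y
    rw [hi', hi'] at e
    rw [h.injective U hU ((bijective_app b _).1 e)]
  · obtain ⟨z, rfl⟩ := (bijective_app c _).2 z
    obtain ⟨y, rfl⟩ := h.isQuotient.surjective U hU z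
    exact ⟨_, hp' _ y⟩
  · obtain ⟨x, rfl⟩ := (bijective_app b _).2 x
    obtain ⟨y, rfl⟩ := (bijective_app b _).2 y
    rw [hp', hp'] at e
    refine (h.isQuotient.eq_or_mem U hU x y ((bijective_app c _).1 e)).imp (congrArg _) ?_
    rintro ⟨⟨x, rfl⟩, ⟨y, rfl⟩⟩
    exact ⟨⟨_, hi' _ x⟩, ⟨_, hi' _ y⟩⟩
  · exact ShortComplex.shortExact_of_iso (ShortComplex.isoMk (asIso a.sch) (asIso b.sch)
      (asIso c.sch) (congrArg Hom.sch hi) (congrArg Hom.sch hp)) h.shortExact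
  · have e : i'.sch = inv a.sch ≫ i.sch ≫ b.sch :=
      ((IsIso.inv_comp_eq a.sch).2 (congrArg Hom.sch hi).symm).symm
    rw [e, Functor.map_comp, Functor.map_comp]
    infer_instance

end IsShortExact

/-- Componentwise description of the admissible short exact sequences. -/
theorem isShortExact_iff (h𝒳 : 𝒳.IsNoetherian) {Z L M N Z' : FModule 𝒳} (hL : L.IsCoherent)
    (hM : M.IsCoherent) (hN : N.IsCoherent) (hc : Z'.IsCoherent) (hZ : IsZero Z) (hZ' : IsZero Z')
    (a : Z ⟶ L) (i : L ⟶ M) (p : M ⟶ N) (b : N ⟶ Z') :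
    (ExactAt a i ∧ ExactAt i p ∧ ExactAt p b ∧ Normal i ∧ Normal p) ↔ IsShortExact i p := by
  have ha : a.sch = 0 := (isZero_sch hZ).eq_of_src _ _
  have hb : b.sch = 0 := (isZero_sch hZ').eq_of_tgt _ _
  -- Exactness at `N` can be described by `exactAt_iff` because the zero morphism `b` is normal.
  have hbn : Normal b := by
    rw [hZ'.eq_of_tgt b 0]
    exact normal_zero _ _
  have ha' {U} (m) : m ∈ Set.range (a.mon.hom.app U) ↔ m = 0 := by
    constructor
    · rintro ⟨z, rfl⟩
      rw [eq_zero_of_isZero hZ z, a.mon.map_zero]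
    · rintro rfl
      exact ⟨0, a.mon.map_zero _⟩
  constructor
  · rintro ⟨h₁, h₂, h₃, hi, hp⟩
    obtain ⟨h₁, w₁, h₁'⟩ := (exactAt_iff h𝒳 hL hM a hi).1 h₁
    obtain ⟨h₂, w₂, h₂'⟩ := (exactAt_iff h𝒳 hM hN i hp).1 h₂
    obtain ⟨h₃, w₃, h₃'⟩ := (exactAt_iff h𝒳 hN hc p hbn).1 h₃
    have hmono : Mono i.sch := (ShortComplex.exact_iff_mono _ ha).1 h₁'
    have hepi : Epi p.sch := (ShortComplex.exact_iff_epi _ hb).1 h₃'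
    refine
      { injective := fun U hU x y e => ?_
        isQuotient :=
          { zero := SetSheaf.hom_ext_affine 𝒳.isM0Scheme fun U hU x => (h₂ U hU _).2 ⟨x, rfl⟩
            surjective := fun U hU z => (h₃ U hU z).1 (eq_zero_of_isZero hZ' _)
            eq_or_mem := fun U hU x y e => ?_ }
        zero := w₂
        shortExact := ⟨h₂'⟩
        mono := (isFlatAlong_iff_of_mono _ _).1 hi.2 }
    -- A trivial kernel does not imply injectivity for pointed sets, but it does for normal
    -- morphisms, whose fibres away from the base point have at most one element.
    · refine ((SetSheaf.normal_iff 𝒳.isM0Scheme _).1 hi.1 U hU x y e).elim id fun h => ?_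
      rw [(ha' x).1 ((h₁ U hU x).1 h), (ha' y).1 ((h₁ U hU y).1 (e.symm.trans h))]
    · exact ((SetSheaf.normal_iff 𝒳.isM0Scheme _).1 hp.1 U hU x y e).imp id fun h =>
        ⟨(h₂ U hU x).1 h, (h₂ U hU y).1 (e.symm.trans h)⟩
  · intro h
    have hmono := h.mono_sch
    have hepi := h.epi_sch
    refine ⟨(exactAt_iff h𝒳 hL hM a h.normal_left).2 ⟨fun U hU m => ?_, ?_⟩,
      (exactAt_iff h𝒳 hM hN i h.normal_right).2
        ⟨fun U hU m => h.isKer.mem_range _ m, h.zero, h.shortExact.exact⟩,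
      (exactAt_iff h𝒳 hN hc p hbn).2 ⟨fun U hU m => ?_, ?_⟩, h.normal_left, h.normal_right⟩
    · rw [ha', ← i.mon.map_zero]
      exact (h.injective U hU).eq_iff
    · exact ⟨by rw [ha, zero_comp], (ShortComplex.exact_iff_mono _ ha).2 hmono⟩
    · exact iff_of_true (eq_zero_of_isZero hZ' _) (h.isQuotient.surjective U hU m)
    · exact ⟨by rw [hb, comp_zero], (ShortComplex.exact_iff_epi _ hb).2 hepi⟩

/-- Cokernels of admissible monomorphisms. -/
theorem IsShortExact.exists_of_mono {L M : FModule 𝒳} (hL : L.IsCoherent)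
    (hM : M.IsCoherent) (i : L ⟶ M)
    (hi : ∀ U, 𝒳.mon.IsAffineOpen U → Function.Injective (i.mon.hom.app (op U))) [Mono i.sch]
    (hi' : Mono ((Scheme.Modules.pullback 𝒳.ev).map i.sch)) :
    ∃ (N : FModule 𝒳) (_ : N.IsCoherent) (p : M ⟶ N), IsShortExact i p := by
  have hq := SetSheaf.isQuotient_toQuotient i.mon
  obtain ⟨w, ⟨hc⟩⟩ := hq.isColimit
  have hc' := CokernelCofork.mapIsColimit _ (cokernelIsCokernel i.sch)
    (Scheme.Modules.pullback 𝒳.ev)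
  -- Base extension and pullback both preserve cokernels, so the identification of the two versions
  -- of `i` induces the structure isomorphism of the cokernel.
  let φ : Arrow.mk (SetSheaf.baseChange.map i.mon) ≅
      Arrow.mk ((Scheme.Modules.pullback 𝒳.ev).map i.sch) :=
    Arrow.isoMk L.iso M.iso i.comm.symm
  let N : FModule 𝒳 :=
    { mon := SetSheaf.quotient i.mon
      sch := cokernel i.sch
      iso := CokernelCofork.mapIsoOfIsColimit hc hc' φ }
  refine ⟨N, ⟨hq.isCoherent 𝒳.isM0Scheme hL.1 hM.1, hL.2.cokernel hM.2 _⟩,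
    ⟨SetSheaf.toQuotient i.mon, cokernel.π i.sch,
      CokernelCofork.π_mapOfIsColimit hc _ φ.hom⟩, ?_⟩
  exact
    { injective := hi
      isQuotient := hq
      zero := cokernel.condition _
      shortExact :=
        { exact := ShortComplex.exact_of_g_is_cokernel _ (cokernelIsCokernel i.sch)
          mono_f := inferInstance
          epi_g := inferInstanceAs (Epi (cokernel.π i.sch)) }
      mono := hi' }

/-- Kernels of admissible epimorphisms. -/
theorem IsShortExact.exists_of_epi (h𝒳 : 𝒳.IsNoetherian) {M N : FModule 𝒳} (hM : M.IsCoherent)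
    (hN : N.IsCoherent) {p : M ⟶ N} (hp : Normal p)
    (hs : ∀ U, 𝒳.mon.IsAffineOpen U → Function.Surjective (p.mon.hom.app (op U))) [Epi p.sch] :
    ∃ (L : FModule 𝒳) (_ : L.IsCoherent) (i : L ⟶ M), IsShortExact i p := by
  obtain ⟨L, hL, i, hi⟩ := exists_isKer h𝒳 hM hN hp
  have := hi.mono_sch
  exact ⟨L, hL, i,
    { injective := fun U _ => hi.injective _
      isQuotient :=
        { zero := congrArg Hom.mon hi.comp_eq_zero
          surjective := hs
          eq_or_mem := fun U hU x y e =>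
            ((SetSheaf.normal_iff 𝒳.isM0Scheme _).1 hp.1 U hU x y e).imp id fun h =>
              ⟨(hi.mem_range _ x).1 h, (hi.mem_range _ y).1 (e.symm.trans h)⟩ }
      zero := hi.zero
      shortExact := ⟨hi.exact⟩
      mono := hi.mono }⟩

namespace IsShortExact

/-- Composition of admissible epimorphisms. -/
theorem exists_comp_right (h𝒳 : 𝒳.IsNoetherian) {L M N L' P : FModule 𝒳} (hM : M.IsCoherent)
    (hP : P.IsCoherent) {i : L ⟶ M} {p : M ⟶ N} {k : L' ⟶ N} {q : N ⟶ P} (h : IsShortExact i p)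
    (h' : IsShortExact k q) :
    ∃ (K : FModule 𝒳) (_ : K.IsCoherent) (j : K ⟶ M), IsShortExact j (p ≫ q) := by
  have := h.epi_sch
  have := h'.epi_sch
  have := h.normal_right.2.1
  have := h'.normal_right.2.1
  have : Epi (p ≫ q).sch := inferInstanceAs (Epi (p.sch ≫ q.sch))
  refine exists_of_epi h𝒳 hM hP ⟨(SetSheaf.normal_iff 𝒳.isM0Scheme _).2 fun U hU x y e => ?_,
    (isFlatAlong_iff_of_epi _ _).2 ?_⟩ fun U hU =>
      (h'.isQuotient.surjective U hU).comp (h.isQuotient.surjective U hU)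
  -- If `x` and `y` have the same image in `P`, then by normality of `q` either this image is the
  -- base point or `p x = p y`. In the second case normality of `p` gives `x = y` or `p x = 0`.
  · have key (z) (hz : p.mon.hom.app (op U) z = 0) : (p ≫ q).mon.hom.app (op U) z = 0 :=
      (congrArg (q.mon.hom.app (op U)) hz).trans (q.mon.map_zero _)
    rcases (SetSheaf.normal_iff 𝒳.isM0Scheme _).1 h'.normal_right.1 U hU _ _ e with e | e
    · exact ((SetSheaf.normal_iff 𝒳.isM0Scheme _).1 h.normal_right.1 U hU _ _ e).imp id (key x)
    · exact Or.inr e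
  · exact mono_map_kernelι_comp (Scheme.Modules.pullback 𝒳.ev) p.sch q.sch

/-- Composition of admissible monomorphisms. -/
theorem exists_comp_left {L M N M' N' : FModule 𝒳} (hL : L.IsCoherent) (hM' : M'.IsCoherent)
    {i : L ⟶ M} {p : M ⟶ N} {k : M ⟶ M'} {q : M' ⟶ N'} (h : IsShortExact i p)
    (h' : IsShortExact k q) :
    ∃ (P : FModule 𝒳) (_ : P.IsCoherent) (r : M' ⟶ P), IsShortExact (i ≫ k) r := by
  have := h.mono_sch
  have := h'.mono_sch
  have := h.mono
  have := h'.mono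
  have : Mono (i ≫ k).sch := inferInstanceAs (Mono (i.sch ≫ k.sch))
  refine exists_of_mono hL hM' _ (fun U hU => (h'.injective U hU).comp (h.injective U hU)) ?_
  rw [comp_sch, Functor.map_comp]
  infer_instance

/-- The fibre product of an admissible monomorphism and an admissible epimorphism. -/
theorem exists_isPullback (h𝒳 : 𝒳.IsNoetherian) {L M N P Q : FModule 𝒳} (hM : M.IsCoherent)
    (hP : P.IsCoherent) (hQ : Q.IsCoherent) {i : M ⟶ N} {q : N ⟶ Q} {l : L ⟶ P} {j : P ⟶ N}
    (hi : IsShortExact i q) (hj : IsShortExact l j) :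
    ∃ (K : FModule 𝒳) (_ : K.IsCoherent) (j' : K ⟶ M) (i' : K ⟶ P), IsPullback j' i' i j ∧
      IsShortExact i' (j ≫ q) ∧
        ∃ (K' : FModule 𝒳) (_ : K'.IsCoherent) (l' : K' ⟶ K), IsShortExact l' j' := by
  -- As `M` is the kernel of `q`, a section of `P` is mapped into `M` if and only if it is killed by
  -- `j ≫ q`. Hence the fibre product is the kernel of this composition of admissible epimorphisms.
  obtain ⟨K, hK, k, hk⟩ := hj.exists_comp_right h𝒳 hP hQ hi
  obtain ⟨j', hj'⟩ := hi.isKer.exists_lift (k ≫ j) (by rw [Category.assoc, hk.comp_eq_zero])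
  have hmi := hi.mono_sch
  have hmk := hk.mono_sch
  have hej := hj.epi_sch
  have : Mono i := mono_of_components i hi.isKer.injective
  have : Mono k := mono_of_components k hk.isKer.injective
  have happ (U x) : i.mon.hom.app U (j'.mon.hom.app U x) = j.mon.hom.app U (k.mon.hom.app U x) :=
    congrArg (fun f : K ⟶ N => f.mon.hom.app U x) hj'
  have hsch : j'.sch ≫ i.sch = k.sch ≫ j.sch := congrArg Hom.sch hj'
  have hpb : IsPullback j' k i j := by
    -- Since `i` is a monomorphism, the component in `M` of a cone is determined by the component in
    -- `P`, and only the latter has to be lifted to `K`.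
    have hl {T : FModule 𝒳} (s : T ⟶ M) (t : T ⟶ P) (hst : s ≫ i = t ≫ j) :
        ∃ u : T ⟶ K, u ≫ k = t :=
      hk.isKer.exists_lift t (by
        rw [← Category.assoc, ← hst, Category.assoc, hi.comp_eq_zero, comp_zero])
    choose u hu using fun {T : FModule 𝒳} (s : T ⟶ M) (t : T ⟶ P) (hst : s ≫ i = t ≫ j) =>
      hl s t hst
    exact ⟨⟨hj'⟩, ⟨PullbackCone.IsLimit.mk _ (fun s => u s.fst s.snd s.condition)
      (fun s => by
        rw [← cancel_mono i, Category.assoc, hj', ← Category.assoc, hu, s.condition])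
      (fun s => hu _ _ _)
      fun s m _ hm => (cancel_mono k).1 (hm.trans (hu _ _ _).symm)⟩⟩
  have hepi : Epi j'.sch := by
    rw [epi_iff_surjective_up_to_refinements]
    intro T y
    obtain ⟨T', π, hπ, x, hx⟩ := surjective_up_to_refinements_of_epi j.sch (y ≫ i.sch)
    obtain ⟨z, hz⟩ := KernelFork.IsLimit.lift' hk.isKer.isLimit.some x (by
      have := congrArg (· ≫ q.sch) hx
      simp only [Category.assoc, hi.zero, comp_zero] at this
      exact this.symm)
    replace hz : z ≫ k.sch = x := hz
    refine ⟨T', π, hπ, z, ?_⟩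
    rw [← cancel_mono i.sch, Category.assoc, hx, Category.assoc, hsch, ← Category.assoc, hz]
  refine ⟨K, hK, j', k, hpb, hk, exists_of_epi h𝒳 hK hM
    ⟨(SetSheaf.normal_iff 𝒳.isM0Scheme _).2 fun U hU x y e => ?_,
    (isFlatAlong_iff_of_epi _ _).2 ?_⟩ fun U hU m => ?_⟩
  · have e' : j.mon.hom.app (op U) (k.mon.hom.app (op U) x) =
        j.mon.hom.app (op U) (k.mon.hom.app (op U) y) := by
      rw [← happ, ← happ, e]
    refine ((SetSheaf.normal_iff 𝒳.isM0Scheme _).1 hj.normal_right.1 U hU _ _ e').imp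
      (fun h => hk.injective U hU h) fun h => hi.injective U hU ?_
    rw [happ, h, i.mon.map_zero]
  -- The kernels of `j'` and `j` agree: `ker j` is contained in `K = ker (j ≫ q)`, and `i` is a
  -- monomorphism. The pullback of `ker j' ⟶ K ⟶ P` therefore inherits injectivity from that of `ker
  -- j ⟶ P`.
  · obtain ⟨s, hs⟩ := KernelFork.IsLimit.lift' hk.isKer.isLimit.some (kernel.ι j.sch) (by
      rw [comp_sch, kernel.condition_assoc, zero_comp])
    replace hs : s ≫ k.sch = kernel.ι j.sch := hs
    let e : kernel j'.sch ⟶ kernel j.sch := kernel.lift _ (kernel.ι j'.sch ≫ k.sch) (by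
      rw [Category.assoc, ← hsch, kernel.condition_assoc, zero_comp])
    have he : e ≫ kernel.ι j.sch = kernel.ι j'.sch ≫ k.sch := kernel.lift_ι _ _ _
    let e' : kernel j.sch ⟶ kernel j'.sch := kernel.lift _ s (by
      rw [← cancel_mono i.sch, Category.assoc, hsch, ← Category.assoc, hs, kernel.condition,
        zero_comp])
    have hee : e ≫ e' = 𝟙 _ := by
      have he' : e' ≫ kernel.ι j'.sch = s := kernel.lift_ι _ _ _
      rw [← cancel_mono (kernel.ι j'.sch), ← cancel_mono k.sch, Category.assoc e, he',
        Category.assoc, hs, he, Category.id_comp]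
    -- A left inverse is enough here, as every functor preserves split monomorphisms.
    have : IsSplitMono e := IsSplitMono.mk' ⟨e', hee⟩
    have := hj.normal_right.2.1
    have : Mono ((Scheme.Modules.pullback 𝒳.ev).map (kernel.ι j'.sch) ≫
        (Scheme.Modules.pullback 𝒳.ev).map k.sch) := by
      rw [← Functor.map_comp, ← he, Functor.map_comp]
      infer_instance
    exact mono_of_mono _ ((Scheme.Modules.pullback 𝒳.ev).map k.sch)
  -- A preimage of `i m` under `j` is killed by `j ≫ q`, so it belongs to `K`.
  · obtain ⟨x, hx⟩ := hj.isQuotient.surjective U hU (i.mon.hom.app (op U) m)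
    obtain ⟨y, rfl⟩ := hk.mem_range hU (m := x)
      ((congrArg (q.mon.hom.app (op U)) hx).trans (hi.app_app m))
    exact ⟨y, hi.injective U hU ((happ _ y).trans hx)⟩

end IsShortExact

end FModule

/-! ### The quasi-exact category of coherent modules -/

section Coh

open FModule

variable {𝒳 : F1Scheme.{u}}

theorem admissible_iff (h𝒳 : 𝒳.IsNoetherian) (S : ComposableArrows (Coh 𝒳) 4) :
    Admissible 𝒳 S ↔ IsZero (S.obj' 0).obj ∧ IsZero (S.obj' 4).obj ∧
      IsShortExact (S.map' 1 2).hom (S.map' 2 3).hom :=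
  and_congr_right fun hZ => and_congr_right fun hZ' =>
    isShortExact_iff h𝒳 (S.obj' 1).property (S.obj' 2).property (S.obj' 3).property
      (S.obj' 4).property hZ hZ' _ _ _ _

theorem admissible_mk₄_iff (h𝒳 : 𝒳.IsNoetherian) {Z L M N Z' : Coh 𝒳} (a : Z ⟶ L) (i : L ⟶ M)
    (p : M ⟶ N) (b : N ⟶ Z') : Admissible 𝒳 (.mk₄ a i p b) ↔
      IsZero Z.obj ∧ IsZero Z'.obj ∧ IsShortExact i.hom p.hom :=
  admissible_iff h𝒳 _

/-- The outer terms carry no information beyond the existence of a coherent zero object. No such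
object is constructed: the one from a given admissible sequence is kept and serves at both ends of
the new sequences. -/
theorem admissibleMono_iff (h𝒳 : 𝒳.IsNoetherian) {L M : Coh 𝒳} (i : L ⟶ M) :
    AdmissibleMono (Admissible 𝒳) i ↔ (∃ Z : Coh 𝒳, IsZero Z.obj) ∧
      ∃ (N : FModule 𝒳) (_ : N.IsCoherent) (p : M.obj ⟶ N), IsShortExact i.hom p := by
  constructor
  · rintro ⟨Z, P, Z', a, p, b, h⟩
    have h := (admissible_mk₄_iff h𝒳 _ _ _ _).1 h
    exact ⟨⟨Z, h.1⟩, P.obj, P.property, p.hom, h.2.2⟩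
  · rintro ⟨⟨Z, hZ⟩, N, hN, p, h⟩
    exact ⟨Z, ⟨N, hN⟩, Z, ObjectProperty.homMk 0, ObjectProperty.homMk p, ObjectProperty.homMk 0,
      (admissible_mk₄_iff h𝒳 _ _ _ _).2 ⟨hZ, hZ, h⟩⟩

theorem admissibleEpi_iff (h𝒳 : 𝒳.IsNoetherian) {M N : Coh 𝒳} (p : M ⟶ N) :
    AdmissibleEpi (Admissible 𝒳) p ↔ (∃ Z : Coh 𝒳, IsZero Z.obj) ∧
      ∃ (L : FModule 𝒳) (_ : L.IsCoherent) (i : L ⟶ M.obj), IsShortExact i p.hom := by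
  constructor
  · rintro ⟨Z, P, Z', a, i, b, h⟩
    have h := (admissible_mk₄_iff h𝒳 _ _ _ _).1 h
    exact ⟨⟨Z, h.1⟩, P.obj, P.property, i.hom, h.2.2⟩
  · rintro ⟨⟨Z, hZ⟩, L, hL, i, h⟩
    exact ⟨Z, ⟨L, hL⟩, Z, ObjectProperty.homMk 0, ObjectProperty.homMk i, ObjectProperty.homMk 0,
      (admissible_mk₄_iff h𝒳 _ _ _ _).2 ⟨hZ, hZ, h⟩⟩

theorem Admissible.of_iso (h𝒳 : 𝒳.IsNoetherian) {S T : ComposableArrows (Coh 𝒳) 4} (e : S ≅ T)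
    (h : Admissible 𝒳 S) : Admissible 𝒳 T := by
  rw [admissible_iff h𝒳] at h ⊢
  let f : S ⋙ ObjectProperty.ι _ ≅ T ⋙ ObjectProperty.ι _ := Functor.isoWhiskerRight e _
  exact ⟨h.1.of_iso (f.app (0 : Fin 5)).symm, h.2.1.of_iso (f.app (4 : Fin 5)).symm,
    h.2.2.of_iso (f.hom.app (1 : Fin 5)) (f.hom.app (2 : Fin 5)) (f.hom.app (3 : Fin 5))
      (f.hom.naturality (homOfLE (by decide : (1 : Fin 5) ≤ 2))).symm
      (f.hom.naturality (homOfLE (by decide : (2 : Fin 5) ≤ 3))).symm⟩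

/-- The fibre product of an admissible monomorphism and an admissible epimorphism in `Coh 𝒳`. -/
theorem exists_isPullback (h𝒳 : 𝒳.IsNoetherian) {M N P : Coh 𝒳} (i : M ⟶ N) (j : P ⟶ N)
    (hi : AdmissibleMono (Admissible 𝒳) i) (hj : AdmissibleEpi (Admissible 𝒳) j) :
    ∃ (K : Coh 𝒳) (j' : K ⟶ M) (i' : K ⟶ P), IsPullback j' i' i j ∧
      AdmissibleMono (Admissible 𝒳) i' ∧ AdmissibleEpi (Admissible 𝒳) j' := by
  obtain ⟨hZ, Q, hQ, q, hi⟩ := (admissibleMono_iff h𝒳 _).1 hi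
  obtain ⟨-, L, hL, l, hj⟩ := (admissibleEpi_iff h𝒳 _).1 hj
  obtain ⟨K, hK, j', i', hpb, hi', hj'⟩ :=
    hi.exists_isPullback h𝒳 M.property P.property hQ hj
  exact ⟨⟨K, hK⟩, ObjectProperty.homMk j', ObjectProperty.homMk i',
    IsPullback.of_map (ObjectProperty.ι _) (by ext1; exact hpb.w) hpb,
    (admissibleMono_iff h𝒳 _).2 ⟨hZ, Q, hQ, _, hi'⟩, (admissibleEpi_iff h𝒳 _).2 ⟨hZ, hj'⟩⟩

theorem isQuasiExact_admissible (h𝒳 : 𝒳.IsNoetherian) : IsQuasiExact (Admissible 𝒳) where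
  of_iso := Admissible.of_iso h𝒳
  mono_comp {L M N} i j hi hj := by
    obtain ⟨hZ, _, _, _, hi⟩ := (admissibleMono_iff h𝒳 _).1 hi
    obtain ⟨-, _, _, _, hj⟩ := (admissibleMono_iff h𝒳 _).1 hj
    exact (admissibleMono_iff h𝒳 _).2 ⟨hZ, hi.exists_comp_left L.property N.property hj⟩
  epi_comp {L M N} p q hp hq := by
    obtain ⟨hZ, _, _, _, hp⟩ := (admissibleEpi_iff h𝒳 _).1 hp
    obtain ⟨-, _, _, _, hq⟩ := (admissibleEpi_iff h𝒳 _).1 hq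
    exact (admissibleEpi_iff h𝒳 _).2 ⟨hZ, hp.exists_comp_right h𝒳 L.property N.property hq⟩
  hasPullback i j hi hj := by
    obtain ⟨_, _, _, h, -⟩ := exists_isPullback h𝒳 i j hi hj
    exact h.hasPullback
  pullback {K M N P} i j hi hj j' i' h := by
    obtain ⟨K', j'', i'', h', hi', hj'⟩ := exists_isPullback h𝒳 i j hi hj
    obtain ⟨hZ, Q, hQ, q, hi'⟩ := (admissibleMono_iff h𝒳 _).1 hi'
    obtain ⟨-, L, hL, l, hj'⟩ := (admissibleEpi_iff h𝒳 _).1 hj'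
    -- An arbitrary fibre product is isomorphic to the constructed one, and the componentwise
    -- conditions are transported along this isomorphism.
    let e : K' ≅ K := h'.isoIsPullback _ _ h
    let f : K'.obj ≅ K.obj := (ObjectProperty.ι _).mapIso e
    have hf₁ : f.hom ≫ i'.hom = i''.hom :=
      congrArg (·.hom) (h'.isoIsPullback_hom_snd _ _ h)
    have hf₂ : f.hom ≫ j'.hom = j''.hom :=
      congrArg (·.hom) (h'.isoIsPullback_hom_fst _ _ h)
    refine ⟨(admissibleMono_iff h𝒳 _).2 ⟨hZ, Q, hQ, q, ?_⟩,
      (admissibleEpi_iff h𝒳 _).2 ⟨hZ, L, hL, l ≫ f.hom, ?_⟩⟩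
    · exact hi'.of_iso f.hom (𝟙 _) (𝟙 _) (by rw [hf₁, Category.comp_id]) (by simp)
    · exact hj'.of_iso (𝟙 _) f.hom (𝟙 _) (Category.id_comp _) (by rw [hf₂, Category.comp_id])

end Coh

end F1

end

/-- The category of coherent sheaves on a Noetherian `𝔽₁`-scheme, with the class of admissible short
exact sequences, is quasi-exact. -/
theorem mainTheorem4 (𝒳 : F1.F1Scheme.{u}) (h𝒳 : 𝒳.IsNoetherian) :
    F1.IsQuasiExact (F1.Admissible 𝒳) := by
  exact F1.isQuasiExact_admissible h𝒳
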